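/- There are universal constants $C, C_1>0$ such that the following holds. Let $d,h,m,n\ge 1$ be integers with $m>1$, let $\tau>0$, and let $\mathcal{H}_m^{\otimes h}$ denote the Hermitian matrices of size $m^h\times m^h$. For such a matrix $A$ put $|||A|||_2^2=m^{-h}\,\mathrm{Tr}(A^\dagger A)$. Let $\mathcal B_0=I,\mathcal B_1,\dots,\mathcal B_{m^2-1}$ be Hermitian $m\times m$ matrices that are orthonormal for $\langle P,Q\rangle=\frac1m\mathrm{Tr}\,P^\dagger Q$, and for $\sigma\in\{0,\dots,m^2-1\}^h$ let $\mathcal B_\sigma=\bigotimes_{i}\mathcal B_{\sigma_i}$, $|\sigma|=\#\{i:\sigma_i\ne0\}$ and $\widehat A(\sigma)=m^{-h}\,\mathrm{Tr}(\mathcal B_\sigma^\dagger A)$. Let $\deg A=\max\{|\sigma|:\widehat A(\sigma)\neq0\}$, with $\deg 0=-\infty$. Let $$P(b)=\sum_{S\subseteq[n]}b_SP_S,\qquad b_S=\prod_{i\in S}b_i,\quad P_S\in\mathcal{H}_m^{\otimes h},\quad b\in\{\pm1\}^n,$$ be such that $\mathbb{E}_{b}\,|||P(b)|||_2^2\le1$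 for $b$ uniform in $\{\pm1\}^n$, $|S|+\deg(P_S)\le d$ for all $S\subseteq[n]$, and $\mathrm{VarInf}_i(P)=\sum_{S\ni i}|||P_S|||_2^2\le\tau$ for all $i\in[n]$. Call a random element $w$ of $\Sigma^n$ ($\Sigma$ a finite set) $k$-wise uniform if for all $j\le k$, all distinct $x_1,\dots,x_j\in[n]$ and all $y_1,\dots,y_j\in\Sigma$ we have $\Pr[w_{x_1}=y_1\wedge\dots\wedge w_{x_j}=y_j]=|\Sigma|^{-j}$. Let $p\ge d/\tau$ be an integer (for example the smallest power of $2$ that is at least $d/\tau$), and let $\mathcal F$ be a finite family of functions $[n]\to[p]$ (repetitions allowed) that is pairwise uniform, i.e. a uniformly random member $\mathbf f$ of $\mathcal F$ is $2$-wise uniform. Let $\mathbf z^1,\dots,\mathbf z^p$ be independent random vectors in $\{\pm1\}^n$, each of them $4d$-wise uniform, and independent of $\mathbf f$. For $f\in\mathcal F$ define $\mathbf x_f\in\{\pm1\}^n$ by $(\mathbf x_f)_i=\mathbf z^{f(i)}_i$. For $g:\mathbb R\to\mathbb R$ and a Hermitian matrix $A=\sum_i\lambda_i\,v_iv_i^\dagger$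 (spectral decomposition) write $g(A)=\sum_ig(\lambda_i)\,v_iv_i^\dagger$, and let $\zeta(x)=x^2$ for $x\le0$ and $\zeta(x)=0$ for $x>0$. Then: 1. $$\left|\frac1{m^h}\mathbb E_{b}\,\mathrm{Tr}\,\zeta(P(b))-\frac1{m^h}\mathbb E_{\mathbf f,\mathbf x_{\mathbf f}}\,\mathrm{Tr}\,\zeta(P(\mathbf x_{\mathbf f}))\right|\le C\sqrt{(9m)^d\,d\,\tau}.$$ 2. For every $\xi\in C^4(\mathbb R)$ and every $C_0$ with $\sup_{x}|\xi^{(4)}(x)|\le C_0$, $$\left|\frac1{m^h}\mathbb E_{b}\,\mathrm{Tr}\,\xi(P(b))-\frac1{m^h}\mathbb E_{\mathbf f,\mathbf x_{\mathbf f}}\,\mathrm{Tr}\,\xi(P(\mathbf x_{\mathbf f}))\right|\le 4C_1C_0\,(9m)^d\,d\,\tau.$$ -/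

import Mathlib

open MeasureTheory ProbabilityTheory Finset
open scoped BigOperators

namespace DerandInv

noncomputable section

/-- Operators on `h` registers of dimension `m`: matrices of size `m ^ h`, whose rows and columns
are indexed by the computational basis states `Fin h → Fin m`. The Hermitian ones make up the
`h`-fold tensor power of the real space of Hermitian `m × m` matrices. -/
abbrev Op (m h : ℕ) : Type := Matrix (Fin h → Fin m) (Fin h → Fin m) ℂ

/-- A standard orthonormal basis of the `m × m` matrices: Hermitian matrices
`B 0, …, B (m ^ 2 - 1)`, orthonormal for `⟨P, Q⟩ = (1 / m) Tr (P† Q)`, with `B 0 = 1`. -/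
structure IsStdBasis (m : ℕ) (B : Fin (m ^ 2) → Matrix (Fin m) (Fin m) ℂ) : Prop where
  hermitian : ∀ i, (B i).IsHermitian
  orthonormal : ∀ i j, (1 / (m : ℂ)) * ((B i).conjTranspose * B j).trace = if i = j then 1 else 0
  zero_eq_one : ∀ i : Fin (m ^ 2), (i : ℕ) = 0 → B i = 1

/-- The tensor product `B_σ = B_{σ 1} ⊗ ⋯ ⊗ B_{σ h}`. -/
def tensorBasis {m h : ℕ} (B : Fin (m ^ 2) → Matrix (Fin m) (Fin m) ℂ)
    (σ : Fin h → Fin (m ^ 2)) : Op m h :=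
  Matrix.of fun x y => ∏ i, B (σ i) (x i) (y i)

/-- The Fourier coefficient of `A` at `σ`, that is `m ^ (-h) Tr (B_σ† A)`. -/
def fourierCoeff {m h : ℕ} (B : Fin (m ^ 2) → Matrix (Fin m) (Fin m) ℂ) (A : Op m h)
    (σ : Fin h → Fin (m ^ 2)) : ℂ :=
  (1 / (m : ℂ) ^ h) * ((tensorBasis B σ).conjTranspose * A).trace

/-- The number `|σ|` of nonzero entries of `σ`. -/
def weight {k h : ℕ} (σ : Fin h → Fin k) : ℕ :=
  (univ.filter fun i => (σ i : ℕ) ≠ 0).card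

open Classical in
/-- The degree of `A`, the largest `|σ|` over all `σ` with a nonzero Fourier coefficient; the zero
operator has degree `⊥`. -/
def opDegree {m h : ℕ} (B : Fin (m ^ 2) → Matrix (Fin m) (Fin m) ℂ) (A : Op m h) : WithBot ℕ :=
  (univ.filter fun σ : Fin h → Fin (m ^ 2) => fourierCoeff B A σ ≠ 0).sup
    fun σ => ((weight σ : ℕ) : WithBot ℕ)

/-- The square of the normalized 2-norm, `m ^ (-h) Tr (A† A)`. -/
def nnormSq {m h : ℕ} (A : Op m h) : ℝ :=
  (1 / (m : ℝ) ^ h) * (A.conjTranspose * A).trace.re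

/-- The normalized trace `m ^ (-h) Tr f(A)` of the spectral function of `f` at a Hermitian `A`
(the trace is then real). -/
def nTr {m h : ℕ} (f : ℝ → ℝ) (A : Op m h) : ℝ :=
  (1 / (m : ℝ) ^ h) * (cfc f A).trace.re

/-- `P(b) = ∑_S b_S P_S` with `b_S = ∏_{i ∈ S} b_i`, for a sign vector `b` (`ℤˣ = {1, -1}`). -/
def evalAt {m h n : ℕ} (P : Finset (Fin n) → Op m h) (b : Fin n → ℤˣ) : Op m h :=
  ∑ S : Finset (Fin n), (∏ i ∈ S, ((b i : ℤ) : ℝ)) • P S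

/-- The influence of the `i`-th variable, `∑_{S ∋ i}` of the squared normalized 2-norm of `P_S`. -/
def varInf {m h n : ℕ} (P : Finset (Fin n) → Op m h) (i : Fin n) : ℝ :=
  ∑ S ∈ univ.filter (fun S : Finset (Fin n) => i ∈ S), nnormSq (P S)

/-- `ζ(x) = x ^ 2` for `x ≤ 0` and `0` otherwise. -/
def zeta (x : ℝ) : ℝ := if x ≤ 0 then x ^ 2 else 0

/-- A finite family of functions `[n] → [p]`, with a uniformly random member `F a`, is `k`-wise
uniform: its values at any `j ≤ k` distinct points are jointly uniform. (For `k ≤ n` the case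
`j = k` implies the others.) -/
def HashUniform {ι : Type*} [Fintype ι] {n p : ℕ} (k : ℕ) (F : ι → Fin n → Fin p) : Prop :=
  ∀ j ≤ k, ∀ x : Fin j ↪ Fin n, ∀ y : Fin j → Fin p,
    ((univ.filter fun a => ∀ t, F a (x t) = y t).card : ℝ) / (Fintype.card ι : ℝ)
      = 1 / (p : ℝ) ^ j

/-- A random sign vector is `k`-wise uniform: any `j ≤ k` distinct coordinates are jointly uniform.
(For `k ≤ n` the case `j = k` implies the others.) -/
def SignUniform {Ω : Type*} [MeasurableSpace Ω] (μ : Measure Ω) {n : ℕ} (k : ℕ)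
    (z : Ω → Fin n → ℤˣ) : Prop :=
  ∀ j ≤ k, ∀ x : Fin j ↪ Fin n, ∀ y : Fin j → ℤˣ,
    μ.real {ω | ∀ t, z ω (x t) = y t} = 1 / (2 : ℝ) ^ j

/-- The generator `G(f, z^1, …, z^p) = x` with `x_i = z^{f(i)}_i`. -/
def gen {n p : ℕ} (f : Fin n → Fin p) (z : Fin p → Fin n → ℤˣ) : Fin n → ℤˣ :=
  fun i => z (f i) i

end

end DerandInv

namespace DerandInv

/-! ### Peano kernels of divided differences -/

/-! The proof is a Lindeberg replacement over the `p` blocks into which a hash function cuts the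
variables. Its noncommutative core is a trace Taylor formula with a sharp remainder: for Hermitian A
and Q, and |q''''| ≤ c on an interval containing the spectra of all A + θQ with 0 ≤ θ ≤ 1, Tr q(A +
Q) differs from its third-order expansion by at most (c/24) Tr Q⁴ (`abs_trace_taylor_le`). Since
(c/24)x⁴ ± q has nonnegative fourth derivative, it suffices that q'''' ≥ 0 forces the s⁴ coefficient
of Tr q(A + sQ) to be nonnegative (`traceCoeff_four_nonneg`). In an eigenbasis of A, four times this
coefficient is the sum of q'[λᵢ,λⱼ,λₖ,λₗ] QᵢⱼQⱼₖQₖₗQₗᵢ. Away from coincident nodes, Peano's formula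
writes the divided difference as an integral of q'''' against the third divided difference of a
truncated square. That kernel splits into two separable products (`peanoThree`), each of which turns
the sum into a weighted sum of squared moduli (`re_sum_peanoThree_nonneg`).

Fix a hash function and a block, and write P = A + Q, where Q collects the terms meeting the block.
As functions of the signs of the block, the Taylor terms of order at most three have degree at most
3d, so a 4d-wise uniform vector and a uniform one give them the same mean. The remainder Tr Q⁴ has
degree at most 4d in all signs, so its mean is the one for uniform signs (`abs_prodExp_block_le`).
Hypercontractivity bounds this mean, normalized, by (9m)ᵈ times the square of the total influence of
the block. Averaging over the hash functions, pairwise uniformity bounds the sum of these squares by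
∑ Iᵢ² + (∑ Iᵢ)²/p, which is at most 2dτ because ∑ Iᵢ ≤ d, Iᵢ ≤ τ and p ≥ d/τ
(`HashUniform.expect_sum_sq_le`).

Hypercontractivity (`hypercontractive`) is proved for the noise operator with parameter (9m)^(-1/4),
viewed as an integral kernel with nonnegative entries. Positivity makes the four-linear inequality
tensorize (`IsHyper.prod`) and pass from nonnegative to complex functions (`IsHyper.norm_bound`), so
only one bit and one qudit need computation.

A general test function is approximated, together with its fourth derivative, by polynomials. The
function ζ is not smooth enough; it is replaced by a smoothing at scale l, and l is chosen to
balance the smoothing error l² against the invariance error of order l⁻². -/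

/-- First divided difference of `u ↦ (max u 0) ^ 2`. -/
noncomputable def peanoOne (u v : ℝ) : ℝ :=
  if 0 < u then (if 0 < v then u + v else u ^ 2 / (u - v))
  else (if 0 < v then v ^ 2 / (v - u) else 0)

/-- Second divided difference of `u ↦ (max u 0) ^ 2`. -/
noncomputable def peanoTwo (u v w : ℝ) : ℝ :=
  if 0 < u then
    (if 0 < v then (if 0 < w then 1 else 1 - w ^ 2 / ((u - w) * (v - w)))
      else (if 0 < w then 1 - v ^ 2 / ((u - v) * (w - v)) else u ^ 2 / ((u - v) * (u - w))))
  else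
    (if 0 < v then
      (if 0 < w then 1 - u ^ 2 / ((v - u) * (w - u)) else v ^ 2 / ((v - u) * (v - w)))
      else (if 0 < w then w ^ 2 / ((w - u) * (w - v)) else 0))

/-- Outer weight in the sum-of-squares form of the third divided difference. -/
noncomputable def sosWeight (x y : ℝ) : ℝ :=
  if x * y < 0 then 1 / |x - y| else |x| + |y|

/-- Inner coefficient in the sum-of-squares form of the third divided difference. -/
noncomputable def sosCoeff (x z y : ℝ) : ℝ :=
  if x * y < 0 then (if 0 < z * y then |x| / |x - z| else |y| / |y - z|)
  else (if z * x < 0 then |z| / (|x - z| * |y - z|) else 0)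

/-- Third divided difference of `u ↦ (max u 0) ^ 2`. -/
noncomputable def peanoThree (u₁ u₂ u₃ u₄ : ℝ) : ℝ :=
  sosWeight u₁ u₃ * sosCoeff u₁ u₂ u₃ * sosCoeff u₁ u₄ u₃
    + sosWeight u₂ u₄ * sosCoeff u₂ u₃ u₄ * sosCoeff u₂ u₁ u₄

lemma sosWeight_nonneg (x y : ℝ) : 0 ≤ sosWeight x y := by
  unfold sosWeight; split_ifs <;> positivity

lemma peanoOne_mul_sub {u v : ℝ} :
    (u - v) * peanoOne u v = max u 0 ^ 2 - max v 0 ^ 2 := by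
  unfold peanoOne
  split_ifs with h1 h2 h2
  · rw [max_eq_left h1.le, max_eq_left h2.le]; ring
  · have : u - v ≠ 0 := by linarith
    rw [max_eq_left h1.le, max_eq_right (not_lt.1 h2)]; field_simp; ring
  · have : v - u ≠ 0 := by linarith
    rw [max_eq_left h2.le, max_eq_right (not_lt.1 h1)]; field_simp; ring
  · rw [max_eq_right (not_lt.1 h1), max_eq_right (not_lt.1 h2)]; ring

/-- In the integrals below the arguments are node minus t, so a zero argument occurs only for
finitely many t and excluding it costs nothing. -/
lemma peanoTwo_mul_sub {u v w : ℝ} (hu : u ≠ 0) (hv : v ≠ 0) (hw : w ≠ 0) :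
    (u - w) * peanoTwo u v w = peanoOne u v - peanoOne v w := by
  rcases lt_or_gt_of_ne hu with hu | hu <;> rcases lt_or_gt_of_ne hv with hv | hv <;>
    rcases lt_or_gt_of_ne hw with hw | hw <;>
    simp only [peanoTwo, peanoOne, hu, hv, hw, not_lt.2 hu.le, not_lt.2 hv.le, not_lt.2 hw.le,
      if_true, if_false]
  · ring
  · have h1 : w - u ≠ 0 := by linarith
    have h2 : w - v ≠ 0 := by linarith
    field_simp; ring
  · have h1 : v - u ≠ 0 := by linarith
    have h2 : v - w ≠ 0 := by linarith
    field_simp; ring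
  · have h1 : v - u ≠ 0 := by linarith
    have h2 : w - u ≠ 0 := by linarith
    field_simp; ring
  · have h1 : u - v ≠ 0 := by linarith
    have h2 : u - w ≠ 0 := by linarith
    field_simp; ring
  · have h1 : u - v ≠ 0 := by linarith
    have h2 : w - v ≠ 0 := by linarith
    field_simp; ring
  · have h1 : u - w ≠ 0 := by linarith
    have h2 : v - w ≠ 0 := by linarith
    field_simp; ring
  · ring

/-- All sixteen sign patterns are checked. If the signs agree, both sides vanish, the truncated
square being quadratic on each half-line. A single positive node u₁ gives u₁² over the product of
its differences, which is one product of a weight and two coefficients; for alternating signs both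
products contribute. Each product separates the two intermediate nodes once the outer pair is fixed,
which is what later produces squares. -/
lemma peanoThree_mul_sub {u₁ u₂ u₃ u₄ : ℝ} (h₁ : u₁ ≠ 0) (h₂ : u₂ ≠ 0) (h₃ : u₃ ≠ 0)
    (h₄ : u₄ ≠ 0) :
    (u₁ - u₄) * peanoThree u₁ u₂ u₃ u₄ = peanoTwo u₁ u₂ u₃ - peanoTwo u₂ u₃ u₄ := by
  have pp : ∀ {x y : ℝ}, 0 < x → 0 < y → 0 < x * y := fun h h' => mul_pos h h'
  have pn : ∀ {x y : ℝ}, 0 < x → y < 0 → x * y < 0 := fun h h' => mul_neg_of_pos_of_neg h h'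
  have np : ∀ {x y : ℝ}, x < 0 → 0 < y → x * y < 0 := fun h h' => mul_neg_of_neg_of_pos h h'
  have nn : ∀ {x y : ℝ}, x < 0 → y < 0 → 0 < x * y := fun h h' => mul_pos_of_neg_of_neg h h'
  have spn : ∀ {x y : ℝ}, 0 < x → y < 0 → |x - y| = x - y := fun h h' => abs_of_pos (by linarith)
  have snp : ∀ {x y : ℝ}, x < 0 → 0 < y → |x - y| = y - x := fun h h' => by
    rw [abs_of_neg (by linarith)]; ring
  have dpn : ∀ {x y : ℝ}, 0 < x → y < 0 → x - y ≠ 0 := fun h h' => by linarith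
  rcases lt_or_gt_of_ne h₁ with h₁ | h₁ <;> rcases lt_or_gt_of_ne h₂ with h₂ | h₂ <;>
    rcases lt_or_gt_of_ne h₃ with h₃ | h₃ <;> rcases lt_or_gt_of_ne h₄ with h₄ | h₄ <;>
    simp only [peanoThree, sosWeight, sosCoeff, peanoTwo, h₁, h₂, h₃, h₄, not_lt.2 h₁.le,
      not_lt.2 h₂.le, not_lt.2 h₃.le, not_lt.2 h₄.le, pp, pn, np, nn, (pp _ _).not_gt,
      (pn _ _).not_gt, (np _ _).not_gt, (nn _ _).not_gt, spn, snp, abs_of_pos, abs_of_neg,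
      if_true, if_false] <;>
    (try have e12 := dpn h₁ h₂) <;> (try have e12 := dpn h₂ h₁) <;>
    (try have e13 := dpn h₁ h₃) <;> (try have e13 := dpn h₃ h₁) <;>
    (try have e14 := dpn h₁ h₄) <;> (try have e14 := dpn h₄ h₁) <;>
    (try have e23 := dpn h₂ h₃) <;> (try have e23 := dpn h₃ h₂) <;>
    (try have e24 := dpn h₂ h₄) <;> (try have e24 := dpn h₄ h₂) <;>
    (try have e34 := dpn h₃ h₄) <;> (try have e34 := dpn h₄ h₃) <;>
    field_simp <;> ring

lemma abs_peanoOne_le (u v : ℝ) : |peanoOne u v| ≤ |u| + |v| := by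
  unfold peanoOne
  split_ifs with h1 h2 h2
  · exact abs_add_le u v
  · have h2 := not_lt.1 h2
    rw [abs_of_nonneg (by apply div_nonneg (sq_nonneg _); linarith), abs_of_pos h1,
      abs_of_nonpos h2, div_le_iff₀ (by linarith)]
    nlinarith
  · have h1 := not_lt.1 h1
    rw [abs_of_nonneg (by apply div_nonneg (sq_nonneg _); linarith), abs_of_pos h2,
      abs_of_nonpos h1, div_le_iff₀ (by linarith)]
    nlinarith
  · rw [abs_zero]; positivity

lemma sq_div_mul_mem {a b c : ℝ} (ha : 0 ≤ a) (hb : a ≤ b) (hc : a ≤ c) :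
    0 ≤ a ^ 2 / (b * c) ∧ a ^ 2 / (b * c) ≤ 1 := by
  have hb' := ha.trans hb
  have hc' := ha.trans hc
  refine ⟨by positivity, div_le_one_of_le₀ ?_ (by positivity)⟩
  rw [sq]; exact mul_le_mul hb hc ha hb'

lemma sq_div_mul_mem' {a b c : ℝ} (ha : a ≤ 0) (hb : -a ≤ b) (hc : -a ≤ c) :
    0 ≤ a ^ 2 / (b * c) ∧ a ^ 2 / (b * c) ≤ 1 := by
  have := sq_div_mul_mem (neg_nonneg.2 ha) hb hc
  rwa [neg_sq] at this

/-- The second derivative of the truncated square takes values in {0, 2}, so its second divided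
differences lie in [0, 1]. -/
lemma abs_peanoTwo_le (u v w : ℝ) : |peanoTwo u v w| ≤ 1 := by
  rw [abs_le]
  unfold peanoTwo
  split_ifs with h1 h2 h3 h3 h2 h3 h3 <;> (try simp only [not_lt] at *)
  · norm_num
  · have := sq_div_mul_mem' (b := u - w) (c := v - w) h3 (by linarith) (by linarith)
    constructor <;> linarith
  · have := sq_div_mul_mem' (b := u - v) (c := w - v) h2 (by linarith) (by linarith)
    constructor <;> linarith
  · have := sq_div_mul_mem (b := u - v) (c := u - w) h1.le (by linarith) (by linarith)
    constructor <;> linarith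
  · have := sq_div_mul_mem' (b := v - u) (c := w - u) h1 (by linarith) (by linarith)
    constructor <;> linarith
  · have := sq_div_mul_mem (b := v - u) (c := v - w) h2.le (by linarith) (by linarith)
    constructor <;> linarith
  · have := sq_div_mul_mem (b := w - u) (c := w - v) h3.le (by linarith) (by linarith)
    constructor <;> linarith
  · norm_num

lemma measurable_peanoOne {f g : ℝ → ℝ} (hf : Measurable f) (hg : Measurable g) :
    Measurable fun t => peanoOne (f t) (g t) := by
  have h1 := measurableSet_lt (measurable_const (a := (0 : ℝ))) hf
  have h2 := measurableSet_lt (measurable_const (a := (0 : ℝ))) hg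
  unfold peanoOne
  refine Measurable.ite h1 (Measurable.ite h2 ?_ ?_) (Measurable.ite h2 ?_ ?_) <;> fun_prop

lemma measurable_peanoTwo {f g h : ℝ → ℝ} (hf : Measurable f) (hg : Measurable g)
    (hh : Measurable h) : Measurable fun t => peanoTwo (f t) (g t) (h t) := by
  have h1 := measurableSet_lt (measurable_const (a := (0 : ℝ))) hf
  have h2 := measurableSet_lt (measurable_const (a := (0 : ℝ))) hg
  have h3 := measurableSet_lt (measurable_const (a := (0 : ℝ))) hh
  unfold peanoTwo
  refine Measurable.ite h1 (Measurable.ite h2 (Measurable.ite h3 ?_ ?_) (Measurable.ite h3 ?_ ?_))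
    (Measurable.ite h2 (Measurable.ite h3 ?_ ?_) (Measurable.ite h3 ?_ ?_)) <;> fun_prop

/-- Continuity in one node carries the integral formulas from distinct to coincident outer nodes. -/
lemma continuousAt_peanoOne {u v : ℝ} (hu : u ≠ 0) :
    ContinuousAt (fun x => peanoOne x v) u := by
  rcases lt_or_gt_of_ne hu with hu | hu
  · have he : ∀ᶠ x in nhds u, (if 0 < v then v ^ 2 / (v - x) else 0) = peanoOne x v := by
      filter_upwards [eventually_lt_nhds hu] with x hx
      simp [peanoOne, not_lt.2 hx.le]
    refine ContinuousAt.congr ?_ he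
    split_ifs with h
    · exact continuousAt_const.div (by fun_prop) (by linarith)
    · exact continuousAt_const
  · have he : ∀ᶠ x in nhds u, (if 0 < v then x + v else x ^ 2 / (x - v)) = peanoOne x v := by
      filter_upwards [eventually_gt_nhds hu] with x hx
      simp [peanoOne, hx]
    refine ContinuousAt.congr ?_ he
    split_ifs with h
    · fun_prop
    · exact ContinuousAt.div (by fun_prop) (by fun_prop) (by have := not_lt.1 h; linarith)

lemma continuousAt_peanoTwo {u v w : ℝ} (hu : u ≠ 0) (hv : v ≠ 0) (hw : w ≠ 0) :
    ContinuousAt (fun x => peanoTwo x v w) u := by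
  rcases lt_or_gt_of_ne hu with hu | hu
  · have he : ∀ᶠ x in nhds u, (if 0 < v then
      (if 0 < w then 1 - x ^ 2 / ((v - x) * (w - x)) else v ^ 2 / ((v - x) * (v - w)))
      else (if 0 < w then w ^ 2 / ((w - x) * (w - v)) else 0)) = peanoTwo x v w := by
      filter_upwards [eventually_lt_nhds hu] with x hx
      simp [peanoTwo, not_lt.2 hx.le]
    refine ContinuousAt.congr ?_ he
    rcases lt_or_gt_of_ne hv with hv | hv <;> rcases lt_or_gt_of_ne hw with hw | hw <;>
      simp only [hv, hw, not_lt.2 hv.le, not_lt.2 hw.le, if_true, if_false]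
    · exact continuousAt_const
    · exact ContinuousAt.div (by fun_prop) (by fun_prop)
        (mul_ne_zero (by linarith) (by linarith))
    · exact ContinuousAt.div (by fun_prop) (by fun_prop)
        (mul_ne_zero (by linarith) (by linarith))
    · exact continuousAt_const.sub (ContinuousAt.div (by fun_prop) (by fun_prop)
        (mul_ne_zero (by linarith) (by linarith)))
  · have he : ∀ᶠ x in nhds u, (if 0 < v then
      (if 0 < w then 1 else 1 - w ^ 2 / ((x - w) * (v - w)))
      else (if 0 < w then 1 - v ^ 2 / ((x - v) * (w - v)) else x ^ 2 / ((x - v) * (x - w))))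
        = peanoTwo x v w := by
      filter_upwards [eventually_gt_nhds hu] with x hx
      simp [peanoTwo, hx]
    refine ContinuousAt.congr ?_ he
    rcases lt_or_gt_of_ne hv with hv | hv <;> rcases lt_or_gt_of_ne hw with hw | hw <;>
      simp only [hv, hw, not_lt.2 hv.le, not_lt.2 hw.le, if_true, if_false]
    · exact ContinuousAt.div (by fun_prop) (by fun_prop)
        (mul_ne_zero (by linarith) (by linarith))
    · exact continuousAt_const.sub (ContinuousAt.div (by fun_prop) (by fun_prop)
        (mul_ne_zero (by linarith) (by linarith)))
    · exact continuousAt_const.sub (ContinuousAt.div (by fun_prop) (by fun_prop)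
        (mul_ne_zero (by linarith) (by linarith)))
    · exact continuousAt_const

end DerandInv

namespace DerandInv

/-! ### The Peano formula for third divided differences -/

/-- Dominated convergence; the finite set `s` holds the parameters at which the kernel may jump, and
it is null. -/
lemma tendsto_integral_mul_of_bounded {R : ℝ} {φ : ℝ → ℝ} (hφ : Continuous φ)
    {k : ℝ → ℝ → ℝ} {a B : ℝ} (hm : ∀ x, Measurable (k x)) {s : Finset ℝ}
    (hB : ∀ᶠ x in nhds a, ∀ t ∈ Set.uIoc (-R) R, |k x t| ≤ B)
    (hk : ∀ t ∉ s, ContinuousAt (fun x => k x t) a) :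
    ContinuousAt (fun x => ∫ t in (-R)..R, φ t * k x t) a := by
  obtain ⟨M, hM⟩ := (isCompact_uIcc (a := -R) (b := R)).exists_bound_of_continuousOn
    hφ.continuousOn
  refine intervalIntegral.tendsto_integral_filter_of_dominated_convergence (fun _ => M * B) ?_ ?_
    intervalIntegrable_const ?_
  · exact Filter.Eventually.of_forall fun x => (hφ.measurable.mul (hm x)).aestronglyMeasurable
  · filter_upwards [hB] with x hx
    refine Filter.Eventually.of_forall fun t ht => ?_
    rw [norm_mul]
    have h1 := hM t (Set.uIoc_subset_uIcc ht)
    exact mul_le_mul h1 (hx t ht) (norm_nonneg _) ((norm_nonneg _).trans h1)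
  · have : ∀ᵐ t : ℝ, t ∉ s := by
      refine (compl_mem_ae_iff (s := (s : Set ℝ))).2 ?_
      exact s.finite_toSet.measure_zero _
    filter_upwards [this] with t ht _
    exact ((hk t ht).tendsto).const_mul _

lemma intervalIntegrable_mul_of_bounded {R : ℝ} {φ : ℝ → ℝ} (hφ : Continuous φ)
    {k : ℝ → ℝ} {B : ℝ} (hm : Measurable k) (hB : ∀ t ∈ Set.uIoc (-R) R, |k t| ≤ B) :
    IntervalIntegrable (fun t => φ t * k t) volume (-R) R := by
  have : IntervalIntegrable k volume (-R) R := by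
    refine (intervalIntegrable_const (c := B)).mono_fun hm.aestronglyMeasurable ?_
    refine (ae_restrict_iff' measurableSet_uIoc).2 (Filter.Eventually.of_forall fun t ht => ?_)
    exact (hB t ht).trans (le_abs_self B)
  exact this.continuousOn_mul hφ.continuousOn

/-- `f` is three times differentiable with continuous third derivative `f₃`, and `D₁`, `D₂`, `D₃`
are continuous divided differences of `f`. -/
structure DividedDiff (f f₁ f₂ f₃ : ℝ → ℝ) (D₁ : ℝ → ℝ → ℝ) (D₂ : ℝ → ℝ → ℝ → ℝ)
    (D₃ : ℝ → ℝ → ℝ → ℝ → ℝ) : Prop where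
  deriv₀ : ∀ x, HasDerivAt f (f₁ x) x
  deriv₁ : ∀ x, HasDerivAt f₁ (f₂ x) x
  deriv₂ : ∀ x, HasDerivAt f₂ (f₃ x) x
  cont : Continuous f₃
  one : ∀ a b, (a - b) * D₁ a b = f a - f b
  two : ∀ a b c, (a - c) * D₂ a b c = D₁ a b - D₁ b c
  three : ∀ a b c e, (a - e) * D₃ a b c e = D₂ a b c - D₂ b c e
  cont_one : ∀ b, Continuous fun a => D₁ a b
  cont_two : ∀ b c, Continuous fun a => D₂ a b c

/-- Expanding at the left endpoint and truncating the square keeps the range of integration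
independent of x, so formulas at different nodes can be subtracted under one integral. -/
lemma taylor_integral {f f₁ f₂ f₃ : ℝ → ℝ} (h₀ : ∀ x, HasDerivAt f (f₁ x) x)
    (h₁ : ∀ x, HasDerivAt f₁ (f₂ x) x) (h₂ : ∀ x, HasDerivAt f₂ (f₃ x) x) (hc : Continuous f₃)
    {R x : ℝ} (hx : x ∈ Set.Ioo (-R) R) :
    f x = f (-R) + f₁ (-R) * (x + R) + f₂ (-R) / 2 * (x + R) ^ 2
      + (1 / 2) * ∫ t in (-R)..R, f₃ t * max (x - t) 0 ^ 2 := by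
  have hcont : Continuous fun t => f₃ t * max (x - t) 0 ^ 2 := by fun_prop
  have e2 : ∫ t in x..R, f₃ t * max (x - t) 0 ^ 2 = 0 := by
    rw [← intervalIntegral.integral_zero (a := x) (b := R) (μ := volume)]
    refine intervalIntegral.integral_congr fun t ht => ?_
    rw [Set.uIcc_of_le hx.2.le] at ht
    simp [max_eq_right (sub_nonpos.2 ht.1)]
  have e1 : ∫ t in (-R)..x, f₃ t * max (x - t) 0 ^ 2 = ∫ t in (-R)..x, f₃ t * (x - t) ^ 2 := by
    refine intervalIntegral.integral_congr fun t ht => ?_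
    rw [Set.uIcc_of_le hx.1.le] at ht
    simp [max_eq_left (sub_nonneg.2 ht.2)]
  have e3 : ∫ t in (-R)..x, f₃ t * (x - t) ^ 2
      = (2 * f x + 2 * f₁ x * (x - x) + f₂ x * (x - x) ^ 2)
        - (2 * f (-R) + 2 * f₁ (-R) * (x - -R) + f₂ (-R) * (x - -R) ^ 2) := by
    -- Twice the second-order Taylor polynomial at t, evaluated at x, is an antiderivative in t: all
    -- lower terms telescope.
    refine intervalIntegral.integral_eq_sub_of_hasDerivAt
      (f := fun t => 2 * f t + 2 * f₁ t * (x - t) + f₂ t * (x - t) ^ 2) (fun t _ => ?_)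
      (Continuous.intervalIntegrable (by fun_prop) _ _)
    have hs : HasDerivAt (fun t => x - t) (-1) t := by
      simpa using (hasDerivAt_id t).const_sub x
    refine HasDerivAt.congr_deriv ((((h₀ t).const_mul 2).add (((h₁ t).const_mul 2).mul hs)).add
      ((h₂ t).mul (hs.pow 2))) ?_
    push_cast
    ring
  rw [← intervalIntegral.integral_add_adjacent_intervals (hcont.intervalIntegrable (-R) x)
    (hcont.intervalIntegrable x R), e2, e1, e3]
  ring

namespace DividedDiff

variable {f f₁ f₂ f₃ : ℝ → ℝ} {D₁ : ℝ → ℝ → ℝ} {D₂ : ℝ → ℝ → ℝ → ℝ}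
  {D₃ : ℝ → ℝ → ℝ → ℝ → ℝ} {R : ℝ}

/-- For distinct nodes, subtract `taylor_integral` at the two nodes and cancel the difference; both
sides are continuous in a, which covers a = b. -/
lemma one_eq_integral (H : DividedDiff f f₁ f₂ f₃ D₁ D₂ D₃) {a b : ℝ} (ha : a ∈ Set.Ioo (-R) R)
    (hb : b ∈ Set.Ioo (-R) R) :
    D₁ a b = f₁ (-R) + f₂ (-R) / 2 * (a + b + 2 * R)
      + (1 / 2) * ∫ t in (-R)..R, f₃ t * peanoOne (a - t) (b - t) := by
  have bound : ∀ x ∈ Set.Ioo (-R) R, ∀ t ∈ Set.uIoc (-R) R,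
      |peanoOne (x - t) (b - t)| ≤ 4 * R := by
    intro x hx t ht
    rw [Set.uIoc_of_le (by linarith [hx.1, hx.2])] at ht
    refine (abs_peanoOne_le _ _).trans ?_
    have h1 : |x - t| ≤ 2 * R := abs_le.2 ⟨by linarith [hx.1, ht.2], by linarith [hx.2, ht.1]⟩
    have h2 : |b - t| ≤ 2 * R := abs_le.2 ⟨by linarith [hb.1, ht.2], by linarith [hb.2, ht.1]⟩
    linarith
  have key : ∀ x ∈ Set.Ioo (-R) R, x ≠ b →
      D₁ x b = f₁ (-R) + f₂ (-R) / 2 * (x + b + 2 * R)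
        + (1 / 2) * ∫ t in (-R)..R, f₃ t * peanoOne (x - t) (b - t) := by
    intro x hx hxb
    have hxb' : x - b ≠ 0 := sub_ne_zero.2 hxb
    apply mul_left_cancel₀ hxb'
    have e : (x - b) * ∫ t in (-R)..R, f₃ t * peanoOne (x - t) (b - t)
        = (∫ t in (-R)..R, f₃ t * max (x - t) 0 ^ 2)
          - ∫ t in (-R)..R, f₃ t * max (b - t) 0 ^ 2 := by
      have c : ∀ y : ℝ, Continuous fun t => f₃ t * max (y - t) 0 ^ 2 := fun y => by
        have := H.cont; fun_prop
      rw [← intervalIntegral.integral_sub ((c x).intervalIntegrable _ _)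
        ((c b).intervalIntegrable _ _), ← intervalIntegral.integral_const_mul]
      refine intervalIntegral.integral_congr fun t _ => ?_
      have := peanoOne_mul_sub (u := x - t) (v := b - t)
      linear_combination f₃ t * this
    rw [H.one, taylor_integral H.deriv₀ H.deriv₁ H.deriv₂ H.cont hx,
      taylor_integral H.deriv₀ H.deriv₁ H.deriv₂ H.cont hb]
    linear_combination (-1 / 2) * e
  by_cases hab : a = b
  · have c1 : ContinuousAt (fun x => D₁ x b) a := (H.cont_one b).continuousAt
    have c2 : ContinuousAt (fun x => f₁ (-R) + f₂ (-R) / 2 * (x + b + 2 * R)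
        + (1 / 2) * ∫ t in (-R)..R, f₃ t * peanoOne (x - t) (b - t)) a := by
      refine ContinuousAt.add (by fun_prop) (continuousAt_const.mul ?_)
      refine tendsto_integral_mul_of_bounded H.cont (k := fun x t => peanoOne (x - t) (b - t))
        (s := {a}) (B := 4 * R)
        (fun x => measurable_peanoOne (by fun_prop) (by fun_prop)) ?_ ?_
      · filter_upwards [isOpen_Ioo.mem_nhds ha] with x hx using bound x hx
      · intro t ht
        have : a - t ≠ 0 := sub_ne_zero.2 fun h => ht (by simp [h])
        exact ContinuousAt.comp (g := fun y => peanoOne y (b - t)) (f := fun x => x - t)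
          (continuousAt_peanoOne this) (by fun_prop)
    refine tendsto_nhds_unique_of_eventuallyEq (l := nhdsWithin a {a}ᶜ)
      (c1.tendsto.mono_left nhdsWithin_le_nhds) (c2.tendsto.mono_left nhdsWithin_le_nhds) ?_
    filter_upwards [self_mem_nhdsWithin, nhdsWithin_le_nhds (isOpen_Ioo.mem_nhds ha)] with x h1 h2
    exact key x h2 (by rw [← hab]; exact h1)
  · exact key a ha hab

lemma two_eq_integral (H : DividedDiff f f₁ f₂ f₃ D₁ D₂ D₃) {a b c : ℝ} (ha : a ∈ Set.Ioo (-R) R)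
    (hb : b ∈ Set.Ioo (-R) R) (hc : c ∈ Set.Ioo (-R) R) :
    D₂ a b c = f₂ (-R) / 2
      + (1 / 2) * ∫ t in (-R)..R, f₃ t * peanoTwo (a - t) (b - t) (c - t) := by
  have bound : ∀ x ∈ Set.Ioo (-R) R, ∀ y ∈ Set.Ioo (-R) R, ∀ t ∈ Set.uIoc (-R) R,
      |peanoOne (x - t) (y - t)| ≤ 4 * R := by
    intro x hx y hy t ht
    rw [Set.uIoc_of_le (by linarith [hx.1, hx.2])] at ht
    refine (abs_peanoOne_le _ _).trans ?_
    have h1 : |x - t| ≤ 2 * R := abs_le.2 ⟨by linarith [hx.1, ht.2], by linarith [hx.2, ht.1]⟩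
    have h2 : |y - t| ≤ 2 * R := abs_le.2 ⟨by linarith [hy.1, ht.2], by linarith [hy.2, ht.1]⟩
    linarith
  have aenot : ∀ s : Finset ℝ, ∀ᵐ t : ℝ, t ∉ s := fun s =>
    (compl_mem_ae_iff (s := (s : Set ℝ))).2 (s.finite_toSet.measure_zero _)
  have key : ∀ x ∈ Set.Ioo (-R) R, x ≠ c →
      D₂ x b c = f₂ (-R) / 2
        + (1 / 2) * ∫ t in (-R)..R, f₃ t * peanoTwo (x - t) (b - t) (c - t) := by
    intro x hx hxc
    apply mul_left_cancel₀ (sub_ne_zero.2 hxc)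
    have e : (x - c) * ∫ t in (-R)..R, f₃ t * peanoTwo (x - t) (b - t) (c - t)
        = (∫ t in (-R)..R, f₃ t * peanoOne (x - t) (b - t))
          - ∫ t in (-R)..R, f₃ t * peanoOne (b - t) (c - t) := by
      rw [← intervalIntegral.integral_sub
        (intervalIntegrable_mul_of_bounded H.cont
          (measurable_peanoOne (by fun_prop) (by fun_prop)) (bound x hx b hb))
        (intervalIntegrable_mul_of_bounded H.cont
          (measurable_peanoOne (by fun_prop) (by fun_prop)) (bound b hb c hc)),
        ← intervalIntegral.integral_const_mul]
      refine intervalIntegral.integral_congr_ae ?_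
      filter_upwards [aenot {x, b, c}] with t ht _
      simp only [Finset.mem_insert, Finset.mem_singleton, not_or] at ht
      have := peanoTwo_mul_sub (sub_ne_zero.2 (Ne.symm ht.1)) (sub_ne_zero.2 (Ne.symm ht.2.1))
        (sub_ne_zero.2 (Ne.symm ht.2.2))
      linear_combination f₃ t * this
    rw [H.two, H.one_eq_integral hx hb, H.one_eq_integral hb hc]
    linear_combination (-1 / 2) * e
  by_cases hac : a = c
  · have c1 : ContinuousAt (fun x => D₂ x b c) a := (H.cont_two b c).continuousAt
    have c2 : ContinuousAt (fun x => f₂ (-R) / 2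
        + (1 / 2) * ∫ t in (-R)..R, f₃ t * peanoTwo (x - t) (b - t) (c - t)) a := by
      refine ContinuousAt.add (by fun_prop) (continuousAt_const.mul ?_)
      refine tendsto_integral_mul_of_bounded H.cont
        (k := fun x t => peanoTwo (x - t) (b - t) (c - t)) (s := {a, b, c}) (B := 1)
        (fun x => measurable_peanoTwo (by fun_prop) (by fun_prop) (by fun_prop)) ?_ ?_
      · exact Filter.Eventually.of_forall fun x t _ => abs_peanoTwo_le _ _ _
      · intro t ht
        simp only [Finset.mem_insert, Finset.mem_singleton, not_or] at ht
        exact ContinuousAt.comp (g := fun y => peanoTwo y (b - t) (c - t)) (f := fun x => x - t)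
          (continuousAt_peanoTwo (sub_ne_zero.2 (Ne.symm ht.1)) (sub_ne_zero.2 (Ne.symm ht.2.1))
            (sub_ne_zero.2 (Ne.symm ht.2.2))) (by fun_prop)
    refine tendsto_nhds_unique_of_eventuallyEq (l := nhdsWithin a {a}ᶜ)
      (c1.tendsto.mono_left nhdsWithin_le_nhds) (c2.tendsto.mono_left nhdsWithin_le_nhds) ?_
    filter_upwards [self_mem_nhdsWithin, nhdsWithin_le_nhds (isOpen_Ioo.mem_nhds ha)] with x h1 h2
    exact key x h2 (by rw [← hac]; exact h1)
  · exact key a ha hac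

/-- Peano formula for the third divided difference, with its integrability. -/
lemma three_eq_integral (H : DividedDiff f f₁ f₂ f₃ D₁ D₂ D₃) {a b c e : ℝ}
    (ha : a ∈ Set.Ioo (-R) R) (hb : b ∈ Set.Ioo (-R) R) (hc : c ∈ Set.Ioo (-R) R)
    (he : e ∈ Set.Ioo (-R) R) (hae : a ≠ e) :
    IntervalIntegrable (fun t => f₃ t * peanoThree (a - t) (b - t) (c - t) (e - t)) volume (-R) R ∧
    D₃ a b c e = (1 / 2) * ∫ t in (-R)..R,
      f₃ t * peanoThree (a - t) (b - t) (c - t) (e - t) := by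
  have aenot : ∀ᵐ t : ℝ, t ∉ ({a, b, c, e} : Finset ℝ) :=
    (compl_mem_ae_iff (s := (({a, b, c, e} : Finset ℝ) : Set ℝ))).2
      (Finset.finite_toSet _ |>.measure_zero _)
  have hae' := sub_ne_zero.2 hae
  have i₁ := intervalIntegrable_mul_of_bounded (R := R) H.cont
    (measurable_peanoTwo (f := fun t => a - t) (g := fun t => b - t) (h := fun t => c - t)
      (by fun_prop) (by fun_prop) (by fun_prop)) (fun t _ => abs_peanoTwo_le _ _ _)
  have i₂ := intervalIntegrable_mul_of_bounded (R := R) H.cont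
    (measurable_peanoTwo (f := fun t => b - t) (g := fun t => c - t) (h := fun t => e - t)
      (by fun_prop) (by fun_prop) (by fun_prop)) (fun t _ => abs_peanoTwo_le _ _ _)
  have hpt : ∀ᵐ t : ℝ, (a - e)⁻¹ * (f₃ t * peanoTwo (a - t) (b - t) (c - t)
      - f₃ t * peanoTwo (b - t) (c - t) (e - t))
      = f₃ t * peanoThree (a - t) (b - t) (c - t) (e - t) := by
    filter_upwards [aenot] with t ht
    simp only [Finset.mem_insert, Finset.mem_singleton, not_or] at ht
    have := peanoThree_mul_sub (sub_ne_zero.2 (Ne.symm ht.1)) (sub_ne_zero.2 (Ne.symm ht.2.1))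
      (sub_ne_zero.2 (Ne.symm ht.2.2.1)) (sub_ne_zero.2 (Ne.symm ht.2.2.2))
    rw [← mul_sub, ← this, sub_sub_sub_cancel_right]
    field_simp
  constructor
  · refine ((i₁.sub i₂).const_mul (a - e)⁻¹).congr_ae (ae_restrict_of_ae ?_)
    filter_upwards [hpt] with t ht using ht
  · have e1 : ∫ t in (-R)..R, f₃ t * peanoThree (a - t) (b - t) (c - t) (e - t)
        = (a - e)⁻¹ * ((∫ t in (-R)..R, f₃ t * peanoTwo (a - t) (b - t) (c - t))
          - ∫ t in (-R)..R, f₃ t * peanoTwo (b - t) (c - t) (e - t)) := by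
      rw [← intervalIntegral.integral_sub i₁ i₂, ← intervalIntegral.integral_const_mul]
      refine intervalIntegral.integral_congr_ae ?_
      filter_upwards [hpt] with t ht _ using ht.symm
    apply mul_left_cancel₀ hae'
    rw [H.three, H.two_eq_integral ha hb hc, H.two_eq_integral hb hc he, e1]
    field_simp
    ring

end DividedDiff

end DerandInv

namespace DerandInv

/-! ### Divided differences of polynomials -/

/-- First divided difference of `x ^ N`. -/
def powDiffOne : ℕ → ℝ → ℝ → ℝ
  | 0, _, _ => 0
  | N + 1, a, b => a * powDiffOne N a b + b ^ N

/-- Second divided difference of `x ^ N`. -/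
def powDiffTwo : ℕ → ℝ → ℝ → ℝ → ℝ
  | 0, _, _, _ => 0
  | N + 1, a, b, c => a * powDiffTwo N a b c + powDiffOne N b c

/-- Third divided difference of `x ^ N`. -/
def powDiffThree : ℕ → ℝ → ℝ → ℝ → ℝ → ℝ
  | 0, _, _, _, _ => 0
  | N + 1, a, b, c, e => a * powDiffThree N a b c e + powDiffTwo N b c e

lemma powDiffOne_mul (N : ℕ) (a b : ℝ) : (a - b) * powDiffOne N a b = a ^ N - b ^ N := by
  induction N with
  | zero => simp [powDiffOne]
  | succ N ih => rw [powDiffOne]; linear_combination a * ih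

lemma powDiffTwo_mul (N : ℕ) (a b c : ℝ) :
    (a - c) * powDiffTwo N a b c = powDiffOne N a b - powDiffOne N b c := by
  induction N with
  | zero => simp [powDiffOne, powDiffTwo]
  | succ N ih =>
    rw [powDiffTwo, powDiffOne, powDiffOne]
    linear_combination a * ih + powDiffOne_mul N b c

lemma powDiffThree_mul (N : ℕ) (a b c e : ℝ) :
    (a - e) * powDiffThree N a b c e = powDiffTwo N a b c - powDiffTwo N b c e := by
  induction N with
  | zero => simp [powDiffThree, powDiffTwo]
  | succ N ih =>
    rw [powDiffThree, powDiffTwo, powDiffTwo]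
    linear_combination a * ih + powDiffTwo_mul N b c e

/-- Cyclic symmetry allows any two cyclically adjacent nodes to be made the outer ones, the only
pair by which the defining recurrence divides. -/
lemma powDiffThree_rotate (N : ℕ) (a b c e : ℝ) :
    powDiffThree N a b c e = powDiffThree N b c e a := by
  induction N with
  | zero => simp [powDiffThree]
  | succ N ih =>
    rw [powDiffThree, powDiffThree]
    linear_combination a * ih - powDiffThree_mul N b c e a

lemma continuous_powDiffOne (N : ℕ) (b : ℝ) : Continuous fun a => powDiffOne N a b := by
  induction N with
  | zero => exact continuous_const
  | succ N ih => simp only [powDiffOne]; fun_prop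

lemma continuous_powDiffTwo (N : ℕ) (b c : ℝ) : Continuous fun a => powDiffTwo N a b c := by
  induction N with
  | zero => exact continuous_const
  | succ N ih => simp only [powDiffTwo]; fun_prop

open Polynomial in
lemma powDiff_diag (N : ℕ) (a : ℝ) :
    powDiffOne N a a = (derivative (X ^ N : ℝ[X])).eval a ∧
    2 * powDiffTwo N a a a = (derivative (derivative (X ^ N : ℝ[X]))).eval a ∧
    6 * powDiffThree N a a a a
      = (derivative (derivative (derivative (X ^ N : ℝ[X])))).eval a := by
  induction N with
  | zero => simp [powDiffOne, powDiffTwo, powDiffThree]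
  | succ N ih =>
    obtain ⟨h1, h2, h3⟩ := ih
    rw [powDiffOne, powDiffTwo, powDiffThree, pow_succ', derivative_mul, derivative_X, one_mul]
    simp only [map_add, derivative_mul, derivative_X, one_mul, eval_add, eval_mul, eval_X,
      eval_pow]
    refine ⟨by rw [h1]; ring, by rw [← h1, ← h2]; ring, by rw [← h2, ← h3]; ring⟩

section Poly

open Polynomial

/-- Third divided difference of a polynomial. -/
noncomputable def polyDiffThree (g : ℝ[X]) (a b c e : ℝ) : ℝ :=
  g.sum fun N x => x * powDiffThree N a b c e

lemma polyDiffThree_rotate (g : ℝ[X]) (a b c e : ℝ) :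
    polyDiffThree g a b c e = polyDiffThree g b c e a := by
  unfold polyDiffThree; simp_rw [powDiffThree_rotate _ a b c e]

lemma polyDiffThree_diag (g : ℝ[X]) (a : ℝ) :
    polyDiffThree g a a a a = (derivative (derivative (derivative g))).eval a / 6 := by
  have h : ∀ N, powDiffThree N a a a a
      = (derivative (derivative (derivative (X ^ N : ℝ[X])))).eval a / 6 := fun N => by
    rw [← (powDiff_diag N a).2.2]; ring
  conv_rhs => rw [g.as_sum_support_C_mul_X_pow]
  unfold polyDiffThree
  rw [Polynomial.sum_def]
  simp only [map_sum, derivative_C_mul, eval_finsetSum, eval_mul, eval_C, Finset.sum_div, h]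
  exact Finset.sum_congr rfl fun _ _ => by ring

lemma dividedDiff_poly (g : ℝ[X]) :
    DividedDiff (fun x => g.eval x) (fun x => (derivative g).eval x)
      (fun x => (derivative (derivative g)).eval x)
      (fun x => (derivative (derivative (derivative g))).eval x)
      (fun a b => g.sum fun N x => x * powDiffOne N a b)
      (fun a b c => g.sum fun N x => x * powDiffTwo N a b c) (polyDiffThree g) where
  deriv₀ x := g.hasDerivAt x
  deriv₁ x := (derivative g).hasDerivAt x
  deriv₂ x := (derivative (derivative g)).hasDerivAt x
  cont := Polynomial.continuous _
  one a b := by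
    simp only [Polynomial.sum_def, Finset.mul_sum, eval_eq_sum, ← Finset.sum_sub_distrib]
    refine Finset.sum_congr rfl fun N _ => ?_
    linear_combination g.coeff N * powDiffOne_mul N a b
  two a b c := by
    simp only [Polynomial.sum_def, Finset.mul_sum, ← Finset.sum_sub_distrib]
    refine Finset.sum_congr rfl fun N _ => ?_
    linear_combination g.coeff N * powDiffTwo_mul N a b c
  three a b c e := by
    simp only [polyDiffThree, Polynomial.sum_def, Finset.mul_sum, ← Finset.sum_sub_distrib]
    refine Finset.sum_congr rfl fun N _ => ?_
    linear_combination g.coeff N * powDiffThree_mul N a b c e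
  cont_one b := by
    simp only [Polynomial.sum_def]
    exact continuous_finsetSum _ fun N _ => continuous_const.mul (continuous_powDiffOne N b)
  cont_two b c := by
    simp only [Polynomial.sum_def]
    exact continuous_finsetSum _ fun N _ => continuous_const.mul (continuous_powDiffTwo N b c)

/-- A cyclic shift exchanges the two summands, up to swapping the outer pair in `sosWeight` and
`sosCoeff`. The latter is symmetric in that pair only when no argument is zero. -/
lemma peanoThree_rotate {a b c e : ℝ} (ha : a ≠ 0) (hb : b ≠ 0) (hc : c ≠ 0) (he : e ≠ 0) :
    peanoThree a b c e = peanoThree b c e a := by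
  have h1 : ∀ x y, sosWeight x y = sosWeight y x := fun x y => by
    simp only [sosWeight, mul_comm x y, abs_sub_comm x y, add_comm |x|]
  have h2 : ∀ x z y, x ≠ 0 → z ≠ 0 → y ≠ 0 → sosCoeff x z y = sosCoeff y z x := by
    intro x z y hx hz hy
    unfold sosCoeff
    rcases lt_or_gt_of_ne hx with hx | hx <;> rcases lt_or_gt_of_ne hy with hy | hy <;>
      rcases lt_or_gt_of_ne hz with hz | hz <;>
      simp [hx, hy, hz, hx.not_gt, hy.not_gt, hz.not_gt, mul_pos_iff, mul_neg_iff,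
        mul_comm |x - z|]
  rw [peanoThree, peanoThree, h1 c a, h2 c e a hc he ha, h2 c b a hc hb ha]
  ring

/-- Unless all four nodes coincide, two cyclic neighbours differ, and a rotation brings them to the
outer positions required by `three_eq_integral`. -/
lemma polyDiffThree_eq_integral (g : ℝ[X]) {R a b c e : ℝ}
    (ha : a ∈ Set.Ioo (-R) R) (hb : b ∈ Set.Ioo (-R) R) (hc : c ∈ Set.Ioo (-R) R)
    (he : e ∈ Set.Ioo (-R) R) (hne : ¬ (a = b ∧ b = c ∧ c = e)) :
    IntervalIntegrable (fun t => (derivative (derivative (derivative g))).eval t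
      * peanoThree (a - t) (b - t) (c - t) (e - t)) volume (-R) R ∧
    polyDiffThree g a b c e = (1 / 2) * ∫ t in (-R)..R,
      (derivative (derivative (derivative g))).eval t
        * peanoThree (a - t) (b - t) (c - t) (e - t) := by
  have rot : ∀ a b c e : ℝ,
      (IntervalIntegrable (fun t => (derivative (derivative (derivative g))).eval t
        * peanoThree (b - t) (c - t) (e - t) (a - t)) volume (-R) R ∧
      polyDiffThree g b c e a = (1 / 2) * ∫ t in (-R)..R,
        (derivative (derivative (derivative g))).eval t
          * peanoThree (b - t) (c - t) (e - t) (a - t)) →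
      (IntervalIntegrable (fun t => (derivative (derivative (derivative g))).eval t
        * peanoThree (a - t) (b - t) (c - t) (e - t)) volume (-R) R ∧
      polyDiffThree g a b c e = (1 / 2) * ∫ t in (-R)..R,
        (derivative (derivative (derivative g))).eval t
          * peanoThree (a - t) (b - t) (c - t) (e - t)) := by
    rintro a b c e ⟨h1, h2⟩
    have hpt : ∀ᵐ t : ℝ, (derivative (derivative (derivative g))).eval t
        * peanoThree (b - t) (c - t) (e - t) (a - t)
        = (derivative (derivative (derivative g))).eval t
        * peanoThree (a - t) (b - t) (c - t) (e - t) := by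
      have aenot : ∀ᵐ t : ℝ, t ∉ ({a, b, c, e} : Finset ℝ) :=
        (compl_mem_ae_iff (s := (({a, b, c, e} : Finset ℝ) : Set ℝ))).2
          (Finset.finite_toSet _ |>.measure_zero _)
      filter_upwards [aenot] with t ht
      simp only [Finset.mem_insert, Finset.mem_singleton, not_or] at ht
      rw [← peanoThree_rotate (sub_ne_zero.2 (Ne.symm ht.1)) (sub_ne_zero.2 (Ne.symm ht.2.1))
        (sub_ne_zero.2 (Ne.symm ht.2.2.1)) (sub_ne_zero.2 (Ne.symm ht.2.2.2))]
    refine ⟨h1.congr_ae (ae_restrict_of_ae hpt), ?_⟩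
    rw [polyDiffThree_rotate, h2]
    congr 1
    exact intervalIntegral.integral_congr_ae (hpt.mono fun t ht _ => ht)
  by_cases h1 : a = e
  · by_cases h2 : a = b
    · by_cases h3 : b = c
      · exact absurd ⟨h2, h3, by rw [← h3, ← h2, h1]⟩ hne
      · exact rot _ _ _ _ (rot _ _ _ _
          ((dividedDiff_poly g).three_eq_integral hc he ha hb (Ne.symm h3)))
    · exact rot _ _ _ _ ((dividedDiff_poly g).three_eq_integral hb hc he ha (Ne.symm h2))
  · exact (dividedDiff_poly g).three_eq_integral ha hb hc he h1

end Poly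

/-! ### Sums of squares -/

section Sos

variable {ι : Type*} [Fintype ι]

lemma sum_rotate {M : Type*} [AddCommMonoid M] (F : ι → ι → ι → ι → M) :
    ∑ i, ∑ j, ∑ k, ∑ l, F j k l i = ∑ i, ∑ j, ∑ k, ∑ l, F i j k l := by
  calc ∑ i, ∑ j, ∑ k, ∑ l, F j k l i = ∑ j, ∑ i, ∑ k, ∑ l, F j k l i := Finset.sum_comm
    _ = ∑ j, ∑ k, ∑ i, ∑ l, F j k l i := Finset.sum_congr rfl fun _ _ => Finset.sum_comm
    _ = ∑ j, ∑ k, ∑ l, ∑ i, F j k l i :=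
      Finset.sum_congr rfl fun _ _ => Finset.sum_congr rfl fun _ _ => Finset.sum_comm

/-- For fixed i and k the sums over j and l are complex conjugates of each other because Q is
Hermitian; the total is ∑ w |∑ⱼ v QᵢⱼQⱼₖ|². -/
lemma re_sum_sos_nonneg {Q : Matrix ι ι ℂ} (hQ : Q.IsHermitian) (w : ι → ι → ℝ)
    (hw : ∀ i k, 0 ≤ w i k) (v : ι → ι → ι → ℝ) :
    0 ≤ ∑ i, ∑ j, ∑ k, ∑ l, w i k * v i j k * v i l k * (Q i j * Q j k * Q k l * Q l i).re := by
  have hq : ∀ i j, Q j i = star (Q i j) := fun i j => (hQ.apply j i).symm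
  have e : ∑ i, ∑ j, ∑ k, ∑ l, w i k * v i j k * v i l k * (Q i j * Q j k * Q k l * Q l i).re
      = ∑ i, ∑ k, w i k * Complex.normSq (∑ j, v i j k * (Q i j * Q j k)) := by
    refine Finset.sum_congr rfl fun i _ => ?_
    rw [Finset.sum_comm]
    refine Finset.sum_congr rfl fun k _ => ?_
    have : ((Complex.normSq (∑ j, v i j k * (Q i j * Q j k)) : ℝ) : ℂ)
        = ∑ j, ∑ l, ((v i j k * v i l k : ℝ) : ℂ) * (Q i j * Q j k * Q k l * Q l i) := by
      rw [← Complex.mul_conj, map_sum, Finset.sum_mul_sum]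
      refine Finset.sum_congr rfl fun j _ => Finset.sum_congr rfl fun l _ => ?_
      rw [hq l k, hq i l]
      simp only [map_mul, Complex.conj_ofReal, RCLike.star_def, Complex.ofReal_mul]
      ring
    have h2 := congrArg Complex.re this
    rw [Complex.ofReal_re] at h2
    rw [h2]
    simp only [Complex.re_sum, Complex.re_ofReal_mul, Finset.mul_sum]
    exact Finset.sum_congr rfl fun j _ => Finset.sum_congr rfl fun l _ => by ring
  rw [e]
  exact Finset.sum_nonneg fun i _ => Finset.sum_nonneg fun k _ =>
    mul_nonneg (hw i k) (Complex.normSq_nonneg _)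

/-- The two summands of `peanoThree` contribute equally, since relabelling the indices cyclically
leaves the product of entries of Q unchanged. -/
lemma re_sum_peanoThree_nonneg {Q : Matrix ι ι ℂ} (hQ : Q.IsHermitian) (u : ι → ℝ) :
    0 ≤ ∑ i, ∑ j, ∑ k, ∑ l, peanoThree (u i) (u j) (u k) (u l)
      * (Q i j * Q j k * Q k l * Q l i).re := by
  have h := re_sum_sos_nonneg hQ (fun i k => sosWeight (u i) (u k))
    (fun _ _ => sosWeight_nonneg _ _) (fun i j k => sosCoeff (u i) (u j) (u k))
  have e : ∑ i, ∑ j, ∑ k, ∑ l, peanoThree (u i) (u j) (u k) (u l)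
      * (Q i j * Q j k * Q k l * Q l i).re
      = (∑ i, ∑ j, ∑ k, ∑ l, sosWeight (u i) (u k) * sosCoeff (u i) (u j) (u k)
          * sosCoeff (u i) (u l) (u k) * (Q i j * Q j k * Q k l * Q l i).re)
        + ∑ i, ∑ j, ∑ k, ∑ l, sosWeight (u i) (u k) * sosCoeff (u i) (u j) (u k)
          * sosCoeff (u i) (u l) (u k) * (Q i j * Q j k * Q k l * Q l i).re := by
    conv_rhs => rw [← sum_rotate (fun i j k l => sosWeight (u i) (u k)
      * sosCoeff (u i) (u j) (u k) * sosCoeff (u i) (u l) (u k)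
      * (Q i j * Q j k * Q k l * Q l i).re)]
    conv_rhs => arg 1; rw [sum_rotate (fun i j k l => sosWeight (u i) (u k)
      * sosCoeff (u i) (u j) (u k) * sosCoeff (u i) (u l) (u k)
      * (Q i j * Q j k * Q k l * Q l i).re)]
    simp only [← Finset.sum_add_distrib]
    refine Finset.sum_congr rfl fun i _ => Finset.sum_congr rfl fun j _ =>
      Finset.sum_congr rfl fun k _ => Finset.sum_congr rfl fun l _ => ?_
    rw [show Q j k * Q k l * Q l i * Q i j = Q i j * Q j k * Q k l * Q l i by ring, peanoThree]
    ring
  rw [e]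
  exact add_nonneg h h

lemma sum_four_eq {M : Type*} [AddCommMonoid M] (F : ι × ι × ι × ι → M) :
    ∑ i, ∑ j, ∑ k, ∑ l, F (i, j, k, l) = ∑ p, F p := by
  simp only [Fintype.sum_prod_type]

/-- All four entries of a tuple of indices carry the same node. -/
def SameNode (lam : ι → ℝ) (p : ι × ι × ι × ι) : Prop :=
  lam p.1 = lam p.2.1 ∧ lam p.2.1 = lam p.2.2.1 ∧ lam p.2.2.1 = lam p.2.2.2

open Classical in
-- Peano's formula says nothing when all four nodes coincide. Those terms form a sum of squares of
-- their own, with the indicators of equal nodes as coefficients.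
lemma re_sum_sameNode_nonneg {Q : Matrix ι ι ℂ} (hQ : Q.IsHermitian) (lam : ι → ℝ) (φ : ℝ → ℝ)
    (hφ : ∀ i, 0 ≤ φ (lam i)) :
    0 ≤ ∑ p : ι × ι × ι × ι, if SameNode lam p then φ (lam p.1)
      * (Q p.1 p.2.1 * Q p.2.1 p.2.2.1 * Q p.2.2.1 p.2.2.2 * Q p.2.2.2 p.1).re else 0 := by
  have := re_sum_sos_nonneg hQ (fun i k => if lam i = lam k then φ (lam i) else 0)
    (fun i k => by have := hφ i; split_ifs <;> positivity)
    (fun i j _ => if lam i = lam j then 1 else 0)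
  refine this.trans_eq ?_
  rw [← sum_four_eq]
  refine Finset.sum_congr rfl fun i _ => Finset.sum_congr rfl fun j _ =>
    Finset.sum_congr rfl fun k _ => Finset.sum_congr rfl fun l _ => ?_
  by_cases h : SameNode lam (i, j, k, l)
  · rw [if_pos h, if_pos (h.1.trans h.2.1), if_pos h.1, if_pos (h.1.trans (h.2.1.trans h.2.2))]
    ring
  · rw [if_neg h]
    by_cases a1 : lam i = lam j
    · by_cases a2 : lam i = lam k
      · have a3 : lam i ≠ lam l := fun a3 => h ⟨a1, a1.symm.trans a2, a2.symm.trans a3⟩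
        rw [if_neg a3]; ring
      · rw [if_neg a2]; ring
    · rw [if_neg a1]; ring

open Polynomial in
-- Coincident quadruples contribute g'''/6 and are handled separately. For the others the sum is
-- moved inside Peano's integral, where the integrand is nonnegative for almost every t.
lemma re_sum_polyDiffThree_nonneg {Q : Matrix ι ι ℂ} (hQ : Q.IsHermitian) (lam : ι → ℝ) (g : ℝ[X])
    {R : ℝ} (hl : ∀ i, lam i ∈ Set.Ioo (-R) R)
    (hg : ∀ t ∈ Set.Icc (-R) R, 0 ≤ (derivative (derivative (derivative g))).eval t) :
    0 ≤ ∑ i, ∑ j, ∑ k, ∑ l, polyDiffThree g (lam i) (lam j) (lam k) (lam l)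
      * (Q i j * Q j k * Q k l * Q l i).re := by
  classical
  rcases isEmpty_or_nonempty ι with he | ⟨⟨i₀⟩⟩
  · simp
  have hR : -R ≤ R := by linarith [(hl i₀).1, (hl i₀).2]
  obtain ⟨K, hK⟩ : ∃ K : ι × ι × ι × ι → ℝ → ℝ, ∀ p t, K p t =
    peanoThree (lam p.1 - t) (lam p.2.1 - t) (lam p.2.2.1 - t) (lam p.2.2.2 - t) := ⟨_, fun _ _ => rfl⟩
  obtain ⟨q, hq⟩ : ∃ q : ι × ι × ι × ι → ℝ, ∀ p, q p =
    (Q p.1 p.2.1 * Q p.2.1 p.2.2.1 * Q p.2.2.1 p.2.2.2 * Q p.2.2.2 p.1).re := ⟨_, fun _ => rfl⟩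
  have h1 := re_sum_sameNode_nonneg hQ lam
    (fun x => (derivative (derivative (derivative g))).eval x / 6) (fun i => by
        have := hg (lam i) ⟨(hl i).1.le, (hl i).2.le⟩
        positivity)
  have peano := fun p : ι × ι × ι × ι => fun h : ¬ SameNode lam p =>
    polyDiffThree_eq_integral g (hl p.1) (hl p.2.1) (hl p.2.2.1) (hl p.2.2.2) h
  have diag : ∀ p : ι × ι × ι × ι, SameNode lam p →
      polyDiffThree g (lam p.1) (lam p.2.1) (lam p.2.2.1) (lam p.2.2.2)
        = (derivative (derivative (derivative g))).eval (lam p.1) / 6 := fun p h => by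
    rw [← h.2.2, ← h.2.1, ← h.1, polyDiffThree_diag]
  simp only [← hK, ← hq] at peano h1
  rw [sum_four_eq fun p => polyDiffThree g (lam p.1) (lam p.2.1) (lam p.2.2.1) (lam p.2.2.2)
      * (Q p.1 p.2.1 * Q p.2.1 p.2.2.1 * Q p.2.2.1 p.2.2.2 * Q p.2.2.2 p.1).re]
  have pos : ∀ t, t ∉ Finset.univ.image lam → 0 ≤ ∑ p, K p t * q p := fun t _ => by
    have := re_sum_peanoThree_nonneg hQ (fun i => lam i - t)
    rw [sum_four_eq fun p => peanoThree (lam p.1 - t) (lam p.2.1 - t) (lam p.2.2.1 - t)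
      (lam p.2.2.2 - t)
      * (Q p.1 p.2.1 * Q p.2.1 p.2.2.1 * Q p.2.2.1 p.2.2.2 * Q p.2.2.2 p.1).re] at this
    simpa only [← hK, ← hq] using this
  -- The kernel vanishes on coincident quadruples, so under the integral the restricted sum may be
  -- completed to the full one, to which `re_sum_peanoThree_nonneg` applies.
  have Kdiag : ∀ t p, SameNode lam p → K p t = 0 := by
    intro t p h
    rw [hK, ← h.2.2, ← h.2.1, ← h.1]
    simp only [peanoThree, sosCoeff, (mul_self_nonneg (lam p.1 - t)).not_gt, if_false, mul_zero,
      add_zero]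
  simp only [← hq]
  clear hq hK
  generalize derivative (derivative (derivative g)) = g₃ at *
  have h2 : 0 ≤ ∑ p, if SameNode lam p then 0
      else ∫ t in (-R)..R, (1 / 2) * (g₃.eval t * K p t * q p) := by
    have int : ∀ p, IntervalIntegrable (fun t => if SameNode lam p then 0
        else (1 / 2) * (g₃.eval t * K p t * q p)) volume (-R) R := by
      intro p
      by_cases h : SameNode lam p
      · simp [h]
      · simp only [h, if_false]
        exact ((peano p h).1.mul_const _).const_mul _
    have e : (∑ p, if SameNode lam p then 0
        else ∫ t in (-R)..R, (1 / 2) * (g₃.eval t * K p t * q p))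
        = ∫ t in (-R)..R, ∑ p, if SameNode lam p then 0
          else (1 / 2) * (g₃.eval t * K p t * q p) := by
      rw [intervalIntegral.integral_finsetSum fun p _ => int p]
      refine Finset.sum_congr rfl fun p _ => ?_
      split_ifs <;> simp
    rw [e]
    refine intervalIntegral.integral_nonneg_of_ae_restrict hR ?_
    have aenot : ∀ᵐ t : ℝ, t ∉ Finset.univ.image lam :=
      (compl_mem_ae_iff (s := ((Finset.univ.image lam : Finset ℝ) : Set ℝ))).2
        (Finset.finite_toSet _ |>.measure_zero _)
    filter_upwards [ae_restrict_of_ae aenot, ae_restrict_mem measurableSet_Icc] with t ht htm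
    have e2 : (∑ p, if SameNode lam p then 0 else (1 / 2) * (g₃.eval t * K p t * q p))
        = (1 / 2) * (g₃.eval t * ∑ p, K p t * q p) := by
      simp only [Finset.mul_sum]
      refine Finset.sum_congr rfl fun p _ => ?_
      split_ifs with h
      · rw [Kdiag t p h]; ring
      · ring
    rw [e2]
    have h3 := hg t htm
    have h4 := pos t ht
    simp only [Pi.zero_apply]
    positivity
  refine (add_nonneg h1 h2).trans_eq ?_
  rw [← Finset.sum_add_distrib]
  refine Finset.sum_congr rfl fun p _ => ?_
  by_cases h : SameNode lam p
  · rw [if_pos h, if_pos h, diag p h, add_zero]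
  · rw [if_neg h, if_neg h, (peano p h).2, intervalIntegral.integral_const_mul,
      intervalIntegral.integral_mul_const]
    ring

end Sos

end DerandInv

namespace DerandInv

/-! ### Expansion of powers of a sum -/

section PowCoeff

variable {R : Type*} [Ring R]

/-- The coefficient of `s ^ k` in `(A + s Q) ^ N`, for a central variable `s`. -/
def powCoeff (A Q : R) : ℕ → ℕ → R
  | 0, 0 => 1
  | _ + 1, 0 => 0
  | 0, N + 1 => A * powCoeff A Q 0 N
  | k + 1, N + 1 => A * powCoeff A Q (k + 1) N + Q * powCoeff A Q k N

lemma powCoeff_zero (A Q : R) (N : ℕ) : powCoeff A Q 0 N = A ^ N := by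
  induction N with
  | zero => simp [powCoeff]
  | succ N ih => rw [powCoeff, ih, pow_succ']

lemma powCoeff_of_lt (A Q : R) {k N : ℕ} (h : N < k) : powCoeff A Q k N = 0 := by
  induction N generalizing k with
  | zero => obtain ⟨k, rfl⟩ := Nat.exists_eq_add_one_of_ne_zero (by omega : k ≠ 0); rfl
  | succ N ih =>
    obtain ⟨k, rfl⟩ := Nat.exists_eq_add_one_of_ne_zero (by omega : k ≠ 0)
    rw [powCoeff, ih (by omega), ih (by omega)]; simp

lemma powCoeff_self (A Q : R) (N : ℕ) : powCoeff A Q N N = Q ^ N := by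
  induction N with
  | zero => simp [powCoeff]
  | succ N ih => rw [powCoeff, ih, powCoeff_of_lt A Q N.lt_succ_self, mul_zero, zero_add, pow_succ']

lemma map_powCoeff {S : Type*} [Ring S] (φ : R →+* S) (A Q : R) (k N : ℕ) :
    φ (powCoeff A Q k N) = powCoeff (φ A) (φ Q) k N := by
  induction N generalizing k with
  | zero => cases k <;> simp [powCoeff]
  | succ N ih => cases k <;> simp [powCoeff, ih]

lemma add_smul_pow {𝕜 : Type*} [CommRing 𝕜] [Algebra 𝕜 R] (A Q : R) (s : 𝕜) (N L : ℕ) (h : N < L) :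
    (A + s • Q) ^ N = ∑ k ∈ range L, s ^ k • powCoeff A Q k N := by
  induction N generalizing L with
  | zero =>
    rw [Finset.sum_eq_single 0]
    · simp [powCoeff]
    · intro k _ hk; rw [powCoeff_of_lt A Q (Nat.pos_of_ne_zero hk), smul_zero]
    · simp; omega
  | succ N ih =>
    obtain ⟨L, rfl⟩ := Nat.exists_eq_add_one_of_ne_zero (by omega : L ≠ 0)
    rw [pow_succ', add_mul, Finset.sum_range_succ']
    conv_lhs => arg 1; rw [ih (L + 1) (by omega), Finset.sum_range_succ']
    rw [ih L (by omega), mul_add, add_right_comm]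
    congr 1
    · rw [Finset.mul_sum, Finset.mul_sum, ← Finset.sum_add_distrib]
      refine Finset.sum_congr rfl fun k _ => ?_
      rw [powCoeff, smul_add, pow_succ, mul_smul_comm, smul_mul_assoc, mul_smul_comm, smul_smul,
        mul_comm s]
    · simp [powCoeff]

open Polynomial in
lemma coeff_C_add_X_mul_C_pow (A Q : R) (k N : ℕ) :
    ((C A + X * C Q) ^ N).coeff k = powCoeff A Q k N := by
  induction N generalizing k with
  | zero => cases k <;> simp [powCoeff, coeff_one]
  | succ N ih =>
    rw [pow_succ', add_mul, coeff_add, coeff_C_mul, mul_assoc]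
    cases k with
    | zero => rw [ih, mul_coeff_zero, coeff_X_zero, zero_mul, add_zero, powCoeff]
    | succ k => rw [coeff_X_mul, coeff_C_mul, ih, ih, powCoeff]

end PowCoeff

/-! ### Trace coefficients as divided differences -/

section Trace

variable {ι : Type*} [Fintype ι] [DecidableEq ι]

open Polynomial in
lemma trace_coeff_mul_comm (p q : (Matrix ι ι ℂ)[X]) (k : ℕ) :
    ((p * q).coeff k).trace = ((q * p).coeff k).trace := by
  rw [coeff_mul, coeff_mul, Matrix.trace_sum, Matrix.trace_sum,
    ← Finset.Nat.sum_antidiagonal_swap]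
  exact Finset.sum_congr rfl fun x _ => Matrix.trace_mul_comm _ _

open Polynomial in
-- Under the trace the factor Q in each term of the Leibniz rule can be moved to the end, giving N +
-- 1 equal terms. The commuting factor V absorbs the powers already split off and makes the
-- induction close.
lemma trace_coeff_derivative_pow (A Q : Matrix ι ι ℂ) (N k : ℕ) (V : (Matrix ι ι ℂ)[X])
    (hV : Commute V (C A + X * C Q)) :
    ((V * derivative ((C A + X * C Q) ^ (N + 1))).coeff k).trace
      = ((N : ℂ) + 1) * ((V * (C A + X * C Q) ^ N * C Q).coeff k).trace := by
  have hd : derivative (C A + X * C Q : (Matrix ι ι ℂ)[X]) = C Q := by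
    simp [derivative_mul]
  induction N generalizing V with
  | zero => simp only [zero_add, pow_one, hd]; simp
  | succ N ih =>
    rw [pow_succ, derivative_mul, hd, mul_add, coeff_add, Matrix.trace_add, ← mul_assoc,
      trace_coeff_mul_comm, ← mul_assoc, ih _ ((Commute.refl _).mul_left hV), ← hV.eq,
      mul_assoc V (C A + X * C Q) _, ← pow_succ', ← mul_assoc]
    push_cast
    ring

lemma trace_powCoeff_succ (A Q : Matrix ι ι ℂ) (k N : ℕ) :
    ((k : ℂ) + 1) * (powCoeff A Q (k + 1) (N + 1)).trace
      = ((N : ℂ) + 1) * (Q * powCoeff A Q k N).trace := by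
  have h := trace_coeff_derivative_pow A Q N k 1 (Commute.one_left _)
  rw [one_mul, one_mul, Polynomial.coeff_derivative, trace_coeff_mul_comm, Polynomial.coeff_C_mul,
    coeff_C_add_X_mul_C_pow, coeff_C_add_X_mul_C_pow] at h
  have e : ((k : Matrix ι ι ℂ) + 1) = ((k : ℂ) + 1) • 1 := by
    rw [← Nat.cast_succ, ← Nat.cast_succ, Nat.cast_smul_eq_nsmul, nsmul_one]
  rw [← h, e, mul_smul_comm, mul_one, Matrix.trace_smul, smul_eq_mul]

/-- In an eigenbasis the left-multiplication recurrence of `powCoeff` is, entry by entry, the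
recurrence defining divided differences of powers. -/
lemma powCoeff_diagonal (lam : ι → ℝ) (Q : Matrix ι ι ℂ) (N : ℕ) :
    (∀ i j, powCoeff (Matrix.diagonal fun i => (lam i : ℂ)) Q 1 N i j
      = powDiffOne N (lam i) (lam j) * Q i j) ∧
    (∀ i k, powCoeff (Matrix.diagonal fun i => (lam i : ℂ)) Q 2 N i k
      = ∑ j, powDiffTwo N (lam i) (lam j) (lam k) * (Q i j * Q j k)) ∧
    ∀ i l, powCoeff (Matrix.diagonal fun i => (lam i : ℂ)) Q 3 N i l
      = ∑ j, ∑ k, powDiffThree N (lam i) (lam j) (lam k) (lam l) * (Q i j * Q j k * Q k l) := by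
  induction N with
  | zero => simp [powCoeff, powDiffOne, powDiffTwo, powDiffThree]
  | succ N ih =>
    obtain ⟨h1, h2, h3⟩ := ih
    refine ⟨fun i j => ?_, fun i k => ?_, fun i l => ?_⟩
    · rw [powCoeff, Matrix.add_apply, Matrix.diagonal_mul, h1, powCoeff_zero,
        Matrix.diagonal_pow, Matrix.mul_diagonal, powDiffOne]
      simp only [Pi.pow_apply]
      push_cast; ring
    · rw [powCoeff, Matrix.add_apply, Matrix.diagonal_mul, h2, Matrix.mul_apply, Finset.mul_sum,
        ← Finset.sum_add_distrib]
      refine Finset.sum_congr rfl fun j _ => ?_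
      rw [h1, powDiffTwo]; push_cast; ring
    · rw [powCoeff, Matrix.add_apply, Matrix.diagonal_mul, h3, Matrix.mul_apply, Finset.mul_sum,
        ← Finset.sum_add_distrib]
      refine Finset.sum_congr rfl fun j _ => ?_
      rw [h2, Finset.mul_sum, Finset.mul_sum, ← Finset.sum_add_distrib]
      refine Finset.sum_congr rfl fun k _ => ?_
      rw [powDiffThree]; push_cast; ring

lemma trace_mul_powCoeff_diagonal (lam : ι → ℝ) (Q : Matrix ι ι ℂ) (N : ℕ) :
    (Q * powCoeff (Matrix.diagonal fun i => (lam i : ℂ)) Q 3 N).trace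
      = ∑ i, ∑ j, ∑ k, ∑ l, powDiffThree N (lam i) (lam j) (lam k) (lam l)
        * (Q i j * Q j k * Q k l * Q l i) := by
  rw [← sum_rotate]
  simp only [Matrix.trace, Matrix.diag_apply, Matrix.mul_apply, (powCoeff_diagonal lam Q N).2.2]
  refine Finset.sum_congr rfl fun i _ => Finset.sum_congr rfl fun j _ => ?_
  rw [Finset.mul_sum]
  refine Finset.sum_congr rfl fun k _ => ?_
  rw [Finset.mul_sum]
  refine Finset.sum_congr rfl fun l _ => ?_
  ring

open Polynomial

/-- The coefficient of `s ^ k` in the real part of `Tr q(A + s Q)`. -/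
noncomputable def traceCoeff (q : ℝ[X]) (A Q : Matrix ι ι ℂ) (k : ℕ) : ℝ :=
  q.sum fun N c => c * (powCoeff A Q k N).trace.re

lemma traceCoeff_add (p q : ℝ[X]) (A Q : Matrix ι ι ℂ) (k : ℕ) :
    traceCoeff (p + q) A Q k = traceCoeff p A Q k + traceCoeff q A Q k :=
  Polynomial.sum_add_index _ _ _ (fun _ => zero_mul _) fun _ _ _ => add_mul _ _ _

lemma traceCoeff_monomial (N : ℕ) (c : ℝ) (A Q : Matrix ι ι ℂ) (k : ℕ) :
    traceCoeff (monomial N c) A Q k = c * (powCoeff A Q k N).trace.re :=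
  Polynomial.sum_monomial_index _ _ (zero_mul _)

lemma polyDiffThree_add (p q : ℝ[X]) (a b c e : ℝ) :
    polyDiffThree (p + q) a b c e = polyDiffThree p a b c e + polyDiffThree q a b c e :=
  Polynomial.sum_add_index _ _ _ (fun _ => zero_mul _) fun _ _ _ => add_mul _ _ _

lemma polyDiffThree_monomial (N : ℕ) (x a b c e : ℝ) :
    polyDiffThree (monomial N x) a b c e = x * powDiffThree N a b c e :=
  Polynomial.sum_monomial_index _ _ (zero_mul _)

/-- Cyclicity of the trace trades the fourth-order coefficient of q for the third-order one of q',
so a third divided difference replaces a fourth. The factor 4 comes from `trace_powCoeff_succ` with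
k = 3. -/
lemma four_mul_traceCoeff_diagonal (q : ℝ[X]) (lam : ι → ℝ) (Q : Matrix ι ι ℂ) :
    4 * traceCoeff q (Matrix.diagonal fun i => (lam i : ℂ)) Q 4
      = ∑ i, ∑ j, ∑ k, ∑ l, polyDiffThree (derivative q) (lam i) (lam j) (lam k) (lam l)
        * (Q i j * Q j k * Q k l * Q l i).re := by
  induction q using Polynomial.induction_on' with
  | add p q hp hq =>
    rw [traceCoeff_add, mul_add, hp, hq]
    simp only [map_add, polyDiffThree_add, add_mul, Finset.sum_add_distrib]
  | monomial N c =>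
    rw [traceCoeff_monomial, derivative_monomial]
    simp only [polyDiffThree_monomial]
    cases N with
    | zero => simp [powCoeff]
    | succ N =>
      have h := congrArg Complex.re (trace_powCoeff_succ (Matrix.diagonal fun i => (lam i : ℂ)) Q 3 N)
      rw [trace_mul_powCoeff_diagonal] at h
      rw [show ((3 : ℕ) : ℂ) + 1 = ((4 : ℝ) : ℂ) by norm_num,
        show ((N : ℂ) + 1) = (((N : ℝ) + 1 : ℝ) : ℂ) by push_cast; ring, Complex.re_ofReal_mul,
        Complex.re_ofReal_mul] at h
      simp only [Complex.re_sum, Complex.re_ofReal_mul, Finset.mul_sum] at h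
      rw [mul_left_comm, h, Finset.mul_sum]
      simp only [Finset.mul_sum, Nat.add_sub_cancel]
      push_cast
      refine Finset.sum_congr rfl fun i _ => Finset.sum_congr rfl fun j _ =>
        Finset.sum_congr rfl fun k _ => Finset.sum_congr rfl fun l _ => ?_
      ring

lemma traceCoeff_conj (q : ℝ[X]) (U : unitary (Matrix ι ι ℂ)) (A Q : Matrix ι ι ℂ) (k : ℕ) :
    traceCoeff q (Unitary.conjStarAlgAut ℂ _ U A) (Unitary.conjStarAlgAut ℂ _ U Q) k
      = traceCoeff q A Q k := by
  unfold traceCoeff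
  congr 1
  ext N c
  have h := map_powCoeff (Unitary.conjStarAlgAut ℂ (Matrix ι ι ℂ) U : _ →+* Matrix ι ι ℂ) A Q k N
  have h2 : powCoeff (Unitary.conjStarAlgAut ℂ _ U A) (Unitary.conjStarAlgAut ℂ _ U Q) k N
      = Unitary.conjStarAlgAut ℂ _ U (powCoeff A Q k N) := h.symm
  rw [h2, Unitary.conjStarAlgAut_apply, Matrix.trace_mul_cycle, Unitary.coe_star_mul_self, one_mul]

/-- After conjugation to an eigenbasis of A, the third derivative of q' is the fourth of q, and
`re_sum_polyDiffThree_nonneg` applies with q' in the role of g. -/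
lemma traceCoeff_four_nonneg {A Q : Matrix ι ι ℂ} (hA : A.IsHermitian) (hQ : Q.IsHermitian)
    (q : ℝ[X]) {R : ℝ} (hl : ∀ i, hA.eigenvalues i ∈ Set.Ioo (-R) R)
    (hq : ∀ t ∈ Set.Icc (-R) R, 0 ≤ (derivative^[4] q).eval t) :
    0 ≤ traceCoeff q A Q 4 := by
  set U := hA.eigenvectorUnitary
  set Q' := (Unitary.conjStarAlgAut ℂ _ U).symm Q with hQ'
  have hQ'' : Q'.IsHermitian := by
    rw [Matrix.IsHermitian, ← Matrix.star_eq_conjTranspose, hQ', ← map_star,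
      Matrix.star_eq_conjTranspose, hQ.eq]
  have e : traceCoeff q A Q 4
      = traceCoeff q (Matrix.diagonal fun i => (hA.eigenvalues i : ℂ)) Q' 4 := by
    rw [← traceCoeff_conj q U _ Q' 4]
    congr 1
    · exact hA.spectral_theorem
    · rw [hQ', StarAlgEquiv.apply_symm_apply]
  have h := re_sum_polyDiffThree_nonneg hQ'' hA.eigenvalues (derivative q) hl hq
  rw [← four_mul_traceCoeff_diagonal, ← e] at h
  linarith

end Trace

end DerandInv

namespace DerandInv

/-! ### Trace Taylor expansion with fourth-order remainder -/

section TraceTaylor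

open Polynomial

/-- Let G(θ) be the cubic Taylor polynomial of Φ at θ, evaluated at 1. Its derivative telescopes to
Φ''''(θ)(1 - θ)³/6 ≥ 0, and G(0), G(1) are the two sides. -/
lemma taylor_le_eval_one (Φ : ℝ[X]) (h : ∀ θ ∈ Set.Icc (0 : ℝ) 1, 0 ≤ (taylor θ Φ).coeff 4) :
    ∑ k ∈ range 4, Φ.coeff k ≤ Φ.eval 1 := by
  have hc : ∀ (θ : ℝ) k, (taylor θ Φ).coeff k * k.factorial = (derivative^[k] Φ).eval θ := by
    intro θ k
    rw [taylor_coeff, ← factorial_smul_hasseDeriv]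
    simp [mul_comm]
  set G : ℝ → ℝ := fun θ => Φ.eval θ + (derivative Φ).eval θ * (1 - θ)
    + (derivative^[2] Φ).eval θ / 2 * (1 - θ) ^ 2 + (derivative^[3] Φ).eval θ / 6 * (1 - θ) ^ 3
    with hG
  have hd : ∀ θ, HasDerivAt G ((derivative^[4] Φ).eval θ / 6 * (1 - θ) ^ 3) θ := by
    intro θ
    have hs : HasDerivAt (fun t : ℝ => 1 - t) (-1) θ := by
      simpa using (hasDerivAt_id θ).const_sub 1
    have h1 : HasDerivAt (fun t => (derivative Φ).eval t) ((derivative^[2] Φ).eval θ) θ :=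
      (derivative Φ).hasDerivAt θ
    have h2 : HasDerivAt (fun t => (derivative^[2] Φ).eval t) ((derivative^[3] Φ).eval θ) θ := by
      simpa only [Function.iterate_succ_apply'] using (derivative^[2] Φ).hasDerivAt θ
    have h3 : HasDerivAt (fun t => (derivative^[3] Φ).eval t) ((derivative^[4] Φ).eval θ) θ := by
      simpa only [Function.iterate_succ_apply'] using (derivative^[3] Φ).hasDerivAt θ
    refine HasDerivAt.congr_deriv ((((Φ.hasDerivAt θ).add (h1.mul hs)).add
      ((h2.div_const 2).mul (hs.pow 2))).add ((h3.div_const 6).mul (hs.pow 3))) ?_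
    have e2 : ((fun t : ℝ => 1 - t) ^ 2) θ = (1 - θ) ^ 2 := rfl
    rw [e2]
    push_cast
    ring
  have hm : MonotoneOn G (Set.Icc 0 1) := by
    refine monotoneOn_of_deriv_nonneg (convex_Icc 0 1)
      (fun θ _ => (hd θ).continuousAt.continuousWithinAt)
      (fun θ _ => (hd θ).differentiableAt.differentiableWithinAt) fun θ hθ => ?_
    rw [interior_Icc] at hθ
    rw [(hd θ).deriv]
    have := h θ ⟨hθ.1.le, hθ.2.le⟩
    have h4 := hc θ 4
    have : 0 ≤ (derivative^[4] Φ).eval θ := by rw [← h4]; positivity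
    have : 0 ≤ 1 - θ := by linarith [hθ.2]
    positivity
  have h01 := hm (Set.left_mem_Icc.2 zero_le_one) (Set.right_mem_Icc.2 zero_le_one) zero_le_one
  have e : ∀ k, (derivative^[k] Φ).eval 0 = Φ.coeff k * k.factorial := fun k => by
    rw [← hc 0 k]; simp
  have e0 := e 0
  have e1 := e 1
  have e2 := e 2
  have e3 := e 3
  simp only [hG, Function.iterate_zero, id, Function.iterate_one] at h01 e0 e1
  rw [e0, e1, e2, e3] at h01
  simp [Finset.sum_range_succ, Nat.factorial] at h01 ⊢
  linarith

variable {ι : Type*} [Fintype ι] [DecidableEq ι]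

lemma traceCoeff_neg (q : ℝ[X]) (A Q : Matrix ι ι ℂ) (k : ℕ) :
    traceCoeff (-q) A Q k = -traceCoeff q A Q k := by
  have h := traceCoeff_add q (-q) A Q k
  rw [add_neg_cancel, traceCoeff, Polynomial.sum_zero_index] at h
  linarith

lemma re_trace_aeval (q : ℝ[X]) (A Q : Matrix ι ι ℂ) {L : ℕ} (hL : q.natDegree < L) (s : ℝ) :
    (aeval (A + (s : ℂ) • Q) q).trace.re = ∑ k ∈ range L, traceCoeff q A Q k * s ^ k := by
  have hN : ∀ N ∈ q.support, ((A + (s : ℂ) • Q) ^ N).trace.re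
      = ∑ k ∈ range L, s ^ k * (powCoeff A Q k N).trace.re := by
    intro N hN
    rw [add_smul_pow A Q (s : ℂ) N L ((le_natDegree_of_mem_supp N hN).trans_lt hL),
      Matrix.trace_sum, Complex.re_sum]
    refine Finset.sum_congr rfl fun k _ => ?_
    rw [Matrix.trace_smul, smul_eq_mul, ← Complex.ofReal_pow, Complex.re_ofReal_mul]
  rw [aeval_eq_sum_range, Matrix.trace_sum, Complex.re_sum]
  unfold traceCoeff
  simp only [Polynomial.sum_def, Finset.sum_mul]
  rw [Finset.sum_comm]
  rw [← Finset.sum_subset (s₁ := q.support)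
    (fun N hN => Finset.mem_range.2 (Nat.lt_succ_of_le (le_natDegree_of_mem_supp N hN)))]
  · refine Finset.sum_congr rfl fun N hN' => ?_
    rw [Matrix.trace_smul, Complex.real_smul, Complex.re_ofReal_mul, hN N hN', Finset.mul_sum]
    exact Finset.sum_congr rfl fun k _ => by ring
  · intro N _ hN'
    rw [notMem_support_iff.1 hN', zero_smul, Matrix.trace_zero, Complex.zero_re]

/-- A polynomial with nonnegative fourth derivative dominates its third-order trace Taylor
expansion. -/
lemma trace_taylor_le {A Q : Matrix ι ι ℂ} (hA : A.IsHermitian) (hQ : Q.IsHermitian) (q : ℝ[X])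
    {R : ℝ} (hsp : ∀ θ ∈ Set.Icc (0 : ℝ) 1, spectrum ℝ (A + (θ : ℂ) • Q) ⊆ Set.Ioo (-R) R)
    (hq : ∀ t ∈ Set.Icc (-R) R, 0 ≤ (derivative^[4] q).eval t) :
    ∑ k ∈ range 4, traceCoeff q A Q k ≤ (aeval (A + Q) q).trace.re := by
  -- The margin 5 makes L exceed the degree of q and keeps the coefficient of index 4 in range.
  set L := q.natDegree + 5 with hL
  let Φ (B : Matrix ι ι ℂ) : ℝ[X] := ∑ k ∈ range L, monomial k (traceCoeff q B Q k)
  have hΦc : ∀ B k, k < L → (Φ B).coeff k = traceCoeff q B Q k := by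
    intro B k hk
    simp [Φ, finsetSum_coeff, coeff_monomial, hk]
  have hΦe : ∀ B (s : ℝ), (Φ B).eval s = (aeval (B + (s : ℂ) • Q) q).trace.re := by
    intro B s
    rw [re_trace_aeval q B Q (by omega : q.natDegree < L)]
    simp [Φ, eval_finsetSum]
  -- Shifting the variable by θ replaces the base point A by A + θQ, so the fourth coefficient is
  -- nonnegative at every point of the segment, not just at A.
  have ht : ∀ θ : ℝ, taylor θ (Φ A) = Φ (A + (θ : ℂ) • Q) := by
    intro θ
    refine Polynomial.funext fun s => ?_
    rw [taylor_eval, hΦe, hΦe]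
    congr 4
    push_cast
    rw [add_smul, add_comm ((s : ℂ) • Q), add_assoc]
  have h := taylor_le_eval_one (Φ A) fun θ hθ => by
    rw [ht, hΦc _ 4 (by omega)]
    have hB : (A + (θ : ℂ) • Q).IsHermitian := by
      refine hA.add ?_
      rw [Matrix.IsHermitian, Matrix.conjTranspose_smul, hQ.eq]
      simp
    refine traceCoeff_four_nonneg hB hQ q (R := R) (fun i => ?_) hq
    apply hsp θ hθ
    rw [hB.spectrum_real_eq_range_eigenvalues]
    exact Set.mem_range_self i
  rw [hΦe] at h
  simp only [Complex.ofReal_one, one_smul] at h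
  refine le_trans (le_of_eq ?_) h
  refine Finset.sum_congr rfl fun k hk => (hΦc _ _ ?_).symm
  have := Finset.mem_range.1 hk
  omega

/-- Third-order trace Taylor expansion with a sharp fourth-order remainder. -/
lemma abs_trace_taylor_le {A Q : Matrix ι ι ℂ} (hA : A.IsHermitian) (hQ : Q.IsHermitian) (q : ℝ[X])
    {R : ℝ} (hsp : ∀ θ ∈ Set.Icc (0 : ℝ) 1, spectrum ℝ (A + (θ : ℂ) • Q) ⊆ Set.Ioo (-R) R)
    {c : ℝ} (hq : ∀ t ∈ Set.Icc (-R) R, |(derivative^[4] q).eval t| ≤ c) :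
    |(aeval (A + Q) q).trace.re - ∑ k ∈ range 4, traceCoeff q A Q k|
      ≤ c / 24 * (Q ^ 4).trace.re := by
  -- The monomial (c/24)x⁴ has fourth derivative c, so adding it to q or to -q makes the fourth
  -- derivative nonnegative.
  have hX : derivative^[4] (monomial 4 (c / 24) : ℝ[X]) = C c := by
    simp only [Function.iterate_succ_apply', Function.iterate_zero, id, derivative_monomial]
    norm_num
    simp only [← C_mul]
    congr 1
    ring
  have h1 := trace_taylor_le hA hQ (monomial 4 (c / 24) + q) hsp fun t ht => by
    rw [iterate_map_add, hX, eval_add, eval_C]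
    linarith [neg_abs_le ((derivative^[4] q).eval t), hq t ht]
  have h2 := trace_taylor_le hA hQ (monomial 4 (c / 24) + -q) hsp fun t ht => by
    rw [iterate_map_add, iterate_map_neg, hX, eval_add, eval_C, eval_neg]
    linarith [le_abs_self ((derivative^[4] q).eval t), hq t ht]
  -- For the monomial the expansion stops at order four, and its last coefficient is exactly the
  -- claimed remainder (c/24) Tr Q⁴.
  have h3 := re_trace_aeval (monomial 4 (c / 24)) A Q (L := 5)
    ((natDegree_monomial_le _).trans_lt (by norm_num)) 1
  simp only [Complex.ofReal_one, one_smul, one_pow, mul_one] at h3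
  rw [Finset.sum_range_succ, traceCoeff_monomial _ _ _ _ 4, powCoeff_self] at h3
  simp only [traceCoeff_add, traceCoeff_neg, Finset.sum_add_distrib, Finset.sum_neg_distrib,
    map_add, map_neg, Matrix.trace_add, Matrix.trace_neg, Complex.add_re, Complex.neg_re] at h1 h2
  rw [abs_le]
  constructor <;> linarith

end TraceTaylor

end DerandInv

namespace DerandInv

/-! ### Spectral functions and polynomial approximation -/

section NTr

variable {m h : ℕ}

lemma nTr_eq_sum {A : Op m h} (hA : A.IsHermitian) (f : ℝ → ℝ) :
    nTr f A = (1 / (m : ℝ) ^ h) * ∑ i, f (hA.eigenvalues i) := by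
  rw [nTr, hA.cfc_eq f, Matrix.IsHermitian.cfc, Unitary.conjStarAlgAut_apply,
    Matrix.trace_mul_cycle, Unitary.coe_star_mul_self, one_mul, Matrix.trace_diagonal,
    Complex.re_sum]
  rfl

lemma nTr_eval {A : Op m h} (hA : A.IsHermitian) (q : Polynomial ℝ) :
    nTr (fun x => q.eval x) A = (1 / (m : ℝ) ^ h) * (Polynomial.aeval A q).trace.re := by
  rw [nTr, cfc_polynomial q A hA.isSelfAdjoint]

lemma abs_nTr_sub_nTr_le (hm : 0 < m) {A : Op m h} (hA : A.IsHermitian) {f g : ℝ → ℝ} {ε : ℝ}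
    (hfg : ∀ x ∈ spectrum ℝ A, |f x - g x| ≤ ε) : |nTr f A - nTr g A| ≤ ε := by
  rw [nTr_eq_sum hA, nTr_eq_sum hA, ← mul_sub, ← Finset.sum_sub_distrib, abs_mul,
    abs_of_nonneg (by positivity)]
  have hm' : (0 : ℝ) < m := by exact_mod_cast hm
  have : |∑ i, (f (hA.eigenvalues i) - g (hA.eigenvalues i))| ≤ (m : ℝ) ^ h * ε := by
    refine (Finset.abs_sum_le_sum_abs _ _).trans ?_
    have : ∑ i : Fin h → Fin m, |f (hA.eigenvalues i) - g (hA.eigenvalues i)|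
        ≤ ∑ _i : Fin h → Fin m, ε := by
      refine Finset.sum_le_sum fun i _ => hfg _ ?_
      rw [hA.spectrum_real_eq_range_eigenvalues]
      exact Set.mem_range_self i
    refine this.trans_eq ?_
    simp
  calc _ ≤ 1 / (m : ℝ) ^ h * ((m : ℝ) ^ h * ε) := by gcongr
    _ = ε := by field_simp

/-- The spectrum of a Hermitian matrix is bounded by its Hilbert–Schmidt norm. -/
lemma sq_le_of_mem_spectrum {ι : Type*} [Fintype ι] [DecidableEq ι] {A : Matrix ι ι ℂ}
    (hA : A.IsHermitian) {x : ℝ} (hx : x ∈ spectrum ℝ A) : x ^ 2 ≤ ∑ i, ∑ j, ‖A i j‖ ^ 2 := by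
  rw [hA.spectrum_real_eq_range_eigenvalues] at hx
  obtain ⟨i, rfl⟩ := hx
  have h1 : (A * A).trace.re = ∑ i, hA.eigenvalues i ^ 2 := by
    conv_lhs => rw [hA.spectral_theorem, ← map_mul, Unitary.conjStarAlgAut_apply,
      Matrix.trace_mul_cycle, Unitary.coe_star_mul_self, one_mul, Matrix.diagonal_mul_diagonal,
      Matrix.trace_diagonal, Complex.re_sum]
    refine Finset.sum_congr rfl fun i _ => ?_
    simp [sq]
  have h2 : (A * A).trace.re = ∑ i, ∑ j, ‖A i j‖ ^ 2 := by
    simp only [Matrix.trace, Matrix.diag_apply, Matrix.mul_apply, Complex.re_sum]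
    refine Finset.sum_congr rfl fun i _ => Finset.sum_congr rfl fun j _ => ?_
    rw [← hA.apply j i, RCLike.star_def, Complex.mul_conj, Complex.ofReal_re,
      Complex.normSq_eq_norm_sq]
  rw [← h2, h1]
  exact Finset.single_le_sum (f := fun i => hA.eigenvalues i ^ 2) (fun _ _ => sq_nonneg _)
    (Finset.mem_univ i)

end NTr

/-! ### Polynomial approximation of a function and a derivative -/

section Approx

open Polynomial

lemma exists_derivative_eq (p : ℝ[X]) : ∃ q : ℝ[X], derivative q = p := by
  induction p using Polynomial.induction_on' with
  | add p q hp hq =>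
    obtain ⟨a, ha⟩ := hp
    obtain ⟨b, hb⟩ := hq
    exact ⟨a + b, by rw [map_add, ha, hb]⟩
  | monomial n c =>
    refine ⟨monomial (n + 1) (c / (n + 1)), ?_⟩
    rw [derivative_monomial]
    have : (n : ℝ) + 1 ≠ 0 := by positivity
    simp [this]

/-- Weierstrass approximation is applied to the highest derivative and integrated back up, matching
values at 0 each time. -/
lemma exists_polynomial_near_iteratedDeriv (k : ℕ) {f : ℝ → ℝ} (hf : ContDiff ℝ k f) {R ε : ℝ}
    (hR : 0 ≤ R) (hε : 0 < ε) :
    ∃ q : ℝ[X], ∀ x ∈ Set.Icc (-R) R, |f x - q.eval x| ≤ ε ∧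
      |iteratedDeriv k f x - (derivative^[k] q).eval x| ≤ ε := by
  induction k generalizing f ε with
  | zero =>
    obtain ⟨q, hq⟩ := exists_polynomial_near_of_continuousOn (-R) R f hf.continuous.continuousOn ε hε
    refine ⟨q, fun x hx => ?_⟩
    have : |f x - q.eval x| ≤ ε := by rw [abs_sub_comm]; exact (hq x hx).le
    simpa using this
  | succ k ih =>
    have hf' : ContDiff ℝ k (deriv f) := (contDiff_succ_iff_deriv.1 (by exact_mod_cast hf)).2.2
    have hd : Differentiable ℝ f := hf.differentiable (by simp)
    -- Integration from 0 multiplies the error by at most R; using R + 1 also ensures δ ≤ ε.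
    set δ := ε / (R + 1) with hδ
    have hδ0 : 0 < δ := by positivity
    have hδε : δ ≤ ε := div_le_self hε.le (by linarith)
    obtain ⟨p, hp⟩ := ih hf' hδ0
    obtain ⟨q₀, hq₀⟩ := exists_derivative_eq p
    set q := q₀ + C (f 0 - q₀.eval 0) with hq
    have hqd : derivative q = p := by simp [hq, hq₀]
    refine ⟨q, fun x hx => ⟨?_, ?_⟩⟩
    · have h := Convex.norm_image_sub_le_of_norm_deriv_le (𝕜 := ℝ) (f := fun x => f x - q.eval x)
        (s := Set.Icc (-R) R) (C := δ) (x := 0) (y := x)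
        (fun y _ => (hd y).sub q.differentiable.differentiableAt) (fun y hy => by
          rw [deriv_fun_sub (hd y) q.differentiable.differentiableAt, Polynomial.deriv, hqd]
          exact (hp y hy).1) (convex_Icc _ _) ⟨by linarith, hR⟩ hx
      have h0 : f 0 - q.eval 0 = 0 := by simp [hq]
      simp only [h0, sub_zero, Real.norm_eq_abs] at h
      refine h.trans ?_
      have : |x| ≤ R + 1 := (abs_le.2 hx).trans (by linarith)
      calc δ * |x| ≤ δ * (R + 1) := by gcongr
        _ = ε := by rw [hδ]; field_simp
    · rw [iteratedDeriv_succ', Function.iterate_succ_apply, hqd]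
      exact (hp x hx).2.trans hδε

end Approx

/-! ### A smooth approximation of `zeta` -/

section Zeta

/-- A smooth function at distance `O(l ^ 2)` from `zeta`. -/
noncomputable def smoothZeta (l x : ℝ) : ℝ := (x ^ 2 - x * √(x ^ 2 + l ^ 2)) / 2

variable {l : ℝ}

lemma contDiff_smoothZeta (hl : 0 < l) (n : ℕ) : ContDiff ℝ n (smoothZeta l) := by
  unfold smoothZeta
  have : ContDiff ℝ n fun x : ℝ => √(x ^ 2 + l ^ 2) :=
    ContDiff.sqrt (by fun_prop) fun x => by positivity
  fun_prop

/-- Since ζ(x) = (x² - x|x|)/2, smoothing replaces |x| by s = √(x² + l²); the error is |x|(s -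
|x|)/2 = |x|l²/(2(s + |x|)). -/
lemma abs_zeta_sub_smoothZeta_le (hl : 0 < l) (x : ℝ) : |zeta x - smoothZeta l x| ≤ l ^ 2 / 4 := by
  have hs : 0 < √(x ^ 2 + l ^ 2) := Real.sqrt_pos.2 (by positivity)
  have hsq : √(x ^ 2 + l ^ 2) ^ 2 = x ^ 2 + l ^ 2 := Real.sq_sqrt (by positivity)
  unfold zeta smoothZeta
  set s := √(x ^ 2 + l ^ 2)
  rw [abs_le]
  split_ifs with h
  · have h1 : -x ≤ s := by nlinarith [sq_nonneg l]
    constructor <;> nlinarith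
  · have h1 : x ≤ s := by nlinarith [sq_nonneg l]
    constructor <;> nlinarith

/-- The fourth derivative is 15 l⁴x/(2s⁷) with s = √(x² + l²), and both |x| and l are at most s. -/
lemma abs_iteratedDeriv_smoothZeta_le (hl : 0 < l) (x : ℝ) :
    |iteratedDeriv 4 (smoothZeta l) x| ≤ 15 / 2 / l ^ 2 := by
  have hs : ∀ x, 0 < √(x ^ 2 + l ^ 2) := fun x => Real.sqrt_pos.2 (by positivity)
  have hsq : ∀ x, √(x ^ 2 + l ^ 2) ^ 2 = x ^ 2 + l ^ 2 := fun x => Real.sq_sqrt (by positivity)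
  have hds : ∀ x, HasDerivAt (fun x => √(x ^ 2 + l ^ 2)) (x / √(x ^ 2 + l ^ 2)) x := fun x => by
    have h1 : HasDerivAt (fun x : ℝ => x ^ 2 + l ^ 2) (2 * x) x := by
      simpa using (hasDerivAt_pow 2 x).add_const (l ^ 2)
    refine (h1.sqrt (by positivity)).congr_deriv ?_
    field_simp
  have d1 : deriv (smoothZeta l)
      = fun x => x - (2 * x ^ 2 + l ^ 2) / (2 * √(x ^ 2 + l ^ 2)) := by
    funext x
    refine HasDerivAt.deriv ?_
    have := ((hasDerivAt_pow 2 x).sub ((hasDerivAt_id x).mul (hds x))).div_const 2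
    refine this.congr_deriv ?_
    have h1 := (hs x).ne'
    have h2 := hsq x
    simp only [Nat.cast_ofNat, id]
    set s := √(x ^ 2 + l ^ 2)
    field_simp
    norm_num
    linear_combination -h2
  have d2 : deriv (fun x => x - (2 * x ^ 2 + l ^ 2) / (2 * √(x ^ 2 + l ^ 2)))
      = fun x => 1 - (2 * x ^ 3 + 3 * x * l ^ 2) / (2 * √(x ^ 2 + l ^ 2) ^ 3) := by
    funext x
    refine HasDerivAt.deriv ?_
    have := (hasDerivAt_id x).sub ((((hasDerivAt_pow 2 x).const_mul 2).add_const (l ^ 2)).div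
      ((hds x).const_mul 2) (by have := hs x; positivity))
    refine this.congr_deriv ?_
    have h1 := (hs x).ne'
    have h2 := hsq x
    simp only [Nat.cast_ofNat]
    set s := √(x ^ 2 + l ^ 2)
    field_simp
    norm_num
    linear_combination (4 * x) * h2
  have d3 : deriv (fun x => 1 - (2 * x ^ 3 + 3 * x * l ^ 2) / (2 * √(x ^ 2 + l ^ 2) ^ 3))
      = fun x => - (3 * l ^ 4) / (2 * √(x ^ 2 + l ^ 2) ^ 5) := by
    funext x
    refine HasDerivAt.deriv ?_
    have := ((((hasDerivAt_pow 3 x).const_mul 2).add (((hasDerivAt_id x).const_mul 3).mul_const (l ^ 2))).div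
      (((hds x).pow 3).const_mul 2) (by
        have := hs x; change 2 * √(x ^ 2 + l ^ 2) ^ 3 ≠ 0; positivity)).const_sub 1
    refine this.congr_deriv ?_
    have h1 := (hs x).ne'
    have h2 := hsq x
    simp only [Pi.pow_apply, Nat.cast_ofNat, id]
    set s := √(x ^ 2 + l ^ 2)
    field_simp
    norm_num
    linear_combination (-(2 * x ^ 2 + l ^ 2) * s ^ 2) * h2
  have d4 : deriv (fun x => - (3 * l ^ 4) / (2 * √(x ^ 2 + l ^ 2) ^ 5))
      = fun x => (15 * l ^ 4 * x) / (2 * √(x ^ 2 + l ^ 2) ^ 7) := by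
    funext x
    refine HasDerivAt.deriv ?_
    have := (hasDerivAt_const x (- (3 * l ^ 4))).div
      (((hds x).pow 5).const_mul 2) (by
        have := hs x; change 2 * √(x ^ 2 + l ^ 2) ^ 5 ≠ 0; positivity)
    refine this.congr_deriv ?_
    have h1 := (hs x).ne'
    have h2 := hsq x
    simp only [Pi.pow_apply, Nat.cast_ofNat]
    set s := √(x ^ 2 + l ^ 2)
    field_simp
    norm_num
    ring
  rw [iteratedDeriv_succ', iteratedDeriv_succ', iteratedDeriv_succ', iteratedDeriv_one, d1, d2, d3,
    d4]
  have h1 := hs x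
  have h2 := hsq x
  set s := √(x ^ 2 + l ^ 2)
  have hxs : |x| ≤ s := abs_le_of_sq_le_sq (by nlinarith [sq_nonneg l]) h1.le
  have hls : l ≤ s := by nlinarith [sq_nonneg x]
  rw [abs_div, abs_mul, abs_of_pos (by positivity : 0 < 15 * l ^ 4),
    abs_of_pos (by positivity : 0 < 2 * s ^ 7), div_div, div_le_div_iff₀ (by positivity)
    (by positivity)]
  calc 15 * l ^ 4 * |x| * (2 * l ^ 2) = 30 * l ^ 6 * |x| := by ring
    _ ≤ 30 * s ^ 6 * s := by gcongr
    _ = 15 * (2 * s ^ 7) := by ring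

end Zeta

end DerandInv

namespace DerandInv

/-! ### Hypercontractivity for positive kernels -/

/-- The operator with nonnegative kernel `K` is a contraction from a weighted `ℓ²` space (weight
`c`) to the space on which the quartic form `w ∑ x, ∏ s, Z s (φ s x)` is defined, tested on
nonnegative functions. -/
structure IsHyper {X I : Type*} [Fintype X] [Fintype I] (w c : ℝ) (φ : Fin 4 → X → I)
    (K : I → I → ℝ) : Prop where
  weight_nonneg : 0 ≤ w
  const_nonneg : 0 ≤ c
  kernel_nonneg : ∀ i j, 0 ≤ K i j
  bound : ∀ a : Fin 4 → I → ℝ, (∀ s i, 0 ≤ a s i) →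
    w * ∑ x, ∏ s, ∑ i, K (φ s x) i * a s i ≤ ∏ s, √(c * ∑ i, a s i ^ 2)

namespace IsHyper

variable {X I X' I' : Type*} [Fintype X] [Fintype I] [Fintype X'] [Fintype I']
  {w c w' c' : ℝ} {φ : Fin 4 → X → I} {K : I → I → ℝ} {φ' : Fin 4 → X' → I'} {K' : I' → I' → ℝ}

/-- Expanding the first factor gives nonnegative combinations of the second form applied to slices.
The second inequality replaces each slice by its weighted ℓ² norm, and the first inequality is
applied to these norms. Nonnegativity of the kernel permits the inner replacement. -/
lemma prod (H : IsHyper w c φ K) (H' : IsHyper w' c' φ' K') :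
    IsHyper (w * w') (c * c') (fun s (x : X × X') => (φ s x.1, φ' s x.2))
      (fun i j => K i.1 j.1 * K' i.2 j.2) where
  weight_nonneg := mul_nonneg H.weight_nonneg H'.weight_nonneg
  const_nonneg := mul_nonneg H.const_nonneg H'.const_nonneg
  kernel_nonneg i j := mul_nonneg (H.kernel_nonneg _ _) (H'.kernel_nonneg _ _)
  bound a ha := by
    classical
    set b : Fin 4 → I → X' → ℝ := fun s i y => ∑ j, K' (φ' s y) j * a s (i, j) with hb
    set α : Fin 4 → I → ℝ := fun s i => √(c' * ∑ j, a s (i, j) ^ 2) with hα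
    have e1 : ∀ x : X × X', ∏ s, ∑ i : I × I', K (φ s x.1) i.1 * K' (φ' s x.2) i.2 * a s i
        = ∑ i : Fin 4 → I, (∏ s, K (φ s x.1) (i s)) * ∏ s, b s (i s) x.2 := by
      intro x
      have : ∀ s, ∑ i : I × I', K (φ s x.1) i.1 * K' (φ' s x.2) i.2 * a s i
          = ∑ i, K (φ s x.1) i * b s i x.2 := by
        intro s
        rw [Fintype.sum_prod_type]
        refine Finset.sum_congr rfl fun i _ => ?_
        rw [hb, Finset.mul_sum]
        exact Finset.sum_congr rfl fun j _ => by ring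
      simp only [this]
      rw [Finset.prod_univ_sum, Fintype.piFinset_univ]
      exact Finset.sum_congr rfl fun i _ => Finset.prod_mul_distrib
    have inner : ∀ i : Fin 4 → I, w' * ∑ y, ∏ s, b s (i s) y ≤ ∏ s, α s (i s) := fun i =>
      H'.bound (fun s j => a s (i s, j)) fun s j => ha s _
    have hαsq : ∀ s, ∑ i, α s i ^ 2 = c' * ∑ i, a s i ^ 2 := by
      intro s
      rw [Fintype.sum_prod_type, Finset.mul_sum]
      refine Finset.sum_congr rfl fun i _ => Real.sq_sqrt ?_
      exact mul_nonneg H'.const_nonneg (Finset.sum_nonneg fun _ _ => sq_nonneg _)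
    calc w * w' * ∑ x : X × X', ∏ s, ∑ i : I × I', K (φ s x.1) i.1 * K' (φ' s x.2) i.2 * a s i
        = w * ∑ x, ∑ i : Fin 4 → I, (∏ s, K (φ s x) (i s)) * (w' * ∑ y, ∏ s, b s (i s) y) := by
          simp only [e1]
          rw [Fintype.sum_prod_type, mul_assoc]
          congr 1
          rw [Finset.mul_sum]
          refine Finset.sum_congr rfl fun x _ => ?_
          rw [Finset.sum_comm, Finset.mul_sum]
          refine Finset.sum_congr rfl fun i _ => ?_
          simp only [← Finset.mul_sum]
          ring
      _ ≤ w * ∑ x, ∑ i : Fin 4 → I, (∏ s, K (φ s x) (i s)) * ∏ s, α s (i s) := by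
          refine mul_le_mul_of_nonneg_left ?_ H.weight_nonneg
          refine Finset.sum_le_sum fun x _ => Finset.sum_le_sum fun i _ => ?_
          exact mul_le_mul_of_nonneg_left (inner i)
            (Finset.prod_nonneg fun s _ => H.kernel_nonneg _ _)
      _ = w * ∑ x, ∏ s, ∑ i, K (φ s x) i * α s i := by
          congr 1
          refine Finset.sum_congr rfl fun x _ => ?_
          rw [Finset.prod_univ_sum, Fintype.piFinset_univ]
          exact Finset.sum_congr rfl fun i _ => Finset.prod_mul_distrib.symm
      _ ≤ ∏ s, √(c * ∑ i, α s i ^ 2) := H.bound α fun s i => Real.sqrt_nonneg _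
      _ = ∏ s, √(c * c' * ∑ i, a s i ^ 2) := by simp only [hαsq, mul_assoc]

lemma transport (H : IsHyper w c φ K) {Y J : Type*} [Fintype Y] [Fintype J] (e : Y ≃ X)
    (f : J ≃ I) : IsHyper w c (fun s y => f.symm (φ s (e y))) (fun i j => K (f i) (f j)) where
  weight_nonneg := H.weight_nonneg
  const_nonneg := H.const_nonneg
  kernel_nonneg _ _ := H.kernel_nonneg _ _
  bound a ha := by
    have := H.bound (fun s i => a s (f.symm i)) fun s i => ha s _
    rw [← e.sum_comp] at this
    have h1 : ∀ s (u : I), ∑ i, K u i * a s (f.symm i) = ∑ j, K u (f j) * a s j := fun s u => by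
      rw [← f.sum_comp]; simp
    have h2 : ∀ s, ∑ i, a s (f.symm i) ^ 2 = ∑ j, a s j ^ 2 := fun s => by
      rw [← f.sum_comp]; simp
    simpa only [h1, h2, Equiv.apply_symm_apply] using this

lemma pow (H : IsHyper w c φ K) (h : ℕ) :
    IsHyper (w ^ h) (c ^ h) (fun s (x : Fin h → X) i => φ s (x i))
      (fun u v => ∏ i, K (u i) (v i)) := by
  induction h with
  | zero =>
    refine ⟨by simp, by simp, by simp, fun a ha => ?_⟩
    simp [Real.sqrt_sq, ha]
  | succ h ih =>
    have := (H.prod ih).transport (Fin.consEquiv fun _ => X).symm (Fin.consEquiv fun _ => I).symm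
    rw [pow_succ', pow_succ']
    convert this using 1
    · funext s x
      refine funext fun i => ?_
      refine Fin.cases ?_ (fun j => ?_) i <;> simp [Fin.consEquiv, Fin.tail]
    · funext u v
      rw [Fin.prod_univ_succ]
      rfl

/-- A kernel acting on nonnegative functions controls complex functions as well. -/
lemma norm_bound (H : IsHyper w c φ K) (a : Fin 4 → I → ℂ) :
    w * ‖∑ x, ∏ s, ∑ i, (K (φ s x) i : ℂ) * a s i‖ ≤ ∏ s, √(c * ∑ i, ‖a s i‖ ^ 2) := by
  refine le_trans (mul_le_mul_of_nonneg_left ?_ H.weight_nonneg)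
    (H.bound (fun s i => ‖a s i‖) fun _ _ => norm_nonneg _)
  refine (norm_sum_le _ _).trans (Finset.sum_le_sum fun x _ => ?_)
  rw [norm_prod]
  refine Finset.prod_le_prod (fun _ _ => norm_nonneg _) fun s _ => ?_
  refine (norm_sum_le _ _).trans (Finset.sum_le_sum fun i _ => ?_)
  rw [norm_mul, Complex.norm_real, Real.norm_of_nonneg (H.kernel_nonneg _ _)]

end IsHyper

lemma le_prod_sqrt_of_pow_four_le {x : ℝ} {N : Fin 4 → ℝ} (hN : ∀ s, 0 ≤ N s)
    (h : x ^ 4 ≤ ∏ s, N s ^ 2) : x ≤ ∏ s, √(N s) := by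
  by_contra! hlt
  have h0 : 0 ≤ ∏ s, √(N s) := Finset.prod_nonneg fun _ _ => Real.sqrt_nonneg _
  have := pow_lt_pow_left₀ hlt h0 (n := 4) (by norm_num)
  rw [← Finset.prod_pow] at this
  have e : ∀ s, √(N s) ^ 4 = N s ^ 2 := fun s => by
    rw [show 4 = 2 * 2 by norm_num, pow_mul, Real.sq_sqrt (hN s)]
  simp only [e] at this
  linarith

lemma sum_fin_succ_fun {α M : Type*} [Fintype α] [AddCommMonoid M] {n : ℕ}
    (f : (Fin (n + 1) → α) → M) : ∑ x, f x = ∑ a, ∑ x : Fin n → α, f (Matrix.vecCons a x) := by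
  rw [← (Fin.consEquiv fun _ => α).sum_comp, Fintype.sum_prod_type]
  rfl

lemma sum_fin_four_fun {α M : Type*} [Fintype α] [AddCommMonoid M] (f : (Fin 4 → α) → M) :
    ∑ x, f x = ∑ a, ∑ b, ∑ c, ∑ e, f ![a, b, c, e] := by
  have e : (default : Fin 0 → α) = ![] := Subsingleton.elim _ _
  simp only [sum_fin_succ_fun, Finset.univ_unique, Finset.sum_singleton, e]

/-! #### One bit -/

lemma sum_units {M : Type*} [AddCommMonoid M] (f : ℤˣ → M) : ∑ x, f x = f 1 + f (-1) := by
  rw [show (univ : Finset ℤˣ) = {1, -1} by decide, Finset.sum_pair (by decide)]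

/-- The noise kernel on a bit. -/
noncomputable def bitKernel (γ : ℝ) (x y : ℤˣ) : ℝ := (1 + γ * (((x * y : ℤˣ) : ℤ) : ℝ)) / 2

/-- Cauchy–Schwarz twice reduces four functions to one. With mean a and half-difference b, what
remains is Bonami's two-point inequality a⁴ + 6γ²a²b² + γ⁴b⁴ ≤ (a² + b²)², which holds for γ² ≤ 1/3.
-/
lemma isHyper_bit {γ : ℝ} (h0 : 0 ≤ γ) (h1 : γ ^ 2 ≤ 1 / 3) :
    IsHyper (1 / 2) (1 / 2) (fun _ (x : ℤˣ) => x) (bitKernel γ) where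
  weight_nonneg := by norm_num
  const_nonneg := by norm_num
  kernel_nonneg i j := by
    have : γ ≤ 1 := by nlinarith
    rcases Int.units_eq_one_or (i * j) with h | h <;> simp [bitKernel, h] <;> linarith
  bound a ha := by
    refine le_prod_sqrt_of_pow_four_le
      (fun s => mul_nonneg (by norm_num) (Finset.sum_nonneg fun _ _ => sq_nonneg _)) ?_
    set Z : Fin 4 → ℤˣ → ℝ := fun s x => ∑ i, bitKernel γ x i * a s i with hZ
    have one : ∀ s, (1 / 2) * ∑ x, Z s x ^ 4 ≤ ((1 / 2) * ∑ i, a s i ^ 2) ^ 2 := by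
      intro s
      simp only [hZ, sum_units, bitKernel]
      norm_num
      nlinarith [mul_nonneg (sub_nonneg.2 h1) (sq_nonneg ((a s 1) ^ 2 - (a s (-1)) ^ 2)),
        mul_nonneg (sub_nonneg.2 h1) (sq_nonneg ((a s 1 - a s (-1)) ^ 2)),
        mul_nonneg (mul_nonneg (sub_nonneg.2 h1) (sq_nonneg γ))
          (sq_nonneg ((a s 1 - a s (-1)) ^ 2)), sq_nonneg ((a s 1 - a s (-1)) ^ 2)]
    have cs : ∀ f g : ℤˣ → ℝ, (∑ x, f x * g x) ^ 2 ≤ (∑ x, f x ^ 2) * ∑ x, g x ^ 2 :=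
      fun f g => Finset.sum_mul_sq_le_sq_mul_sq _ f g
    have c1 := cs (fun x => Z 0 x * Z 1 x) (fun x => Z 2 x * Z 3 x)
    have c2 := cs (fun x => Z 0 x ^ 2) (fun x => Z 1 x ^ 2)
    have c3 := cs (fun x => Z 2 x ^ 2) (fun x => Z 3 x ^ 2)
    simp only [mul_pow, ← pow_mul, Nat.reduceMul] at c1 c2 c3
    have hn : ∀ f : ℤˣ → ℝ, (∀ x, 0 ≤ f x) → 0 ≤ ∑ x, f x := fun f hf =>
      Finset.sum_nonneg fun x _ => hf x
    calc (1 / 2 * ∑ x, ∏ s, Z s x) ^ 4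
        = (1 / 16) * ((∑ x, Z 0 x * Z 1 x * (Z 2 x * Z 3 x)) ^ 2) ^ 2 := by
          simp only [Fin.prod_univ_four]
          rw [mul_pow, ← pow_mul]
          norm_num [mul_assoc]
      _ ≤ (1 / 16) * ((∑ x, Z 0 x ^ 2 * Z 1 x ^ 2) * ∑ x, Z 2 x ^ 2 * Z 3 x ^ 2) ^ 2 := by
          gcongr
      _ ≤ (1 / 16) * (((∑ x, Z 0 x ^ 4) * ∑ x, Z 1 x ^ 4)
            * ((∑ x, Z 2 x ^ 4) * ∑ x, Z 3 x ^ 4)) := by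
          rw [mul_pow]
          gcongr
      _ = ∏ s, ((1 / 2) * ∑ x, Z s x ^ 4) := by
          simp only [Fin.prod_univ_four]; ring
      _ ≤ ∏ s, ((1 / 2) * ∑ i, a s i ^ 2) ^ 2 :=
          Finset.prod_le_prod (fun s _ => mul_nonneg (by norm_num)
            (hn _ fun x => by positivity)) fun s _ => one s

/-! #### One qudit -/

section Qudit

open Matrix

variable {m : ℕ}

lemma trace_mul_transpose_sq_le (X Y : Matrix (Fin m) (Fin m) ℝ) :
    (X * Yᵀ).trace ^ 2 ≤ (X * Xᵀ).trace * (Y * Yᵀ).trace := by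
  have e : ∀ X Y : Matrix (Fin m) (Fin m) ℝ,
      (X * Yᵀ).trace = ∑ p : Fin m × Fin m, X p.1 p.2 * Y p.1 p.2 := by
    intro X Y
    simp only [Matrix.trace, Matrix.diag_apply, Matrix.mul_apply, Matrix.transpose_apply,
      Fintype.sum_prod_type]
  rw [e, e, e]
  simpa only [sq] using Finset.sum_mul_sq_le_sq_mul_sq univ
    (fun p : Fin m × Fin m => X p.1 p.2) (fun p => Y p.1 p.2)

lemma trace_mul_transpose_self_nonneg (X : Matrix (Fin m) (Fin m) ℝ) : 0 ≤ (X * Xᵀ).trace := by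
  simp only [Matrix.trace, Matrix.diag_apply, Matrix.mul_apply, Matrix.transpose_apply]
  exact Finset.sum_nonneg fun i _ => Finset.sum_nonneg fun j _ => mul_self_nonneg _

/-- Hölder's inequality for the Schatten 4-norm, from Cauchy–Schwarz for the Hilbert–Schmidt inner
product applied twice. -/
lemma trace_four_pow_le (Z : Fin 4 → Matrix (Fin m) (Fin m) ℝ) :
    (Z 0 * (Z 1)ᵀ * (Z 2 * (Z 3)ᵀ)).trace ^ 4
      ≤ ∏ s, (Z s * (Z s)ᵀ * (Z s * (Z s)ᵀ)).trace := by
  have two : ∀ A B : Matrix (Fin m) (Fin m) ℝ, (A * Bᵀ * (A * Bᵀ)ᵀ).trace ^ 2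
      ≤ (A * Aᵀ * (A * Aᵀ)).trace * (B * Bᵀ * (B * Bᵀ)).trace := by
    intro A B
    have h := trace_mul_transpose_sq_le (Aᵀ * A) (Bᵀ * B)
    have e1 : (A * Bᵀ * (A * Bᵀ)ᵀ).trace = (Aᵀ * A * (Bᵀ * B)ᵀ).trace := by
      rw [Matrix.transpose_mul, Matrix.transpose_mul, Matrix.transpose_transpose,
        ← Matrix.mul_assoc, Matrix.trace_mul_comm]
      simp only [Matrix.mul_assoc]
    have e2 : ∀ C : Matrix (Fin m) (Fin m) ℝ, (Cᵀ * C * (Cᵀ * C)ᵀ).trace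
        = (C * Cᵀ * (C * Cᵀ)).trace := by
      intro C
      rw [Matrix.transpose_mul, Matrix.transpose_transpose, Matrix.mul_assoc, Matrix.trace_mul_comm]
      simp only [Matrix.mul_assoc]
    rw [e1, ← e2, ← e2]
    exact h
  have c1 := trace_mul_transpose_sq_le (Z 0 * (Z 1)ᵀ) (Z 3 * (Z 2)ᵀ)
  rw [Matrix.transpose_mul (Z 3), Matrix.transpose_transpose] at c1
  have c2 := two (Z 0) (Z 1)
  have c3 := two (Z 3) (Z 2)
  rw [Matrix.transpose_mul (Z 3), Matrix.transpose_transpose] at c3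
  rw [Fin.prod_univ_four]
  calc _ = ((Z 0 * (Z 1)ᵀ * (Z 2 * (Z 3)ᵀ)).trace ^ 2) ^ 2 := by ring
    _ ≤ ((Z 0 * (Z 1)ᵀ * (Z 0 * (Z 1)ᵀ)ᵀ).trace * (Z 3 * (Z 2)ᵀ * (Z 2 * (Z 3)ᵀ)).trace) ^ 2 := by
      gcongr
    _ ≤ ((Z 0 * (Z 0)ᵀ * (Z 0 * (Z 0)ᵀ)).trace * (Z 1 * (Z 1)ᵀ * (Z 1 * (Z 1)ᵀ)).trace)
        * ((Z 3 * (Z 3)ᵀ * (Z 3 * (Z 3)ᵀ)).trace * (Z 2 * (Z 2)ᵀ * (Z 2 * (Z 2)ᵀ)).trace) := by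
      rw [mul_pow]
      exact mul_le_mul c2 c3 (sq_nonneg _) ((sq_nonneg _).trans c2)
    _ = _ := by ring

lemma trace_mul_mul_transpose_le (A B : Matrix (Fin m) (Fin m) ℝ) :
    (A * B * (A * B)ᵀ).trace ≤ (A * Aᵀ).trace * (Bᵀ * B).trace := by
  simp only [Matrix.trace, Matrix.diag_apply, Matrix.mul_apply, Matrix.transpose_apply, ← sq]
  rw [Finset.sum_mul_sum]
  exact Finset.sum_le_sum fun i _ => Finset.sum_le_sum fun j _ =>
    Finset.sum_mul_sq_le_sq_mul_sq _ _ _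

/-- The fourth-moment inequality for the depolarizing channel on one qudit. -/
lemma trace_depolarize_le {γ : ℝ} (h0 : 0 ≤ γ) (h1 : γ ^ 4 * (9 * m) = 1) (hm : 2 ≤ m) (c : ℝ)
    (Y : Matrix (Fin m) (Fin m) ℝ) (hY : Y.trace = 0) :
    (1 / m : ℝ) * (((c • 1 + γ • Y) * (c • 1 + γ • Y)ᵀ) * ((c • 1 + γ • Y) * (c • 1 + γ • Y)ᵀ)).trace
      ≤ ((1 / m : ℝ) * ((c • 1 + Y) * (c • 1 + Y)ᵀ).trace) ^ 2 := by
  have hm' : (2 : ℝ) ≤ m := by exact_mod_cast hm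
  set F := (Y * Yᵀ).trace with hF
  have hF0 : 0 ≤ F := trace_mul_transpose_self_nonneg Y
  have hYt : Yᵀ.trace = 0 := by rw [Matrix.trace_transpose, hY]
  have t1 : (Y * Y).trace ≤ F := by
    have h := trace_mul_transpose_sq_le Y Yᵀ
    rw [Matrix.transpose_transpose, Matrix.trace_mul_comm Yᵀ, ← hF] at h
    nlinarith
  have t1' : (Yᵀ * Yᵀ).trace = (Y * Y).trace := by
    rw [← Matrix.transpose_mul, Matrix.trace_transpose]
  have t2 : (Y * Yᵀ * (Y * Yᵀ)).trace ≤ F ^ 2 := by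
    have h := trace_mul_mul_transpose_le Y Yᵀ
    rw [Matrix.transpose_mul, Matrix.transpose_transpose, ← hF] at h
    linarith
  have t3 : (Y * (Y * Yᵀ)).trace ^ 2 ≤ F * F ^ 2 := by
    have h := trace_mul_transpose_sq_le Y (Y * Yᵀ)
    rw [Matrix.transpose_mul, Matrix.transpose_transpose, ← hF] at h
    exact h.trans (mul_le_mul_of_nonneg_left t2 hF0)
  have t3' : (Yᵀ * (Y * Yᵀ)).trace = (Y * (Y * Yᵀ)).trace := by
    rw [← Matrix.trace_transpose]
    simp only [Matrix.transpose_mul, Matrix.transpose_transpose]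
    rw [Matrix.trace_mul_comm]
  have e1 : (((c • 1 + γ • Y) * (c • 1 + γ • Y)ᵀ) * ((c • 1 + γ • Y) * (c • 1 + γ • Y)ᵀ)).trace
      = m * c ^ 4 + c ^ 2 * γ ^ 2 * (2 * (Y * Y).trace + 4 * F)
        + 4 * c * γ ^ 3 * (Y * (Y * Yᵀ)).trace + γ ^ 4 * (Y * Yᵀ * (Y * Yᵀ)).trace := by
    have hS : (c • 1 + γ • Y) * (c • 1 + γ • Y)ᵀ
        = (c ^ 2) • (1 : Matrix (Fin m) (Fin m) ℝ) + (c * γ) • Y + (c * γ) • Yᵀ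
          + (γ ^ 2) • (Y * Yᵀ) := by
      simp only [Matrix.transpose_add, Matrix.transpose_smul, Matrix.transpose_one, add_mul,
        mul_add, smul_mul_assoc, mul_smul_comm, one_mul, mul_one, smul_smul, smul_add, sq,
        mul_comm γ c]
      abel
    rw [hS]
    generalize hW : Y * Yᵀ = W at *
    have hWc : (W * Y).trace = (Y * W).trace := Matrix.trace_mul_comm _ _
    have hWc' : (W * Yᵀ).trace = (Y * W).trace := by rw [Matrix.trace_mul_comm, t3']
    have hYY : (Yᵀ * Y).trace = F := by
      rw [Matrix.trace_mul_comm, hW]; exact hF.symm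
    simp only [add_mul, mul_add, smul_mul_assoc, mul_smul_comm, one_mul, mul_one,
      Matrix.trace_add, Matrix.trace_smul, hY, hYt, hWc, hWc', hYY, hW, t1', t3', ← hF,
      Matrix.trace_one, Fintype.card_fin, smul_eq_mul]
    ring
  have e2 : ((c • 1 + Y) * (c • 1 + Y)ᵀ).trace = m * c ^ 2 + F := by
    simp only [Matrix.transpose_add, Matrix.transpose_smul, Matrix.transpose_one, add_mul,
      mul_add, smul_mul_assoc, mul_smul_comm, one_mul, mul_one, Matrix.trace_add,
      Matrix.trace_smul, hY, hYt, ← hF, Matrix.trace_one, Fintype.card_fin, smul_eq_mul]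
    ring
  rw [e1, e2]
  generalize (Y * (Y * Yᵀ)).trace = u at *
  generalize (Y * Y).trace = v at *
  generalize (Y * Yᵀ * (Y * Yᵀ)).trace = t at *
  clear_value F
  -- For m ≥ 2 one has γ⁴ = 1/(9m) ≤ 1/18, which is below 1/16.
  have hγ : γ ^ 2 ≤ 1 / 4 := by
    by_contra! hlt
    nlinarith [mul_lt_mul'' hlt hlt (by norm_num) (by norm_num)]
  -- The odd term is absorbed by AM–GM into the quadratic and quartic ones, using |u| ≤ F^(3/2).
  have hcub : 4 * c * γ ^ 3 * u ≤ 2 * c ^ 2 * γ ^ 2 * F + 2 * γ ^ 4 * F ^ 2 := by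
    obtain ⟨r, hr, rfl⟩ : ∃ r : ℝ, 0 ≤ r ∧ F = r ^ 2 := ⟨√F, Real.sqrt_nonneg _, (Real.sq_sqrt hF0).symm⟩
    have hu : |u| ≤ r ^ 3 := abs_le_of_sq_le_sq (by nlinarith) (by positivity)
    have h1 : c * u ≤ |c| * r ^ 3 := (le_abs_self _).trans (by rw [abs_mul]; gcongr)
    have h2 : 4 * γ ^ 3 * (c * u) ≤ 4 * γ ^ 3 * (|c| * r ^ 3) := by gcongr
    have h3 : 0 ≤ 2 * γ ^ 2 * (|c| * r - γ * r ^ 2) ^ 2 := by positivity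
    have h4 : 2 * γ ^ 2 * (|c| * r - γ * r ^ 2) ^ 2
        = 2 * c ^ 2 * γ ^ 2 * r ^ 2 - 4 * γ ^ 3 * (|c| * r ^ 3) + 2 * γ ^ 4 * (r ^ 2) ^ 2 := by
      rw [← sq_abs c]; ring
    linarith
  have hF4 : γ ^ 4 * (9 * m) * F ^ 2 = F ^ 2 := by rw [h1, one_mul]
  have hm0 : (0 : ℝ) < m := by linarith
  have g1 : c ^ 2 * γ ^ 2 * v ≤ c ^ 2 * γ ^ 2 * F := by gcongr
  have g2 : γ ^ 4 * t ≤ γ ^ 4 * F ^ 2 := by gcongr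
  have g3 : c ^ 2 * F * γ ^ 2 ≤ c ^ 2 * F * (1 / 4) := by gcongr
  -- The c²F terms add up to 8γ² ≤ 2 and the F² terms to 3γ⁴; since 3mγ⁴ = 1/3 ≤ 1, both fit into
  -- the square on the right.
  have key : m * (m * c ^ 4 + c ^ 2 * γ ^ 2 * (2 * v + 4 * F) + 4 * c * γ ^ 3 * u + γ ^ 4 * t)
      ≤ (m * c ^ 2 + F) ^ 2 := by
    have : m * (m * c ^ 4 + c ^ 2 * γ ^ 2 * (2 * v + 4 * F) + 4 * c * γ ^ 3 * u + γ ^ 4 * t)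
      ≤ m * (m * c ^ 4 + 2 * c ^ 2 * F + 3 * γ ^ 4 * F ^ 2) := by
      gcongr ?_ * ?_
      nlinarith
    nlinarith [sq_nonneg F]
  calc (1 / m : ℝ) * (m * c ^ 4 + c ^ 2 * γ ^ 2 * (2 * v + 4 * F) + 4 * c * γ ^ 3 * u + γ ^ 4 * t)
      = (1 / m : ℝ) ^ 2 * (m * (m * c ^ 4 + c ^ 2 * γ ^ 2 * (2 * v + 4 * F) + 4 * c * γ ^ 3 * u
          + γ ^ 4 * t)) := by field_simp
    _ ≤ (1 / m : ℝ) ^ 2 * (m * c ^ 2 + F) ^ 2 := by gcongr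
    _ = _ := by ring

/-- The kernel of the depolarizing channel on one qudit. -/
noncomputable def quditKernel (m : ℕ) (γ : ℝ) (u v : Fin m × Fin m) : ℝ :=
  γ * (if u = v then 1 else 0)
    + (1 - γ) / m * ((if u.1 = u.2 then 1 else 0) * (if v.1 = v.2 then 1 else 0))

/-- The four matrix positions in a summand of `Tr (Z₀ Z₁ᵀ Z₂ Z₃ᵀ)`. -/
def quditPos {α : Type*} (s : Fin 4) (x : Fin 4 → α) : α × α :=
  ![(x 0, x 1), (x 2, x 1), (x 2, x 3), (x 0, x 3)] s

/-- The kernel sends M to cI + γ(M - cI) with c = Tr M / m. `trace_four_pow_le` reduces to a single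
matrix, to which `trace_depolarize_le` applies. -/
lemma isHyper_qudit {γ : ℝ} (h0 : 0 ≤ γ) (h1 : γ ^ 4 * (9 * m) = 1) (hm : 2 ≤ m) :
    IsHyper (1 / m) (1 / m) quditPos (quditKernel m γ) where
  weight_nonneg := by positivity
  const_nonneg := by positivity
  kernel_nonneg i j := by
    have hm' : (2 : ℝ) ≤ m := by exact_mod_cast hm
    have : γ ≤ 1 := by
      by_contra! hlt
      have : 1 ≤ γ ^ 4 := one_le_pow₀ hlt.le
      nlinarith
    have : 0 ≤ 1 - γ := by linarith
    unfold quditKernel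
    split_ifs <;> positivity
  bound a ha := by
    refine le_prod_sqrt_of_pow_four_le
      (fun s => mul_nonneg (by positivity) (Finset.sum_nonneg fun _ _ => sq_nonneg _)) ?_
    have hm0 : (0 : ℝ) < m := by exact_mod_cast (by omega : 0 < m)
    let M (s : Fin 4) : Matrix (Fin m) (Fin m) ℝ := Matrix.of fun x y => a s (x, y)
    let c (s : Fin 4) : ℝ := (M s).trace / m
    let Y (s : Fin 4) : Matrix (Fin m) (Fin m) ℝ := M s - c s • 1
    let Z (s : Fin 4) : Matrix (Fin m) (Fin m) ℝ := c s • 1 + γ • Y s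
    have hY : ∀ s, (Y s).trace = 0 := fun s => by
      simp only [Y, c, Matrix.trace_sub, Matrix.trace_smul, Matrix.trace_one, Fintype.card_fin,
        smul_eq_mul]
      field_simp; ring
    have hZ : ∀ s x y, ∑ i, quditKernel m γ (x, y) i * a s i = Z s x y := by
      intro s x y
      have e : ∑ i : Fin m × Fin m, (if i.1 = i.2 then (1 : ℝ) else 0) * a s i = (M s).trace := by
        simp [Fintype.sum_prod_type, Matrix.trace, M]
      simp only [quditKernel, add_mul, Finset.sum_add_distrib, mul_assoc, ← Finset.mul_sum, e]
      simp only [Z, Y, c, M, Matrix.add_apply, Matrix.smul_apply, Matrix.sub_apply, Matrix.of_apply,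
        Matrix.one_apply, smul_eq_mul, ite_mul, one_mul, zero_mul, Finset.sum_ite_eq,
        Finset.mem_univ, if_true]
      split_ifs <;> ring
    have hT : ∑ x : Fin 4 → Fin m, ∏ s, ∑ i, quditKernel m γ (quditPos s x) i * a s i
        = (Z 0 * (Z 1)ᵀ * (Z 2 * (Z 3)ᵀ)).trace := by
      simp only [Fin.prod_univ_four, quditPos, Matrix.cons_val, hZ, Matrix.trace, Matrix.diag_apply,
        Matrix.mul_apply, Matrix.transpose_apply, sum_fin_four_fun]
      refine Finset.sum_congr rfl fun i _ => ?_
      rw [Finset.sum_comm]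
      refine Finset.sum_congr rfl fun j _ => ?_
      rw [Finset.sum_mul_sum]
      exact Finset.sum_congr rfl fun k _ => Finset.sum_congr rfl fun l _ => by ring
    have hN : ∀ s, ∑ i, a s i ^ 2 = ((c s • 1 + Y s) * (c s • 1 + Y s)ᵀ).trace := by
      intro s
      have : c s • 1 + Y s = M s := by simp [Y]
      rw [this]
      simp only [Matrix.trace, Matrix.diag_apply, Matrix.mul_apply, Matrix.transpose_apply, M,
        Matrix.of_apply, Fintype.sum_prod_type, sq]
    rw [hT, mul_pow]
    calc (1 / m : ℝ) ^ 4 * (Z 0 * (Z 1)ᵀ * (Z 2 * (Z 3)ᵀ)).trace ^ 4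
        ≤ (1 / m : ℝ) ^ 4 * ∏ s, (Z s * (Z s)ᵀ * (Z s * (Z s)ᵀ)).trace := by
          gcongr
          exact trace_four_pow_le Z
      _ = ∏ s, ((1 / m : ℝ) * (Z s * (Z s)ᵀ * (Z s * (Z s)ᵀ)).trace) := by
          simp only [Fin.prod_univ_four]; ring
      _ ≤ ∏ s, ((1 / m : ℝ) * ∑ i, a s i ^ 2) ^ 2 := by
          refine Finset.prod_le_prod (fun s _ => mul_nonneg (by positivity) ?_) fun s _ => ?_
          · have := trace_mul_transpose_self_nonneg (Z s * (Z s)ᵀ)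
            rwa [Matrix.transpose_mul, Matrix.transpose_transpose] at this
          · rw [hN]
            exact trace_depolarize_le h0 h1 hm (c s) (Y s) (hY s)

end Qudit

end DerandInv

namespace DerandInv

/-! ### Fourier expansions -/

section Fourier

lemma sum_prod_pi {α β R : Type*} [Fintype α] [DecidableEq α] [Fintype β] [CommSemiring R]
    (f : α → β → R) : ∑ x : α → β, ∏ i, f i (x i) = ∏ i, ∑ y, f i y := by
  rw [Finset.prod_univ_sum, Fintype.piFinset_univ]

/-- The matrix entry addressed by a tuple of index pairs. -/
def entry {m h : ℕ} (A : Op m h) (v : Fin h → Fin m × Fin m) : ℂ :=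
  A (fun i => (v i).1) fun i => (v i).2

lemma sum_entry {m h : ℕ} {M : Type*} [AddCommMonoid M]
    (f : (Fin h → Fin m) → (Fin h → Fin m) → M) :
    ∑ v : Fin h → Fin m × Fin m, f (fun i => (v i).1) (fun i => (v i).2) = ∑ x, ∑ y, f x y := by
  rw [← Fintype.sum_prod_type']
  exact (Equiv.arrowProdEquivProdArrow (Fin h) (fun _ => Fin m) (fun _ => Fin m)).sum_comp
    fun p => f p.1 p.2

variable {m h n : ℕ} {B : Fin (m ^ 2) → Matrix (Fin m) (Fin m) ℂ}

lemma nnormSq_eq_sum (A : Op m h) :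
    nnormSq A = (1 / (m : ℝ)) ^ h * ∑ v, ‖entry A v‖ ^ 2 := by
  simp only [entry]
  rw [sum_entry (fun x y => ‖A x y‖ ^ 2), nnormSq, one_div_pow, Finset.sum_comm]
  congr 1
  simp only [Matrix.trace, Matrix.diag_apply, Matrix.mul_apply, Complex.re_sum,
    Matrix.conjTranspose_apply]
  refine Finset.sum_congr rfl fun x _ => Finset.sum_congr rfl fun y _ => ?_
  rw [RCLike.star_def, mul_comm, Complex.mul_conj, Complex.ofReal_re, Complex.normSq_eq_norm_sq]

lemma entry_tensorBasis (σ : Fin h → Fin (m ^ 2)) (v : Fin h → Fin m × Fin m) :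
    entry (tensorBasis B σ) v = ∏ i, B (σ i) (v i).1 (v i).2 := rfl

lemma fourierCoeff_eq_sum (A : Op m h) (σ : Fin h → Fin (m ^ 2)) :
    fourierCoeff B A σ = (1 / (m : ℂ)) ^ h * ∑ v, star (entry (tensorBasis B σ) v) * entry A v := by
  simp only [entry]
  rw [sum_entry (fun x y => star (tensorBasis B σ x y) * A x y), fourierCoeff, one_div_pow,
    Finset.sum_comm]
  rfl

lemma IsStdBasis.sum_orthonormal (hB : IsStdBasis m B) (i j : Fin (m ^ 2)) :
    (1 / (m : ℂ)) * ∑ p : Fin m × Fin m, star (B i p.1 p.2) * B j p.1 p.2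
      = if i = j then 1 else 0 := by
  rw [← hB.orthonormal, Fintype.sum_prod_type, Finset.sum_comm]
  rfl

/-- Orthonormality gives a one-sided inverse between index sets that both have m² elements, hence a
two-sided one. -/
lemma IsStdBasis.sum_complete (hB : IsStdBasis m B) (p q : Fin m × Fin m) :
    (1 / (m : ℂ)) * ∑ i, B i p.1 p.2 * star (B i q.1 q.2) = if p = q then 1 else 0 := by
  let X : Matrix (Fin (m ^ 2)) (Fin m × Fin m) ℂ :=
    Matrix.of fun i p => (1 / (m : ℂ)) * star (B i p.1 p.2)
  let Y : Matrix (Fin m × Fin m) (Fin (m ^ 2)) ℂ := Matrix.of fun p i => B i p.1 p.2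
  have h1 : X * Y = 1 := by
    ext i j
    rw [Matrix.one_apply, ← hB.sum_orthonormal, Matrix.mul_apply, Finset.mul_sum]
    exact Finset.sum_congr rfl fun p _ => by simp [X, Y, mul_assoc]
  have h2 : Y * X = 1 := (Matrix.mul_eq_one_comm_of_card_eq _ _ _ (by simp [sq])).1 h1
  have h3 := congrFun (congrFun h2 p) q
  rw [Matrix.one_apply, Matrix.mul_apply] at h3
  rw [← h3, Finset.mul_sum]
  exact Finset.sum_congr rfl fun i _ => by simp only [X, Y, Matrix.of_apply]; ring

lemma prod_ite_eq_ite {ι β R : Type*} [Fintype ι] [DecidableEq β] [CommSemiring R]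
    (f g : ι → β) : (∏ i, if f i = g i then (1 : R) else 0) = if f = g then 1 else 0 := by
  split_ifs with hfg
  · simp [hfg]
  · obtain ⟨i, hi⟩ := Function.ne_iff.1 hfg
    exact Finset.prod_eq_zero (Finset.mem_univ i) (if_neg hi)

lemma IsStdBasis.sum_orthonormal_pi (hB : IsStdBasis m B) (σ ρ : Fin h → Fin (m ^ 2)) :
    (1 / (m : ℂ)) ^ h * ∑ v, star (entry (tensorBasis B σ) v) * entry (tensorBasis B ρ) v
      = if σ = ρ then 1 else 0 := by
  simp only [entry_tensorBasis, star_prod, ← Finset.prod_mul_distrib]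
  rw [sum_prod_pi (fun i (p : Fin m × Fin m) => star (B (σ i) p.1 p.2) * B (ρ i) p.1 p.2),
    ← prod_ite_eq_ite, ← Fin.prod_const, ← Finset.prod_mul_distrib]
  exact Finset.prod_congr rfl fun i _ => hB.sum_orthonormal _ _

lemma IsStdBasis.entry_eq_sum (hB : IsStdBasis m B) (A : Op m h) (v : Fin h → Fin m × Fin m) :
    entry A v = ∑ σ, fourierCoeff B A σ * entry (tensorBasis B σ) v := by
  have hc : ∀ u, (1 / (m : ℂ)) ^ h * ∑ σ, entry (tensorBasis B σ) v
      * star (entry (tensorBasis B σ) u) = if v = u then 1 else 0 := by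
    intro u
    simp only [entry_tensorBasis, star_prod, ← Finset.prod_mul_distrib]
    rw [sum_prod_pi (fun i j => B j (v i).1 (v i).2 * star (B j (u i).1 (u i).2)),
      ← prod_ite_eq_ite, ← Fin.prod_const, ← Finset.prod_mul_distrib]
    exact Finset.prod_congr rfl fun i _ => hB.sum_complete _ _
  calc entry A v = ∑ u, (if v = u then 1 else 0) * entry A u := by simp
    _ = ∑ u, ((1 / (m : ℂ)) ^ h * ∑ σ, entry (tensorBasis B σ) v
      * star (entry (tensorBasis B σ) u)) * entry A u := by simp only [hc]
    _ = _ := by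
      simp only [fourierCoeff_eq_sum, Finset.mul_sum, Finset.sum_mul]
      rw [Finset.sum_comm]
      refine Finset.sum_congr rfl fun σ _ => Finset.sum_congr rfl fun u _ => ?_
      ring

/-- Parseval's identity for a finite orthonormal family. -/
lemma sum_norm_sq_eq {I J : Type*} [Fintype I] [Fintype J] [DecidableEq J] {c : ℝ}
    (E : J → I → ℂ) (hE : ∀ j j', (c : ℂ) * ∑ i, star (E j i) * E j' i = if j = j' then 1 else 0)
    (g : J → ℂ) : c * ∑ i, ‖∑ j, g j * E j i‖ ^ 2 = ∑ j, ‖g j‖ ^ 2 := by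
  have hn : ∀ z : ℂ, ((‖z‖ ^ 2 : ℝ) : ℂ) = star z * z := fun z => by
    rw [RCLike.star_def, Complex.conj_mul']; push_cast; rfl
  have : ((c * ∑ i, ‖∑ j, g j * E j i‖ ^ 2 : ℝ) : ℂ) = ((∑ j, ‖g j‖ ^ 2 : ℝ) : ℂ) := by
    rw [Complex.ofReal_mul, Complex.ofReal_sum, Complex.ofReal_sum]
    simp only [hn, star_sum, star_mul', Finset.sum_mul_sum]
    rw [Finset.sum_comm, Finset.mul_sum]
    refine Finset.sum_congr rfl fun j _ => ?_
    rw [Finset.sum_comm, Finset.mul_sum]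
    have : ∀ j', (c : ℂ) * ∑ i, star (g j) * star (E j i) * (g j' * E j' i)
        = star (g j) * g j' * if j = j' then 1 else 0 := fun j' => by
      rw [← hE, Finset.mul_sum, Finset.mul_sum, Finset.mul_sum]
      exact Finset.sum_congr rfl fun i _ => by ring
    simp only [this]
    simp
  exact_mod_cast this

lemma IsStdBasis.nnormSq_eq (hB : IsStdBasis m B) (A : Op m h) :
    nnormSq A = ∑ σ, ‖fourierCoeff B A σ‖ ^ 2 := by
  rw [nnormSq_eq_sum]
  simp only [hB.entry_eq_sum A]
  exact sum_norm_sq_eq (fun σ => entry (tensorBasis B σ))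
    (by push_cast; exact hB.sum_orthonormal_pi) _

/-- The character `b ↦ ∏ i ∈ S, b i`. -/
def char {n : ℕ} (S : Finset (Fin n)) (b : Fin n → ℤˣ) : ℝ := ∏ i ∈ S, ((b i : ℤ) : ℝ)

lemma char_eq_prod (S : Finset (Fin n)) (b : Fin n → ℤˣ) :
    char S b = ∏ i, if i ∈ S then ((b i : ℤ) : ℝ) else 1 := by
  rw [char, Finset.prod_ite_mem, Finset.univ_inter]

lemma char_orthonormal (S T : Finset (Fin n)) :
    (1 / 2 : ℝ) ^ n * ∑ b, char S b * char T b = if S = T then 1 else 0 := by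
  simp only [char_eq_prod, ← Finset.prod_mul_distrib]
  rw [sum_prod_pi (fun i (y : ℤˣ) => (if i ∈ S then ((y : ℤ) : ℝ) else 1)
    * if i ∈ T then ((y : ℤ) : ℝ) else 1), ← Fin.prod_const, ← Finset.prod_mul_distrib]
  have : ∀ i, (1 / 2 : ℝ) * ∑ y : ℤˣ, (if i ∈ S then ((y : ℤ) : ℝ) else 1)
      * (if i ∈ T then ((y : ℤ) : ℝ) else 1) = if (i ∈ S) = (i ∈ T) then 1 else 0 := by
    intro i
    rw [sum_units]
    by_cases h1 : i ∈ S <;> by_cases h2 : i ∈ T <;> norm_num [h1, h2]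
  simp only [this]
  split_ifs with hST
  · simp [hST]
  · obtain ⟨i, hi⟩ : ∃ i, ¬ (i ∈ S ↔ i ∈ T) := by
      by_contra! hcon
      exact hST (Finset.ext hcon)
    exact Finset.prod_eq_zero (Finset.mem_univ i) (if_neg fun h => hi (iff_of_eq h))

lemma entry_evalAt (P : Finset (Fin n) → Op m h) (b : Fin n → ℤˣ) (v : Fin h → Fin m × Fin m) :
    entry (evalAt P b) v = ∑ S, (char S b : ℂ) * entry (P S) v := by
  simp only [entry, evalAt, Matrix.sum_apply, Matrix.smul_apply, Complex.real_smul, char]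

lemma sum_nnormSq_evalAt (P : Finset (Fin n) → Op m h) :
    (1 / 2 : ℝ) ^ n * ∑ b, nnormSq (evalAt P b) = ∑ S, nnormSq (P S) := by
  simp only [nnormSq_eq_sum, ← Finset.mul_sum]
  rw [mul_left_comm, Finset.sum_comm, Finset.sum_comm (s := univ (α := Finset (Fin n))),
    Finset.mul_sum]
  congr 1
  refine Finset.sum_congr rfl fun v _ => ?_
  simp only [entry_evalAt, mul_comm _ (entry _ v)]
  refine sum_norm_sq_eq (c := (1 / 2) ^ n) (fun S b => (char S b : ℂ)) (fun S T => ?_)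
    fun S => entry (P S) v
  have := congrArg (fun x : ℝ => (x : ℂ)) (char_orthonormal S T)
  convert this using 1
  · push_cast; simp [Complex.conj_ofReal]
  · split_ifs <;> simp

lemma expect_units (f : (Fin n → ℤˣ) → ℝ) : 𝔼 b, f b = (1 / 2 : ℝ) ^ n * ∑ b, f b := by
  rw [Fintype.expect_eq_sum_div_card]
  simp [div_eq_inv_mul]

end Fourier

end DerandInv

namespace DerandInv

/-! ### The hypercontractive inequality -/

section Hyper

variable {m h n : ℕ} {B : Fin (m ^ 2) → Matrix (Fin m) (Fin m) ℂ}

/-- The identity is fixed by the depolarizing channel; the other basis elements are orthogonal to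
it, hence traceless, and are scaled by γ. -/
lemma IsStdBasis.sum_quditKernel (hB : IsStdBasis m B) (hm : 0 < m) (γ : ℝ) (u : Fin m × Fin m)
    (i : Fin (m ^ 2)) :
    ∑ v, (quditKernel m γ u v : ℂ) * B i v.1 v.2
      = (if (i : ℕ) ≠ 0 then (γ : ℂ) else 1) * B i u.1 u.2 := by
  have hm' : (m : ℂ) ≠ 0 := by exact_mod_cast hm.ne'
  let z : Fin (m ^ 2) := ⟨0, by positivity⟩
  have hz : B z = 1 := hB.zero_eq_one z rfl
  have htr : (B i).trace = if z = i then (m : ℂ) else 0 := by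
    have := hB.orthonormal z i
    rw [hz, Matrix.conjTranspose_one, one_mul] at this
    split_ifs at this ⊢
    · field_simp at this; exact this
    · simpa [hm'] using this
  have e : ∑ v : Fin m × Fin m, (if v.1 = v.2 then (1 : ℂ) else 0) * B i v.1 v.2
      = (B i).trace := by
    simp [Fintype.sum_prod_type, Matrix.trace]
  have e2 : ∑ v, (quditKernel m γ u v : ℂ) * B i v.1 v.2
      = γ * B i u.1 u.2 + (1 - γ) / m * (if u.1 = u.2 then 1 else 0) * (B i).trace := by
    simp only [quditKernel, Complex.ofReal_add, Complex.ofReal_mul, Complex.ofReal_div,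
      Complex.ofReal_sub, Complex.ofReal_one, Complex.ofReal_natCast, apply_ite Complex.ofReal,
      Complex.ofReal_zero]
    simp only [add_mul, Finset.sum_add_distrib, mul_assoc, ← Finset.mul_sum, e]
    simp
  rw [e2, htr]
  by_cases hi : (i : ℕ) = 0
  · have : z = i := Fin.ext hi.symm
    rw [if_pos this, if_neg (not_not.2 hi), ← this, hz, Matrix.one_apply]
    field_simp
    ring
  · have : z ≠ i := fun h => hi (by rw [← h])
    rw [if_neg this, if_pos hi]
    ring

lemma sum_bitKernel (γ : ℝ) (x : ℤˣ) (p : Prop) [Decidable p] :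
    ∑ y, bitKernel γ x y * (if p then ((y : ℤ) : ℝ) else 1)
      = (if p then γ else 1) * if p then ((x : ℤ) : ℝ) else 1 := by
  rw [sum_units]
  rcases Int.units_eq_one_or x with rfl | rfl <;> by_cases hp : p <;> simp [hp, bitKernel] <;> ring

lemma prod_ite_const {ι R : Type*} [Fintype ι] [CommSemiring R] (p : ι → Prop) [DecidablePred p]
    (c : R) : (∏ i, if p i then c else 1) = c ^ (univ.filter p).card := by
  rw [Finset.prod_ite, Finset.prod_const, Finset.prod_const_one, mul_one]

/-- Characters and tensor basis elements are eigenfunctions of the product kernel. -/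
lemma IsStdBasis.sum_kernel (hB : IsStdBasis m B) (hm : 0 < m) (γ : ℝ)
    (u : (Fin n → ℤˣ) × (Fin h → Fin m × Fin m)) (S : Finset (Fin n))
    (σ : Fin h → Fin (m ^ 2)) :
    ∑ v : (Fin n → ℤˣ) × (Fin h → Fin m × Fin m),
      (((∏ i, bitKernel γ (u.1 i) (v.1 i)) * ∏ i, quditKernel m γ (u.2 i) (v.2 i) : ℝ) : ℂ)
        * ((char S v.1 : ℂ) * entry (tensorBasis B σ) v.2)
      = (γ : ℂ) ^ (S.card + weight σ) * ((char S u.1 : ℂ) * entry (tensorBasis B σ) u.2) := by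
  have h1 : ∑ b : Fin n → ℤˣ, (∏ i, bitKernel γ (u.1 i) (b i)) * char S b
      = γ ^ S.card * char S u.1 := by
    simp only [char_eq_prod, ← Finset.prod_mul_distrib]
    rw [sum_prod_pi (fun i (y : ℤˣ) => bitKernel γ (u.1 i) y * if i ∈ S then ((y : ℤ) : ℝ) else 1)]
    simp only [sum_bitKernel, Finset.prod_mul_distrib, prod_ite_const]
    simp
  have h2 : ∑ v : Fin h → Fin m × Fin m, ((∏ i, quditKernel m γ (u.2 i) (v i) : ℝ) : ℂ)
      * entry (tensorBasis B σ) v = (γ : ℂ) ^ weight σ * entry (tensorBasis B σ) u.2 := by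
    simp only [entry_tensorBasis, Complex.ofReal_prod, ← Finset.prod_mul_distrib]
    rw [sum_prod_pi (fun i (y : Fin m × Fin m) => (quditKernel m γ (u.2 i) y : ℂ)
      * B (σ i) y.1 y.2)]
    simp only [hB.sum_quditKernel hm, Finset.prod_mul_distrib, prod_ite_const, weight]
  rw [Fintype.sum_prod_type]
  calc _ = (∑ b : Fin n → ℤˣ, (((∏ i, bitKernel γ (u.1 i) (b i)) * char S b : ℝ) : ℂ))
        * ∑ v : Fin h → Fin m × Fin m, ((∏ i, quditKernel m γ (u.2 i) (v i) : ℝ) : ℂ)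
      * entry (tensorBasis B σ) v := by
        rw [Finset.sum_mul_sum]
        refine Finset.sum_congr rfl fun b _ => Finset.sum_congr rfl fun v _ => ?_
        push_cast
        ring
    _ = _ := by
      rw [← Complex.ofReal_sum, h1, h2]
      push_cast
      ring

lemma char_tensorBasis_orthonormal (hB : IsStdBasis m B)
    (j k : Finset (Fin n) × (Fin h → Fin (m ^ 2))) :
    (((1 / 2) ^ n * (1 / m) ^ h : ℝ) : ℂ) * ∑ v : (Fin n → ℤˣ) × (Fin h → Fin m × Fin m),
      star ((char j.1 v.1 : ℂ) * entry (tensorBasis B j.2) v.2)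
        * ((char k.1 v.1 : ℂ) * entry (tensorBasis B k.2) v.2) = if j = k then 1 else 0 := by
  have h1 := congrArg (fun x : ℝ => (x : ℂ)) (char_orthonormal j.1 k.1)
  have h2 := hB.sum_orthonormal_pi j.2 k.2
  have h3 : (if j = k then (1 : ℂ) else 0)
      = ((if j.1 = k.1 then (1 : ℝ) else 0 : ℝ) : ℂ) * if j.2 = k.2 then 1 else 0 := by
    by_cases e1 : j.1 = k.1 <;> by_cases e2 : j.2 = k.2 <;> simp [Prod.ext_iff, e1, e2]
  rw [h3, ← h1, ← h2, Fintype.sum_prod_type]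
  push_cast
  rw [mul_mul_mul_comm, Finset.sum_mul_sum]
  congr 1
  refine Finset.sum_congr rfl fun b _ => Finset.sum_congr rfl fun v _ => ?_
  simp only [star_mul', RCLike.star_def, Complex.conj_ofReal]
  ring

/-- Writing A⁴ as AA†AA† puts the matrix positions in the alternating pattern of `quditPos`, in
which the quartic form splits over registers. -/
lemma trace_pow_four_eq (A : Op m h) (hA : A.IsHermitian) :
    (A ^ 4).trace = ∑ x : Fin h → Fin 4 → Fin m, entry A (fun i => quditPos 0 (x i))
      * star (entry A fun i => quditPos 1 (x i)) * (entry A fun i => quditPos 2 (x i))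
      * star (entry A fun i => quditPos 3 (x i)) := by
  have hq : ∀ x y, star (A x y) = A y x := fun x y => hA.apply y x
  rw [← (Equiv.piComm (fun (_ : Fin 4) (_ : Fin h) => Fin m)).sum_comp]
  simp only [entry, quditPos, Matrix.cons_val, hq]
  have e : ∀ x : Fin 4 → Fin h → Fin m, ∀ s, (fun i => Equiv.piComm _ x i s) = x s :=
    fun _ _ => rfl
  simp only [e, sum_fin_four_fun, Matrix.cons_val]
  simp only [pow_succ, pow_zero, one_mul, Matrix.trace, Matrix.diag_apply, Matrix.mul_apply,
    Finset.sum_mul]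
  refine Finset.sum_congr rfl fun a _ => ?_
  rw [Finset.sum_comm]
  refine (Finset.sum_congr rfl fun c _ => Finset.sum_comm).trans ?_
  rw [Finset.sum_comm]

/-- Hypercontractivity for polynomials in random signs with operator coefficients. -/
theorem hypercontractive (hB : IsStdBasis m B) (hm : 1 < m) {d : ℕ} (P : Finset (Fin n) → Op m h)
    (hP : ∀ S, (P S).IsHermitian)
    (hd : ∀ S σ, fourierCoeff B (P S) σ ≠ 0 → S.card + weight σ ≤ d) :
    (1 / 2 : ℝ) ^ n * ∑ b, (1 / m : ℝ) ^ h * ((evalAt P b) ^ 4).trace.re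
      ≤ (9 * m) ^ d * (∑ S, nnormSq (P S)) ^ 2 := by
  have hm0 : (0 : ℝ) < m := by exact_mod_cast (by omega : 0 < m)
  obtain ⟨γ, hγ0, hγ⟩ : ∃ γ : ℝ, 0 < γ ∧ γ ^ 4 * (9 * m) = 1 := by
    refine ⟨(1 / (9 * m : ℝ)) ^ (1 / 4 : ℝ), by positivity, ?_⟩
    rw [← Real.rpow_natCast, ← Real.rpow_mul (by positivity)]
    norm_num
    field_simp
  have hγ1 : γ ^ 2 ≤ 1 / 3 := by
    have : (2 : ℝ) ≤ m := by exact_mod_cast hm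
    by_contra! hlt
    nlinarith [mul_lt_mul'' hlt hlt (by norm_num) (by norm_num)]
  have hγle : γ ≤ 1 := by nlinarith
  have H := ((isHyper_bit hγ0.le hγ1).pow n).prod ((isHyper_qudit hγ0.le hγ hm).pow h)
  -- R is P with the noise undone on each Fourier coefficient, so applying the kernel to R gives
  -- back P.
  let g (j : Finset (Fin n) × (Fin h → Fin (m ^ 2))) : ℂ :=
    ((γ⁻¹ ^ (j.1.card + weight j.2) : ℝ) : ℂ) * fourierCoeff B (P j.1) j.2
  let E (j : Finset (Fin n) × (Fin h → Fin (m ^ 2)))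
    (v : (Fin n → ℤˣ) × (Fin h → Fin m × Fin m)) : ℂ :=
    (char j.1 v.1 : ℂ) * entry (tensorBasis B j.2) v.2
  let R (v : (Fin n → ℤˣ) × (Fin h → Fin m × Fin m)) : ℂ := ∑ j, g j * E j v
  let K (u v : (Fin n → ℤˣ) × (Fin h → Fin m × Fin m)) : ℝ :=
    (∏ i, bitKernel γ (u.1 i) (v.1 i)) * ∏ i, quditKernel m γ (u.2 i) (v.2 i)
  have hT : ∀ u, ∑ v, (K u v : ℂ) * R v = entry (evalAt P u.1) u.2 := by
    intro u
    have e1 : ∑ v, (K u v : ℂ) * R v = ∑ j, g j * ∑ v, (K u v : ℂ) * E j v := by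
      simp only [R, Finset.mul_sum]
      rw [Finset.sum_comm]
      exact Finset.sum_congr rfl fun j _ => Finset.sum_congr rfl fun v _ => by ring
    rw [e1, entry_evalAt, Fintype.sum_prod_type]
    refine Finset.sum_congr rfl fun S _ => ?_
    rw [hB.entry_eq_sum, Finset.mul_sum]
    refine Finset.sum_congr rfl fun σ _ => ?_
    have e2 : ∑ v, (K u v : ℂ) * E (S, σ) v = _ := hB.sum_kernel (by omega) γ u S σ
    rw [e2]
    have h1 : ((γ⁻¹ ^ (S.card + weight σ) : ℝ) : ℂ) * (γ : ℂ) ^ (S.card + weight σ) = 1 := by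
      rw [← Complex.ofReal_pow, ← Complex.ofReal_mul, ← mul_pow, inv_mul_cancel₀ hγ0.ne', one_pow,
        Complex.ofReal_one]
    simp only [g]
    linear_combination (fourierCoeff B (P S) σ * ((char S u.1 : ℂ)
      * entry (tensorBasis B σ) u.2)) * h1
  have hT' : ∀ u, ∑ v, (K u v : ℂ) * star (R v) = star (entry (evalAt P u.1) u.2) := by
    intro u
    rw [← hT, star_sum]
    refine Finset.sum_congr rfl fun v _ => ?_
    rw [star_mul', RCLike.star_def, Complex.conj_ofReal]
  -- Undoing the noise costs at most γ^(-2d) in squared norm, as only levels up to d occur; squaring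
  -- turns this into γ^(-4d) = (9m)ᵈ.
  have hN : ((1 / 2) ^ n * (1 / m) ^ h : ℝ) * ∑ v, ‖R v‖ ^ 2 ≤ γ⁻¹ ^ (2 * d) * ∑ S, nnormSq (P S) := by
    rw [sum_norm_sq_eq E (char_tensorBasis_orthonormal hB) g, Fintype.sum_prod_type, Finset.mul_sum]
    refine Finset.sum_le_sum fun S _ => ?_
    rw [hB.nnormSq_eq, Finset.mul_sum]
    refine Finset.sum_le_sum fun σ _ => ?_
    simp only [g, norm_mul, Complex.norm_real, mul_pow, Real.norm_of_nonneg (pow_nonneg (inv_nonneg.2 hγ0.le) _)]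
    by_cases hz : fourierCoeff B (P S) σ = 0
    · simp [hz]
    · refine mul_le_mul_of_nonneg_right ?_ (sq_nonneg _)
      rw [← pow_mul]
      refine pow_le_pow_right₀ ((one_le_inv₀ hγ0).2 hγle) ?_
      have := hd S σ hz
      omega
  have hH : ∀ b, (evalAt P b).IsHermitian := by
    intro b
    refine isSelfAdjoint_sum _ fun S _ => ?_
    exact (IsSelfAdjoint.all _).smul (hP S)
  -- Alternating R with its conjugate reproduces the conjugated factors of `trace_pow_four_eq`; the
  -- kernel is real, so it commutes with conjugation.
  have hb := H.norm_bound ![R, fun v => star (R v), R, fun v => star (R v)]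
  have hsum : ∑ x : (Fin n → ℤˣ) × (Fin h → Fin 4 → Fin m), ∏ s : Fin 4, ∑ i,
      (K (x.1, fun j => quditPos s (x.2 j)) i : ℂ)
        * (![R, fun v => star (R v), R, fun v => star (R v)] : Fin 4 → _ → ℂ) s i
      = ∑ b, (evalAt P b ^ 4).trace := by
    rw [Fintype.sum_prod_type]
    refine Finset.sum_congr rfl fun b _ => ?_
    rw [trace_pow_four_eq _ (hH b)]
    refine Finset.sum_congr rfl fun x _ => ?_
    simp only [Fin.prod_univ_four, Matrix.cons_val, hT, hT']
  have hprod : ∏ s : Fin 4, √((1 / 2) ^ n * (1 / m) ^ h *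
      ∑ i, ‖(![R, fun v => star (R v), R, fun v => star (R v)] : Fin 4 → _ → ℂ) s i‖ ^ 2)
      = (((1 / 2) ^ n * (1 / m) ^ h : ℝ) * ∑ v, ‖R v‖ ^ 2) ^ 2 := by
    have hnn : 0 ≤ ((1 / 2) ^ n * (1 / m) ^ h : ℝ) * ∑ v, ‖R v‖ ^ 2 := by positivity
    simp only [Fin.prod_univ_four, Matrix.cons_val, norm_star]
    rw [Real.mul_self_sqrt hnn, mul_assoc, Real.mul_self_sqrt hnn, sq]
  have hb' : ((1 / 2) ^ n * (1 / m) ^ h : ℝ) * ‖∑ b, (evalAt P b ^ 4).trace‖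
      ≤ (((1 / 2) ^ n * (1 / m) ^ h : ℝ) * ∑ v, ‖R v‖ ^ 2) ^ 2 := by
    rw [← hsum, ← hprod]
    exact hb
  have hnn : 0 ≤ ((1 / 2) ^ n * (1 / m) ^ h : ℝ) * ∑ v, ‖R v‖ ^ 2 := by positivity
  calc (1 / 2 : ℝ) ^ n * ∑ b, (1 / m : ℝ) ^ h * ((evalAt P b) ^ 4).trace.re
      = ((1 / 2) ^ n * (1 / m) ^ h : ℝ) * (∑ b, (evalAt P b ^ 4).trace).re := by
        rw [← Finset.mul_sum, Complex.re_sum, mul_assoc]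
    _ ≤ ((1 / 2) ^ n * (1 / m) ^ h : ℝ) * ‖∑ b, (evalAt P b ^ 4).trace‖ := by
        gcongr
        exact Complex.re_le_norm _
    _ ≤ (((1 / 2) ^ n * (1 / m) ^ h : ℝ) * ∑ v, ‖R v‖ ^ 2) ^ 2 := hb'
    _ ≤ (γ⁻¹ ^ (2 * d) * ∑ S, nnormSq (P S)) ^ 2 := by gcongr
    _ = _ := by
        rw [mul_pow, ← pow_mul, show 2 * d * 2 = 4 * d by ring, pow_mul]
        congr 2
        rw [inv_pow]
        field_simp
        linarith

end Hyper

end DerandInv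

namespace DerandInv

/-! ### Low-degree functions of signs and their expectations -/

section LowDegree

variable {n p : ℕ}

/-- The functions of `n` signs that are polynomials of degree at most `D`. -/
def lowDegree (n D : ℕ) : Submodule ℂ ((Fin n → ℤˣ) → ℂ) :=
  Submodule.span ℂ {φ | ∃ S : Finset (Fin n), S.card ≤ D ∧ φ = fun b => (char S b : ℂ)}

lemma char_mem_lowDegree {D : ℕ} {S : Finset (Fin n)} (hS : S.card ≤ D) :
    (fun b => (char S b : ℂ)) ∈ lowDegree n D :=
  Submodule.subset_span ⟨S, hS, rfl⟩

lemma lowDegree_mono {D E : ℕ} (h : D ≤ E) : lowDegree n D ≤ lowDegree n E :=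
  Submodule.span_mono fun _ ⟨S, hS, e⟩ => ⟨S, hS.trans h, e⟩

lemma const_mem_lowDegree (D : ℕ) (c : ℂ) : (fun _ => c) ∈ lowDegree n D := by
  have := Submodule.smul_mem _ c (char_mem_lowDegree (n := n) (D := D) (S := ∅) (by simp))
  convert this using 1
  ext b
  simp [char]

lemma char_mul_char (S T : Finset (Fin n)) (b : Fin n → ℤˣ) :
    char S b * char T b = char (symmDiff S T) b := by
  simp only [char_eq_prod, ← Finset.prod_mul_distrib]
  refine Finset.prod_congr rfl fun i _ => ?_
  rcases Int.units_eq_one_or (b i) with h | h <;> by_cases h1 : i ∈ S <;> by_cases h2 : i ∈ T <;>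
    simp [h, h1, h2, Finset.mem_symmDiff]

/-- Since signs square to 1, a product of characters is the character of the symmetric difference,
whose size is at most the sum of the sizes. -/
lemma mul_mem_lowDegree {D E : ℕ} {φ ψ : (Fin n → ℤˣ) → ℂ} (hφ : φ ∈ lowDegree n D)
    (hψ : ψ ∈ lowDegree n E) : (fun b => φ b * ψ b) ∈ lowDegree n (D + E) := by
  change φ * ψ ∈ _
  have h := Submodule.mul_mem_mul hφ hψ
  rw [lowDegree, lowDegree, Submodule.span_mul_span] at h
  refine Submodule.span_mono ?_ h
  rintro _ ⟨_, ⟨S, hS, rfl⟩, _, ⟨T, hT, rfl⟩, rfl⟩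
  refine ⟨symmDiff S T, ?_, ?_⟩
  · calc (symmDiff S T).card ≤ (S ∪ T).card := Finset.card_le_card (by
          intro i
          simp only [Finset.mem_symmDiff, Finset.mem_union]
          tauto)
      _ ≤ D + E := (Finset.card_union_le _ _).trans (by omega)
  · ext b
    simp [← char_mul_char]

lemma sum_mem_lowDegree {κ : Type*} {s : Finset κ} {D : ℕ} {φ : κ → (Fin n → ℤˣ) → ℂ}
    (h : ∀ k ∈ s, φ k ∈ lowDegree n D) : (fun b => ∑ k ∈ s, φ k b) ∈ lowDegree n D := by
  have := Submodule.sum_mem _ h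
  convert this using 1
  ext b
  simp

/-- Every function of `n` signs has degree at most `n`. -/
lemma mem_lowDegree_self (φ : (Fin n → ℤˣ) → ℂ) : φ ∈ lowDegree n n := by
  have key : ∀ (b₀ : Fin n → ℤˣ) (T : Finset (Fin n)),
      (fun b => ∏ i ∈ T, if b i = b₀ i then (1 : ℂ) else 0) ∈ lowDegree n T.card := by
    intro b₀ T
    induction T using Finset.induction_on with
    | empty => simpa using const_mem_lowDegree 0 1
    | insert i T hi ih =>
      rw [Finset.card_insert_of_notMem hi, add_comm]
      simp only [Finset.prod_insert hi]
      refine mul_mem_lowDegree ?_ ih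
      have h1 := Submodule.add_mem _ (const_mem_lowDegree (n := n) 1 (1 / 2))
        (Submodule.smul_mem _ (((b₀ i : ℤ) : ℂ) / 2)
          (char_mem_lowDegree (n := n) (D := 1) (S := {i}) (by simp)))
      convert h1 using 1
      ext b
      rcases Int.units_eq_one_or (b i) with h | h <;>
        rcases Int.units_eq_one_or (b₀ i) with h' | h' <;> simp [h, h', char] <;> norm_num
  have h2 : (fun b => ∑ b₀ : Fin n → ℤˣ,
      (φ b₀) * ∏ i, if b i = b₀ i then (1 : ℂ) else 0) ∈ lowDegree n n := by
    refine sum_mem_lowDegree fun b₀ _ => ?_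
    have := Submodule.smul_mem _ (φ b₀) (key b₀ univ)
    rw [Finset.card_fin] at this
    exact this
  convert h2 using 1
  ext b
  simp only [prod_ite_eq_ite]
  simp

/-- A probability weight on sign vectors that integrates characters of degree at most `D` like the
uniform one. -/
structure FoolsDegree (D : ℕ) (ρ : (Fin n → ℤˣ) → ℝ) : Prop where
  nonneg : ∀ v, 0 ≤ ρ v
  sum_eq_one : ∑ v, ρ v = 1
  sum_char : ∀ S : Finset (Fin n), S.Nonempty → S.card ≤ D → ∑ v, ρ v * char S v = 0

lemma FoolsDegree.sum_char_eq {D : ℕ} {ρ : (Fin n → ℤˣ) → ℝ} (hρ : FoolsDegree D ρ)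
    {S : Finset (Fin n)} (hS : S.card ≤ D) : ∑ v, ρ v * char S v = if S = ∅ then 1 else 0 := by
  rcases S.eq_empty_or_nonempty with rfl | h
  · simp [char, hρ.sum_eq_one]
  · rw [hρ.sum_char S h hS, if_neg h.ne_empty]

lemma foolsDegree_uniform (D : ℕ) : FoolsDegree D fun _ : Fin n → ℤˣ => (1 / 2 : ℝ) ^ n where
  nonneg _ := by positivity
  sum_eq_one := by
    simp
  sum_char S hS _ := by
    have := char_orthonormal ∅ S
    rw [if_neg hS.ne_empty.symm, Finset.mul_sum] at this
    simpa [char] using this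

/-- Two weights that fool degree `D` give the same expectation to functions of degree `D`. -/
lemma FoolsDegree.sum_eq {D : ℕ} {ρ ρ' : (Fin n → ℤˣ) → ℝ} (hρ : FoolsDegree D ρ)
    (hρ' : FoolsDegree D ρ') {φ : (Fin n → ℤˣ) → ℂ} (hφ : φ ∈ lowDegree n D) :
    ∑ v, (ρ v : ℂ) * φ v = ∑ v, (ρ' v : ℂ) * φ v := by
  induction hφ using Submodule.span_induction with
  | mem φ h =>
    obtain ⟨S, hS, rfl⟩ := h
    have h := (hρ.sum_char_eq hS).trans (hρ'.sum_char_eq hS).symm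
    dsimp only
    exact_mod_cast h
  | zero => simp
  | add φ ψ _ _ h1 h2 => simp only [Pi.add_apply, mul_add, Finset.sum_add_distrib, h1, h2]
  | smul c φ _ h =>
    simp only [Pi.smul_apply, smul_eq_mul, mul_left_comm _ c, ← Finset.mul_sum, h]

/-- The expectation of a function of independent sign vectors with the given weights. -/
noncomputable def prodExp (ρ : Fin p → (Fin n → ℤˣ) → ℝ) (Φ : (Fin p → Fin n → ℤˣ) → ℝ) : ℝ :=
  ∑ w, (∏ j, ρ j (w j)) * Φ w

lemma prodExp_weight_nonneg {D : ℕ} {ρ : Fin p → (Fin n → ℤˣ) → ℝ}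
    (hρ : ∀ j, FoolsDegree D (ρ j)) (w : Fin p → Fin n → ℤˣ) : 0 ≤ ∏ j, ρ j (w j) :=
  Finset.prod_nonneg fun j _ => (hρ j).nonneg _

lemma prodExp_mono {D : ℕ} {ρ : Fin p → (Fin n → ℤˣ) → ℝ} (hρ : ∀ j, FoolsDegree D (ρ j))
    {Φ Ψ : (Fin p → Fin n → ℤˣ) → ℝ} (h : ∀ w, Φ w ≤ Ψ w) : prodExp ρ Φ ≤ prodExp ρ Ψ :=
  Finset.sum_le_sum fun w _ => mul_le_mul_of_nonneg_left (h w) (prodExp_weight_nonneg hρ w)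

lemma prodExp_sub (ρ : Fin p → (Fin n → ℤˣ) → ℝ) (Φ Ψ : (Fin p → Fin n → ℤˣ) → ℝ) :
    prodExp ρ (fun w => Φ w - Ψ w) = prodExp ρ Φ - prodExp ρ Ψ := by
  simp only [prodExp, mul_sub, Finset.sum_sub_distrib]

lemma prodExp_const_mul (ρ : Fin p → (Fin n → ℤˣ) → ℝ) (c : ℝ) (Φ : (Fin p → Fin n → ℤˣ) → ℝ) :
    prodExp ρ (fun w => c * Φ w) = c * prodExp ρ Φ := by
  simp only [prodExp, Finset.mul_sum]
  exact Finset.sum_congr rfl fun w _ => by ring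

lemma prodExp_const {D : ℕ} {ρ : Fin p → (Fin n → ℤˣ) → ℝ} (hρ : ∀ j, FoolsDegree D (ρ j))
    (c : ℝ) : prodExp ρ (fun _ => c) = c := by
  rw [prodExp, ← Finset.sum_mul, sum_prod_pi (fun j v => ρ j v)]
  simp [(hρ _).sum_eq_one]

lemma abs_prodExp_sub_le {D : ℕ} {ρ : Fin p → (Fin n → ℤˣ) → ℝ} (hρ : ∀ j, FoolsDegree D (ρ j))
    {Φ Ψ T : (Fin p → Fin n → ℤˣ) → ℝ} (h : ∀ w, |Φ w - Ψ w| ≤ T w) :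
    |prodExp ρ Φ - prodExp ρ Ψ| ≤ prodExp ρ T := by
  have h1 := prodExp_mono hρ fun w => (abs_le.1 (h w)).2
  have h2 := prodExp_mono hρ fun w => neg_le.1 (abs_le.1 (h w)).1
  have h3 : prodExp ρ (fun w => -(Φ w - Ψ w)) = -prodExp ρ fun w => Φ w - Ψ w := by
    simpa using prodExp_const_mul ρ (-1) fun w => Φ w - Ψ w
  rw [h3] at h2
  rw [← prodExp_sub, abs_le]
  exact ⟨by linarith, h1⟩

/-- Splitting off the sign vector of one block. -/
lemma prodExp_split (ρ : Fin p → (Fin n → ℤˣ) → ℝ) (j : Fin p)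
    (Φ : (Fin p → Fin n → ℤˣ) → ℝ) :
    prodExp ρ Φ = ∑ u : {i // i ≠ j} → Fin n → ℤˣ, (∏ i : {i // i ≠ j}, ρ i (u i)) *
      ∑ v, ρ j v * Φ ((Equiv.funSplitAt j _).symm (v, u)) := by
  rw [prodExp, ← (Equiv.funSplitAt j (Fin n → ℤˣ)).symm.sum_comp, Fintype.sum_prod_type_right]
  refine Finset.sum_congr rfl fun u _ => ?_
  rw [Finset.mul_sum]
  refine Finset.sum_congr rfl fun v _ => ?_
  rw [Fintype.prod_eq_mul_prod_subtype_ne _ j]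
  have h1 : (Equiv.funSplitAt j (Fin n → ℤˣ)).symm (v, u) j = v := by
    simp [Equiv.funSplitAt, Equiv.piSplitAt]
  have h2 : ∀ i : {i // i ≠ j}, (Equiv.funSplitAt j (Fin n → ℤˣ)).symm (v, u) i = u i := by
    intro i
    simp [Equiv.funSplitAt, Equiv.piSplitAt, i.2]
  simp only [h1, h2]
  ring

/-- Changing the weight of one block does not change the expectation of a function that has low
degree in that block. -/
lemma prodExp_eq_of_block {D : ℕ} {ρ ρ' : Fin p → (Fin n → ℤˣ) → ℝ} {j : Fin p}
    (hρ : FoolsDegree D (ρ j)) (hρ' : FoolsDegree D (ρ' j)) (hne : ∀ i, i ≠ j → ρ i = ρ' i)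
    {Φ : (Fin p → Fin n → ℤˣ) → ℝ}
    (hΦ : ∀ u : {i // i ≠ j} → Fin n → ℤˣ, ∃ φ ∈ lowDegree n D,
      ∀ v, Φ ((Equiv.funSplitAt j _).symm (v, u)) = (φ v).re) :
    prodExp ρ Φ = prodExp ρ' Φ := by
  rw [prodExp_split ρ j, prodExp_split ρ' j]
  refine Finset.sum_congr rfl fun u _ => ?_
  obtain ⟨φ, hφ, e⟩ := hΦ u
  have h := congrArg Complex.re (hρ.sum_eq hρ' hφ)
  simp only [Complex.re_sum, Complex.re_ofReal_mul] at h
  simp only [e, h]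
  congr 1
  exact Finset.prod_congr rfl fun i _ => by rw [hne i.1 i.2]

/-- The generator turns independent sign vectors that fool degree `D` into one. -/
lemma prodExp_gen {D : ℕ} {ρ : Fin p → (Fin n → ℤˣ) → ℝ} (hρ : ∀ j, FoolsDegree D (ρ j))
    (f : Fin n → Fin p) {Φ : (Fin n → ℤˣ) → ℝ} {φ : (Fin n → ℤˣ) → ℂ}
    (hφ : φ ∈ lowDegree n D) (e : ∀ b, Φ b = (φ b).re) :
    prodExp ρ (fun w => Φ (gen f w)) = (1 / 2 : ℝ) ^ n * ∑ b, Φ b := by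
  let ρ' : (Fin n → ℤˣ) → ℝ := fun b => ∑ w, if gen f w = b then ∏ j, ρ j (w j) else 0
  have hsum : ∀ Ψ : (Fin n → ℤˣ) → ℝ, ∑ b, ρ' b * Ψ b = prodExp ρ fun w => Ψ (gen f w) := by
    intro Ψ
    simp only [ρ', Finset.sum_mul, prodExp]
    rw [Finset.sum_comm]
    refine Finset.sum_congr rfl fun w _ => ?_
    simp
  have hF : FoolsDegree D ρ' := by
    refine ⟨fun b => Finset.sum_nonneg fun w _ => ?_, ?_, fun S hS hD => ?_⟩
    · split_ifs
      · exact prodExp_weight_nonneg hρ w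
      · exact le_rfl
    · simpa [prodExp_const hρ] using hsum fun _ => 1
    · rw [hsum]
      -- A character factors over the blocks. The block of any member of S carries a nonempty
      -- character of size at most D, whose mean is zero, so the product vanishes.
      have hchar : ∀ w, char S (gen f w) = ∏ j, char (S.filter fun i => f i = j) (w j) := by
        intro w
        simp only [char, gen]
        rw [← Finset.prod_fiberwise_of_maps_to (s := S) (t := univ) (g := f) (by simp)]
        refine Finset.prod_congr rfl fun j _ => Finset.prod_congr rfl fun i hi => ?_
        rw [(Finset.mem_filter.1 hi).2]
      simp only [prodExp, hchar, ← Finset.prod_mul_distrib]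
      rw [sum_prod_pi (fun j v => ρ j v * char (S.filter fun i => f i = j) v)]
      obtain ⟨i, hi⟩ := hS
      refine Finset.prod_eq_zero (Finset.mem_univ (f i)) ?_
      exact (hρ _).sum_char _ ⟨i, by simp [hi]⟩ ((Finset.card_filter_le _ _).trans hD)
  have h := congrArg Complex.re (hF.sum_eq (foolsDegree_uniform D) hφ)
  simp only [Complex.re_sum, Complex.re_ofReal_mul, ← e] at h
  rw [← hsum, h, Finset.mul_sum]

/-- Replacing the weights of all blocks, one after the other. -/
lemma abs_prodExp_sub_prodExp_le {D : ℕ} {ρ ρ' : Fin p → (Fin n → ℤˣ) → ℝ}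
    (hρ : ∀ j, FoolsDegree D (ρ j)) (hρ' : ∀ j, FoolsDegree D (ρ' j))
    {Φ : (Fin p → Fin n → ℤˣ) → ℝ} {err : Fin p → ℝ}
    (h : ∀ j (σ σ' : Fin p → (Fin n → ℤˣ) → ℝ), (∀ i, FoolsDegree D (σ i)) →
      (∀ i, FoolsDegree D (σ' i)) → (∀ i, i ≠ j → σ i = σ' i) →
      |prodExp σ Φ - prodExp σ' Φ| ≤ err j) :
    |prodExp ρ Φ - prodExp ρ' Φ| ≤ ∑ j, err j := by
  -- Hybrid argument: the blocks in J carry ρ, the others ρ'.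
  have hmix : ∀ (J : Finset (Fin p)) i, FoolsDegree D (J.piecewise ρ ρ' i) := by
    intro J i
    by_cases hi : i ∈ J <;> simp [hi, hρ, hρ']
  have key : ∀ J : Finset (Fin p), |prodExp (J.piecewise ρ ρ') Φ - prodExp ρ' Φ| ≤ ∑ j ∈ J, err j := by
    intro J
    induction J using Finset.induction_on with
    | empty => simp
    | insert j J hj ih =>
      rw [Finset.sum_insert hj]
      refine (abs_sub_le _ (prodExp (J.piecewise ρ ρ') Φ) _).trans (add_le_add ?_ ih)
      refine h j _ _ (hmix _) (hmix _) fun i hi => ?_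
      rw [Finset.piecewise_insert, Function.update_of_ne hi]
  simpa using key univ

end LowDegree

end DerandInv

namespace DerandInv

/-! ### Exchanging one block of signs -/

section Block

variable {m h n p : ℕ}

/-- Matrices whose entries are functions of `n` signs of degree at most `D`. -/
def MatLowDegree (D : ℕ) (X : (Fin n → ℤˣ) → Op m h) : Prop :=
  ∀ x y, (fun v => X v x y) ∈ lowDegree n D

lemma MatLowDegree.mul {D E : ℕ} {X Y : (Fin n → ℤˣ) → Op m h} (hX : MatLowDegree D X)
    (hY : MatLowDegree E Y) : MatLowDegree (D + E) fun v => X v * Y v := by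
  intro x y
  simp only [Matrix.mul_apply]
  exact sum_mem_lowDegree fun k _ => mul_mem_lowDegree (hX x k) (hY k y)

lemma MatLowDegree.add {D : ℕ} {X Y : (Fin n → ℤˣ) → Op m h} (hX : MatLowDegree D X)
    (hY : MatLowDegree D Y) : MatLowDegree D fun v => X v + Y v :=
  fun x y => Submodule.add_mem _ (hX x y) (hY x y)

lemma MatLowDegree.const (D : ℕ) (A : Op m h) : MatLowDegree (n := n) D fun _ => A :=
  fun x y => const_mem_lowDegree D (A x y)

lemma MatLowDegree.pow {D : ℕ} {X : (Fin n → ℤˣ) → Op m h} (hX : MatLowDegree D X) (k : ℕ) :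
    MatLowDegree (k * D) fun v => X v ^ k := by
  induction k with
  | zero => simpa using MatLowDegree.const 0 (1 : Op m h)
  | succ k ih =>
    simp only [pow_succ, Nat.succ_mul]
    exact ih.mul hX

lemma MatLowDegree.trace {D : ℕ} {X : (Fin n → ℤˣ) → Op m h} (hX : MatLowDegree D X) :
    (fun v => (X v).trace) ∈ lowDegree n D :=
  sum_mem_lowDegree fun x _ => hX x x

/-- Each word in the k-th coefficient contains exactly k factors X, and A is constant. -/
lemma MatLowDegree.powCoeff {D : ℕ} (A : Op m h) {X : (Fin n → ℤˣ) → Op m h}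
    (hX : MatLowDegree D X) (k N : ℕ) :
    MatLowDegree (k * D) fun v => DerandInv.powCoeff A (X v) k N := by
  induction N generalizing k with
  | zero =>
    cases k with
    | zero => simpa [powCoeff_zero] using MatLowDegree.const 0 (1 : Op m h)
    | succ k =>
      simp only [powCoeff_of_lt _ _ (Nat.succ_pos k)]
      exact MatLowDegree.const _ 0
  | succ N ih =>
    cases k with
    | zero =>
      simp only [powCoeff_zero]
      exact MatLowDegree.const _ _
    | succ k =>
      have e : ∀ v, DerandInv.powCoeff A (X v) (k + 1) (N + 1)
          = A * DerandInv.powCoeff A (X v) (k + 1) N + X v * DerandInv.powCoeff A (X v) k N :=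
        fun v => rfl
      simp only [e]
      refine .add ?_ ?_
      · simpa using (MatLowDegree.const 0 A).mul (ih (k + 1))
      · have := hX.mul (ih k)
        rwa [show D + k * D = (k + 1) * D by ring] at this

lemma exists_lowDegree_traceCoeff {D : ℕ} (q : Polynomial ℝ) (A : Op m h)
    {X : (Fin n → ℤˣ) → Op m h} (hX : MatLowDegree D X) (k : ℕ) :
    ∃ φ ∈ lowDegree n (k * D), ∀ v, traceCoeff q A (X v) k = (φ v).re := by
  refine ⟨fun v => ∑ N ∈ q.support, (q.coeff N : ℂ) * (DerandInv.powCoeff A (X v) k N).trace, ?_, ?_⟩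
  · exact sum_mem_lowDegree fun N _ => Submodule.smul_mem _ _ (hX.powCoeff A k N).trace
  · intro v
    rw [Complex.re_sum, traceCoeff, Polynomial.sum]
    simp only [Complex.re_ofReal_mul]

lemma matLowDegree_evalAt {D : ℕ} {P : Finset (Fin n) → Op m h}
    (hP : ∀ S, P S ≠ 0 → S.card ≤ D) : MatLowDegree D (evalAt P) := by
  intro x y
  simp only [evalAt, Matrix.sum_apply, Matrix.smul_apply, Complex.real_smul]
  refine sum_mem_lowDegree fun S _ => ?_
  by_cases h0 : P S = 0
  · simpa [h0] using const_mem_lowDegree (n := n) D 0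
  · have := Submodule.smul_mem _ (P S x y) (char_mem_lowDegree (hP S h0))
    convert this using 1
    ext b
    simp [char, mul_comm]

/-- With the other blocks frozen, only the signs at indices hashed to j vary; the rest of each
character is a scalar. -/
lemma matLowDegree_evalAt_gen {D : ℕ} {P : Finset (Fin n) → Op m h}
    (hP : ∀ S, P S ≠ 0 → S.card ≤ D) (f : Fin n → Fin p) (j : Fin p)
    (u : {i // i ≠ j} → Fin n → ℤˣ) :
    MatLowDegree D fun v => evalAt P (gen f ((Equiv.funSplitAt j _).symm (v, u))) := by
  intro x y
  simp only [evalAt, Matrix.sum_apply, Matrix.smul_apply, Complex.real_smul]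
  refine sum_mem_lowDegree fun S _ => ?_
  by_cases h0 : P S = 0
  · simpa [h0] using const_mem_lowDegree (n := n) D 0
  · have hc : (S.filter fun i => f i = j).card ≤ D := (Finset.card_filter_le _ _).trans (hP S h0)
    have := Submodule.smul_mem _
      ((char (S.filter fun i => ¬ f i = j) (gen f ((Equiv.funSplitAt j _).symm (1, u))) : ℂ)
        * P S x y) (char_mem_lowDegree hc)
    convert this using 1
    ext v
    simp only [Pi.smul_apply, smul_eq_mul]
    rw [mul_right_comm, ← Complex.ofReal_mul]
    congr 2
    rw [← Finset.prod_filter_not_mul_prod_filter S fun i => f i = j]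
    congr 1
    · refine Finset.prod_congr rfl fun i hi => ?_
      have hi' := (Finset.mem_filter.1 hi).2
      simp [gen, Equiv.funSplitAt, Equiv.piSplitAt, hi']
    · refine Finset.prod_congr rfl fun i hi => ?_
      have hi' := (Finset.mem_filter.1 hi).2
      simp [gen, Equiv.funSplitAt, Equiv.piSplitAt, hi']

lemma evalAt_gen_eq_of_disjoint {P : Finset (Fin n) → Op m h} (f : Fin n → Fin p) (j : Fin p)
    (hP : ∀ S, P S ≠ 0 → ∀ i ∈ S, f i ≠ j) (u : {i // i ≠ j} → Fin n → ℤˣ)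
    (v v' : Fin n → ℤˣ) :
    evalAt P (gen f ((Equiv.funSplitAt j _).symm (v, u)))
      = evalAt P (gen f ((Equiv.funSplitAt j _).symm (v', u))) := by
  refine Finset.sum_congr rfl fun S _ => ?_
  by_cases h0 : P S = 0
  · simp [h0]
  · congr 1
    refine Finset.prod_congr rfl fun i hi => ?_
    have hi' := hP S h0 i hi
    simp [gen, Equiv.funSplitAt, Equiv.piSplitAt, hi']

lemma isHermitian_evalAt {P : Finset (Fin n) → Op m h} (hP : ∀ S, (P S).IsHermitian)
    (b : Fin n → ℤˣ) : (evalAt P b).IsHermitian :=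
  isSelfAdjoint_sum _ fun S _ => (IsSelfAdjoint.all _).smul (hP S)

/-- The part of `P` in which some variable of the set `s` occurs. -/
def touching (P : Finset (Fin n) → Op m h) (s : Finset (Fin n)) (S : Finset (Fin n)) : Op m h :=
  if Disjoint S s then 0 else P S

/-- The part of `P` in which no variable of the set `s` occurs. -/
def avoiding (P : Finset (Fin n) → Op m h) (s : Finset (Fin n)) (S : Finset (Fin n)) : Op m h :=
  if Disjoint S s then P S else 0

lemma evalAt_avoiding_add_touching (P : Finset (Fin n) → Op m h) (s : Finset (Fin n))
    (b : Fin n → ℤˣ) : evalAt (avoiding P s) b + evalAt (touching P s) b = evalAt P b := by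
  rw [evalAt, evalAt, evalAt, ← Finset.sum_add_distrib]
  refine Finset.sum_congr rfl fun S _ => ?_
  rw [← smul_add]
  congr 1
  by_cases hs : Disjoint S s <;> simp [avoiding, touching, hs]

lemma isHermitian_touching {P : Finset (Fin n) → Op m h} (hP : ∀ S, (P S).IsHermitian)
    (s S : Finset (Fin n)) : (touching P s S).IsHermitian := by
  unfold touching
  split_ifs
  exacts [Matrix.isHermitian_zero, hP S]

lemma isHermitian_avoiding {P : Finset (Fin n) → Op m h} (hP : ∀ S, (P S).IsHermitian)
    (s S : Finset (Fin n)) : (avoiding P s S).IsHermitian := by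
  unfold avoiding
  split_ifs
  exacts [hP S, Matrix.isHermitian_zero]

/-- Exchanging the weight of one block changes the expected trace of a polynomial by at most the
fourth moment of the part of the operator that the block touches. -/
lemma abs_prodExp_block_le {D : ℕ} {P : Finset (Fin n) → Op m h} (hP : ∀ S, (P S).IsHermitian)
    (hD : ∀ S, P S ≠ 0 → S.card ≤ D) (f : Fin n → Fin p) (j : Fin p) {s : Finset (Fin n)}
    (hs : s = univ.filter fun i => f i = j) (q : Polynomial ℝ) {R c : ℝ}
    (hR : ∀ b, ∀ θ ∈ Set.Icc (0 : ℝ) 1,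
      spectrum ℝ (evalAt (avoiding P s) b + (θ : ℂ) • evalAt (touching P s) b) ⊆ Set.Ioo (-R) R)
    (hq : ∀ t ∈ Set.Icc (-R) R, |(Polynomial.derivative^[4] q).eval t| ≤ c)
    {ρ ρ' : Fin p → (Fin n → ℤˣ) → ℝ} (hρ : ∀ i, FoolsDegree (4 * D) (ρ i))
    (hρ' : ∀ i, FoolsDegree (4 * D) (ρ' i)) (hne : ∀ i, i ≠ j → ρ i = ρ' i) :
    |prodExp ρ (fun w => (Polynomial.aeval (evalAt P (gen f w)) q).trace.re)
        - prodExp ρ' (fun w => (Polynomial.aeval (evalAt P (gen f w)) q).trace.re)|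
      ≤ c / 12 * ((1 / 2 : ℝ) ^ n * ∑ b, (evalAt (touching P s) b ^ 4).trace.re) := by
  set A := evalAt (avoiding P s) with hA
  set Q := evalAt (touching P s) with hQ
  let M : (Fin n → ℤˣ) → ℝ := fun b => ∑ k ∈ range 4, traceCoeff q (A b) (Q b) k
  have hDt : ∀ S, touching P s S ≠ 0 → S.card ≤ D := by
    intro S hS
    refine hD S fun h0 => hS ?_
    simp [touching, h0]
  have hclose : ∀ b, |(Polynomial.aeval (evalAt P b) q).trace.re - M b|
      ≤ c / 24 * (Q b ^ 4).trace.re := by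
    intro b
    rw [← evalAt_avoiding_add_touching P s b]
    exact abs_trace_taylor_le (isHermitian_evalAt (isHermitian_avoiding hP s) b)
      (isHermitian_evalAt (isHermitian_touching hP s) b) q (hR b) hq
  -- In the block j the operator A is constant, so the Taylor terms of order k ≤ 3 have degree at
  -- most 3D in its sign vector and do not see the exchange.
  have hmain : prodExp ρ (fun w => M (gen f w)) = prodExp ρ' (fun w => M (gen f w)) := by
    refine prodExp_eq_of_block (D := 4 * D) (hρ j) (hρ' j) hne fun u => ?_
    have hX : MatLowDegree D fun v => Q (gen f ((Equiv.funSplitAt j _).symm (v, u))) :=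
      matLowDegree_evalAt_gen hDt f j u
    choose φ hφ e using fun k => exists_lowDegree_traceCoeff q
      (A (gen f ((Equiv.funSplitAt j _).symm (1, u)))) hX k
    refine ⟨fun v => ∑ k ∈ range 4, φ k v, sum_mem_lowDegree fun k hk => lowDegree_mono ?_ (hφ k),
      fun v => ?_⟩
    · exact Nat.mul_le_mul_right _ (Finset.mem_range.1 hk).le
    · rw [Complex.re_sum]
      refine Finset.sum_congr rfl fun k _ => ?_
      rw [← e]
      congr 1
      refine evalAt_gen_eq_of_disjoint f j (fun S hS i hi hij => hS ?_) u v 1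
      rw [avoiding, if_neg]
      rw [Finset.not_disjoint_iff]
      exact ⟨i, hi, by simp [hs, hij]⟩
  -- Tr Q⁴ has degree at most 4D in all signs, so its mean under the generator is the uniform one.
  -- The estimate is used for both weights, whence c/12 = 2 · c/24.
  have hT : ∀ σ : Fin p → (Fin n → ℤˣ) → ℝ, (∀ i, FoolsDegree (4 * D) (σ i)) →
      |prodExp σ (fun w => (Polynomial.aeval (evalAt P (gen f w)) q).trace.re)
        - prodExp σ (fun w => M (gen f w))|
      ≤ c / 24 * ((1 / 2 : ℝ) ^ n * ∑ b, (Q b ^ 4).trace.re) := by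
    intro σ hσ
    refine (abs_prodExp_sub_le hσ fun w => hclose (gen f w)).trans ?_
    rw [prodExp_const_mul, prodExp_gen hσ f ((matLowDegree_evalAt hDt).pow 4).trace fun b => rfl]
  have h1 := hT ρ hρ
  have h2 := hT ρ' hρ'
  rw [hmain] at h1
  rw [abs_le] at h1 h2 ⊢
  constructor <;> linarith

lemma norm_evalAt_apply_le {P P' : Finset (Fin n) → Op m h}
    (hPP : ∀ S x y, ‖P' S x y‖ ≤ ‖P S x y‖) (b : Fin n → ℤˣ) (x y : Fin h → Fin m) :
    ‖evalAt P' b x y‖ ≤ ∑ S, ‖P S x y‖ := by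
  simp only [evalAt, Matrix.sum_apply, Matrix.smul_apply]
  refine (norm_sum_le _ _).trans (Finset.sum_le_sum fun S _ => ?_)
  rw [norm_smul]
  have : ‖∏ i ∈ S, ((b i : ℤ) : ℝ)‖ = 1 := by
    rw [norm_prod]
    refine Finset.prod_eq_one fun i _ => ?_
    rcases Int.units_eq_one_or (b i) with h | h <;> simp [h]
  rw [this, one_mul]
  exact hPP S x y

/-- A common bound for the spectra of all interpolations between `evalAt (avoiding P s) b` and
`evalAt P b`. -/
lemma exists_spectrum_subset (P : Finset (Fin n) → Op m h) (hP : ∀ S, (P S).IsHermitian) :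
    ∃ R : ℝ, 0 ≤ R ∧ ∀ (s : Finset (Fin n)) b, ∀ θ ∈ Set.Icc (0 : ℝ) 1,
      spectrum ℝ (evalAt (avoiding P s) b + (θ : ℂ) • evalAt (touching P s) b)
        ⊆ Set.Ioo (-R) R := by
  set T : ℝ := ∑ x : Fin h → Fin m, ∑ y : Fin h → Fin m, (∑ S, ‖P S x y‖) ^ 2 with hT
  have hT0 : 0 ≤ T := Finset.sum_nonneg fun x _ => Finset.sum_nonneg fun y _ => sq_nonneg _
  -- T bounds the squared Hilbert–Schmidt norm uniformly in s, b and θ; adding 1 makes the interval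
  -- open around the spectrum.
  refine ⟨√T + 1, by positivity, fun s b θ hθ x hx => ?_⟩
  have e : evalAt (avoiding P s) b + (θ : ℂ) • evalAt (touching P s) b
      = evalAt (fun S => avoiding P s S + θ • touching P s S) b := by
    simp only [evalAt, smul_add, Finset.sum_add_distrib, Finset.smul_sum]
    congr 1
    refine Finset.sum_congr rfl fun S _ => ?_
    rw [smul_comm, Complex.coe_smul]
  have hH : ∀ S, (avoiding P s S + θ • touching P s S).IsHermitian := fun S =>
    (isHermitian_avoiding hP s S).add ((IsSelfAdjoint.all θ).smul (isHermitian_touching hP s S))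
  rw [e] at hx
  have h1 := sq_le_of_mem_spectrum (isHermitian_evalAt hH b) hx
  have h2 : x ^ 2 ≤ T := by
    refine h1.trans (Finset.sum_le_sum fun i _ => Finset.sum_le_sum fun k _ => ?_)
    gcongr
    refine norm_evalAt_apply_le (fun S x y => ?_) b i k
    by_cases hs : Disjoint S s
    · simp [avoiding, touching, hs]
    · simp only [avoiding, touching, hs, if_false, zero_add, Matrix.smul_apply, norm_smul]
      rw [Real.norm_of_nonneg hθ.1]
      exact mul_le_of_le_one_left (norm_nonneg _) hθ.2
  have h3 := Real.abs_le_sqrt h2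
  rw [abs_le] at h3
  exact ⟨by linarith, by linarith⟩

end Block

end DerandInv

namespace DerandInv

/-! ### Random sign vectors and their weights -/

section Measure

variable {n p : ℕ} {Ω : Type*} [MeasurableSpace Ω] {μ : Measure Ω} [IsProbabilityMeasure μ]

instance measurableSingletonClass_signs : MeasurableSingletonClass ℤˣ where
  measurableSet_singleton x := by
    have : ({x} : Set ℤˣ) = Units.val ⁻¹' {(x : ℤ)} := by
      ext y
      simp [Units.ext_iff]
    rw [this]
    exact measurableSet_preimage (comap_measurable _) (measurableSet_singleton _)

lemma integral_comp_fintype {α : Type*} [Fintype α] [MeasurableSpace α]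
    [MeasurableSingletonClass α] {Y : Ω → α} (hY : Measurable Y) (g : α → ℝ) :
    ∫ ω, g (Y ω) ∂μ = ∑ y, μ.real {ω | Y ω = y} * g y := by
  have := Measure.isProbabilityMeasure_map (μ := μ) hY.aemeasurable
  rw [← integral_map (f := g) hY.aemeasurable (by fun_prop), integral_fintype .of_finite]
  refine Finset.sum_congr rfl fun y _ => ?_
  rw [map_measureReal_apply hY (measurableSet_singleton y)]
  rfl

/-- The signs at the at most D positions of S are jointly uniform, so the mean of the character is a
product of zero means. -/
lemma SignUniform.foolsDegree {D : ℕ} {z : Ω → Fin n → ℤˣ} (hz : Measurable z)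
    (h : SignUniform μ D z) : FoolsDegree D fun v => μ.real {ω | z ω = v} where
  nonneg _ := measureReal_nonneg
  sum_eq_one := by
    have := integral_comp_fintype (μ := μ) hz fun _ => 1
    simpa using this.symm
  sum_char S hS hD := by
    rw [← integral_comp_fintype hz (char S)]
    let x : Fin S.card ↪ Fin n := (S.orderEmbOfFin rfl).toEmbedding
    have hx : ∀ b : Fin n → ℤˣ, char S b = ∏ t, ((b (x t) : ℤ) : ℝ) := by
      intro b
      rw [char, ← Finset.prod_coe_sort]
      exact ((S.orderIsoOfFin rfl).toEquiv.prod_comp fun i : S => ((b i : ℤ) : ℝ)).symm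
    simp only [hx]
    have hY : Measurable fun ω t => z ω (x t) := by fun_prop
    rw [integral_comp_fintype hY fun y => ∏ t, ((y t : ℤ) : ℝ)]
    have e : ∀ y : Fin S.card → ℤˣ, {ω | (fun t => z ω (x t)) = y} = {ω | ∀ t, z ω (x t) = y t} :=
      fun y => by simp only [funext_iff]
    simp only [e, h _ hD x, ← Finset.mul_sum]
    rw [sum_prod_pi (fun _ (y : ℤˣ) => ((y : ℤ) : ℝ))]
    rw [Finset.prod_eq_zero (Finset.mem_univ ⟨0, hS.card_pos⟩) (by rw [sum_units]; simp), mul_zero]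

lemma integral_eq_prodExp {z : Fin p → Ω → Fin n → ℤˣ} (hz : ∀ i, Measurable (z i))
    (hi : iIndepFun z μ) (Φ : (Fin p → Fin n → ℤˣ) → ℝ) :
    ∫ ω, Φ (fun i => z i ω) ∂μ = prodExp (fun i v => μ.real {ω | z i ω = v}) Φ := by
  rw [integral_comp_fintype (measurable_pi_lambda _ hz), prodExp]
  refine Finset.sum_congr rfl fun w _ => ?_
  congr 1
  have h := hi.measure_inter_preimage_eq_mul univ (sets := fun i => {w i})
    fun i _ => measurableSet_singleton _
  have e : {ω | (fun i => z i ω) = w} = ⋂ i ∈ (univ : Finset (Fin p)), z i ⁻¹' {w i} := by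
    ext ω
    simp [funext_iff]
  rw [Measure.real, e, h, ENNReal.toReal_prod]
  rfl

end Measure

/-! ### Influences and hashing -/

section Influence

variable {m h n p : ℕ} {B : Fin (m ^ 2) → Matrix (Fin m) (Fin m) ℂ}

lemma nnormSq_nonneg (A : Op m h) : 0 ≤ nnormSq A := by
  rw [nnormSq_eq_sum]
  positivity

lemma varInf_nonneg (P : Finset (Fin n) → Op m h) (i : Fin n) : 0 ≤ varInf P i :=
  Finset.sum_nonneg fun S _ => nnormSq_nonneg (P S)

lemma card_add_weight_le_of_opDegree {d k : ℕ} {A : Op m h}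
    (hd : (k : WithBot ℕ) + opDegree B A ≤ d) {σ : Fin h → Fin (m ^ 2)}
    (hσ : fourierCoeff B A σ ≠ 0) : k + weight σ ≤ d := by
  classical
  have h1 : ((weight σ : ℕ) : WithBot ℕ) ≤ opDegree B A := by
    unfold opDegree
    refine Finset.le_sup (f := fun σ => ((weight σ : ℕ) : WithBot ℕ)) ?_
    simpa using hσ
  have h2 : (k : WithBot ℕ) + (weight σ : ℕ) ≤ d := (add_le_add_right h1 _).trans hd
  exact_mod_cast h2

/-- The zero operator has degree `⊥`, so the degree hypothesis leaves |S| free when P_S = 0. A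
nonzero coefficient is what yields |S| ≤ d in the remaining cases. -/
lemma IsStdBasis.exists_fourierCoeff_ne_zero (hB : IsStdBasis m B) {A : Op m h} (hA : A ≠ 0) :
    ∃ σ, fourierCoeff B A σ ≠ 0 := by
  by_contra! hcon
  refine hA (Matrix.ext fun x y => ?_)
  have := hB.entry_eq_sum A fun i => (x i, y i)
  simpa [hcon, entry] using this

/-- Union bound: a set meeting s is counted in the influence of at least one element of s. -/
lemma sum_nnormSq_touching_le (P : Finset (Fin n) → Op m h) (s : Finset (Fin n)) :
    ∑ S, nnormSq (touching P s S) ≤ ∑ i ∈ s, varInf P i := by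
  have e : ∀ i, varInf P i = ∑ S, if i ∈ S then nnormSq (P S) else 0 := fun i => by
    rw [varInf, Finset.sum_filter]
  simp only [e]
  rw [Finset.sum_comm]
  refine Finset.sum_le_sum fun S _ => ?_
  have h0 : ∀ i ∈ s, 0 ≤ if i ∈ S then nnormSq (P S) else 0 := fun i _ => by
    split_ifs
    exacts [nnormSq_nonneg _, le_rfl]
  by_cases hs : Disjoint S s
  · rw [touching, if_pos hs]
    simpa [nnormSq] using Finset.sum_nonneg h0
  · obtain ⟨i, hiS, his⟩ := Finset.not_disjoint_iff.1 hs
    rw [touching, if_neg hs]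
    refine le_trans ?_ (Finset.single_le_sum h0 his)
    rw [if_pos hiS]

/-- Each S is counted |S| times, once for every variable in it. -/
lemma sum_varInf_le {d : ℕ} {P : Finset (Fin n) → Op m h} (hD : ∀ S, P S ≠ 0 → S.card ≤ d) :
    ∑ i, varInf P i ≤ d * ∑ S, nnormSq (P S) := by
  simp only [varInf, Finset.sum_filter]
  rw [Finset.sum_comm, Finset.mul_sum]
  refine Finset.sum_le_sum fun S _ => ?_
  rw [← Finset.sum_filter, Finset.sum_const, nsmul_eq_mul]
  by_cases h0 : P S = 0
  · simp [h0, nnormSq]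
  · refine mul_le_mul_of_nonneg_right ?_ (nnormSq_nonneg _)
    simpa using hD S h0

lemma HashUniform.nonempty {ι : Type*} [Fintype ι] {k : ℕ} {F : ι → Fin n → Fin p}
    (hF : HashUniform k F) : Nonempty ι := by
  by_contra hcon
  rw [not_nonempty_iff] at hcon
  have := hF 0 (Nat.zero_le k) ⟨Fin.elim0, fun s => s.elim0⟩ Fin.elim0
  simp at this

lemma HashUniform.card_collision {ι : Type*} [Fintype ι] {F : ι → Fin n → Fin p}
    (hF : HashUniform 2 F) {i k : Fin n} (hik : i ≠ k) :
    ((univ.filter fun a => F a i = F a k).card : ℝ) / Fintype.card ι = 1 / p := by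
  let x : Fin 2 ↪ Fin n := ⟨![i, k], by
    intro s t hst
    fin_cases s <;> fin_cases t <;> simp_all [eq_comm]⟩
  have h : ∀ c : Fin p, ((univ.filter fun a => F a i = c ∧ F a k = c).card : ℝ) / Fintype.card ι
      = 1 / (p : ℝ) ^ 2 := by
    intro c
    have h0 : x 0 = i := rfl
    have h1 : x 1 = k := rfl
    simp only [← hF 2 le_rfl x fun _ => c, Fin.forall_fin_two, h0, h1]
  have e : (univ.filter fun a => F a i = F a k).card
      = ∑ c : Fin p, (univ.filter fun a => F a i = c ∧ F a k = c).card := by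
    rw [Finset.card_eq_sum_card_fiberwise (f := fun a => F a i) (t := univ) (by simp)]
    refine Finset.sum_congr rfl fun c _ => ?_
    congr 1
    ext a
    simp only [Finset.mem_filter, Finset.mem_univ, true_and]
    constructor
    · rintro ⟨h1, h2⟩
      exact ⟨h2, h1 ▸ h2⟩
    · rintro ⟨h1, h2⟩
      exact ⟨h1.trans h2.symm, h1⟩
  rw [e, Nat.cast_sum, Finset.sum_div, Finset.sum_congr rfl fun c _ => h c]
  simp only [Finset.sum_const, Finset.card_univ, Fintype.card_fin, nsmul_eq_mul]
  rcases Nat.eq_zero_or_pos p with rfl | hp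
  · simp
  · field_simp

/-- Pairwise uniform hashing spreads out nonnegative weights. -/
lemma HashUniform.expect_sum_sq_le {ι : Type*} [Fintype ι] {F : ι → Fin n → Fin p}
    (hF : HashUniform 2 F) {I : Fin n → ℝ} (hI : ∀ i, 0 ≤ I i) :
    𝔼 a, ∑ j, (∑ i ∈ univ.filter (fun i => F a i = j), I i) ^ 2
      ≤ ∑ i, I i ^ 2 + (∑ i, I i) ^ 2 / p := by
  have := hF.nonempty
  have hN : (Fintype.card ι : ℝ) ≠ 0 := by exact_mod_cast Fintype.card_ne_zero
  have e : ∀ a, ∑ j, (∑ i ∈ univ.filter (fun i => F a i = j), I i) ^ 2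
      = ∑ i, ∑ k, (if F a i = F a k then 1 else 0) * (I i * I k) := by
    intro a
    simp only [Finset.sum_filter]
    simp only [sq, Finset.sum_mul_sum]
    rw [Finset.sum_comm]
    refine Finset.sum_congr rfl fun i _ => ?_
    rw [Finset.sum_comm]
    refine Finset.sum_congr rfl fun k _ => ?_
    simp [eq_comm]
  have hprob : ∀ i k, 𝔼 a, (if F a i = F a k then (1 : ℝ) else 0)
      ≤ (if i = k then 1 else 0) + 1 / p := by
    intro i k
    rw [Fintype.expect_eq_sum_div_card, Finset.sum_boole]
    split_ifs with hik
    · subst hik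
      simp only [Finset.filter_true, Finset.card_univ, div_self hN]
      have : (0 : ℝ) ≤ 1 / p := by positivity
      linarith
    · rw [hF.card_collision hik, zero_add]
  simp only [e]
  rw [Finset.expect_sum_comm]
  simp only [Finset.expect_sum_comm univ (univ : Finset (Fin n)), ← Finset.expect_mul]
  calc _ ≤ ∑ i, ∑ k, ((if i = k then 1 else 0) + 1 / (p : ℝ)) * (I i * I k) :=
        Finset.sum_le_sum fun i _ => Finset.sum_le_sum fun k _ =>
          mul_le_mul_of_nonneg_right (hprob i k) (mul_nonneg (hI i) (hI k))
    _ = _ := by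
        simp only [add_mul, Finset.sum_add_distrib, ← Finset.mul_sum, sq, Finset.sum_mul_sum]
        congr 1
        · simp
        · ring

end Influence

end DerandInv

namespace DerandInv

/-! ### The invariance principle -/

section Main

variable {m h n p d : ℕ} {B : Fin (m ^ 2) → Matrix (Fin m) (Fin m) ℂ}

/-- Uniform blocks fed into the generator give a uniform sign vector, so both expectations to be
compared are product expectations over the same blocks. -/
lemma half_pow_mul_sum_eq_prodExp (f : Fin n → Fin p) (Φ : (Fin n → ℤˣ) → ℝ) :
    (1 / 2 : ℝ) ^ n * ∑ b, Φ b = prodExp (fun _ _ => (1 / 2 : ℝ) ^ n) fun w => Φ (gen f w) :=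
  (prodExp_gen (fun _ => foolsDegree_uniform n) f (mem_lowDegree_self fun b => (Φ b : ℂ))
    fun _ => (Complex.ofReal_re _).symm).symm

lemma fourth_moment_touching_le (hB : IsStdBasis m B) (hm : 1 < m) {P : Finset (Fin n) → Op m h}
    (hP : ∀ S, (P S).IsHermitian)
    (hd : ∀ S σ, fourierCoeff B (P S) σ ≠ 0 → S.card + weight σ ≤ d) (s : Finset (Fin n)) :
    (1 / 2 : ℝ) ^ n * ∑ b, (1 / m : ℝ) ^ h * (evalAt (touching P s) b ^ 4).trace.re
      ≤ (9 * m) ^ d * (∑ i ∈ s, varInf P i) ^ 2 := by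
  refine (hypercontractive (d := d) hB hm (touching P s) (isHermitian_touching hP s)
    fun S σ hne => hd S σ fun h0 => hne ?_).trans ?_
  · unfold touching
    split_ifs
    · simp [fourierCoeff]
    · exact h0
  · have h0 : 0 ≤ ∑ S, nnormSq (touching P s S) := Finset.sum_nonneg fun S _ => nnormSq_nonneg _
    gcongr
    exact sum_nnormSq_touching_le P s

/-- The blocks are exchanged one at a time; each costs c/12 times the fourth moment of the part it
touches, which hypercontractivity controls by its influences. -/
lemma abs_prodExp_polynomial_le (hB : IsStdBasis m B) (hm : 1 < m) {P : Finset (Fin n) → Op m h}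
    (hP : ∀ S, (P S).IsHermitian)
    (hd : ∀ S σ, fourierCoeff B (P S) σ ≠ 0 → S.card + weight σ ≤ d) (q : Polynomial ℝ) {R c : ℝ}
    (hR : ∀ (s : Finset (Fin n)) b, ∀ θ ∈ Set.Icc (0 : ℝ) 1,
      spectrum ℝ (evalAt (avoiding P s) b + (θ : ℂ) • evalAt (touching P s) b) ⊆ Set.Ioo (-R) R)
    (hc : 0 ≤ c) (hq : ∀ t ∈ Set.Icc (-R) R, |(Polynomial.derivative^[4] q).eval t| ≤ c)
    (f : Fin n → Fin p) {ρ ρ' : Fin p → (Fin n → ℤˣ) → ℝ} (hρ : ∀ i, FoolsDegree (4 * d) (ρ i))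
    (hρ' : ∀ i, FoolsDegree (4 * d) (ρ' i)) :
    |prodExp ρ (fun w => nTr (fun x => q.eval x) (evalAt P (gen f w)))
        - prodExp ρ' (fun w => nTr (fun x => q.eval x) (evalAt P (gen f w)))|
      ≤ c / 12 * ((9 * m) ^ d * ∑ j, (∑ i ∈ univ.filter (fun i => f i = j), varInf P i) ^ 2) := by
  have hD : ∀ S, P S ≠ 0 → S.card ≤ d := by
    intro S hS
    obtain ⟨σ, hσ⟩ := hB.exists_fourierCoeff_ne_zero hS
    exact (Nat.le_add_right _ _).trans (hd S σ hσ)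
  rw [Finset.mul_sum, Finset.mul_sum]
  refine abs_prodExp_sub_prodExp_le hρ hρ' fun j σ σ' hσ hσ' hne => ?_
  simp only [nTr_eval (isHermitian_evalAt hP _), prodExp_const_mul]
  rw [← mul_sub, abs_mul, abs_of_nonneg (by positivity : (0 : ℝ) ≤ 1 / (m : ℝ) ^ h)]
  have h1 := abs_prodExp_block_le hP hD f j rfl q (hR _) hq hσ hσ' hne
  have h2 := fourth_moment_touching_le hB hm hP hd (univ.filter fun i => f i = j)
  calc _ ≤ 1 / (m : ℝ) ^ h * (c / 12 * ((1 / 2 : ℝ) ^ n *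
        ∑ b, (evalAt (touching P (univ.filter fun i => f i = j)) b ^ 4).trace.re)) := by gcongr
    _ = c / 12 * ((1 / 2 : ℝ) ^ n * ∑ b, (1 / m : ℝ) ^ h *
        (evalAt (touching P (univ.filter fun i => f i = j)) b ^ 4).trace.re) := by
        rw [← Finset.mul_sum, one_div_pow]
        ring
    _ ≤ _ := by gcongr

/-- The invariance principle for a fixed hash function. -/
theorem abs_sub_prodExp_le (hB : IsStdBasis m B) (hm : 1 < m) {P : Finset (Fin n) → Op m h}
    (hP : ∀ S, (P S).IsHermitian)
    (hd : ∀ S σ, fourierCoeff B (P S) σ ≠ 0 → S.card + weight σ ≤ d) {ξ : ℝ → ℝ} {C₀ : ℝ}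
    (hξ : ContDiff ℝ 4 ξ) (hC : ∀ x, |iteratedDeriv 4 ξ x| ≤ C₀) (f : Fin n → Fin p)
    {ρ : Fin p → (Fin n → ℤˣ) → ℝ} (hρ : ∀ i, FoolsDegree (4 * d) (ρ i)) :
    |(1 / 2 : ℝ) ^ n * ∑ b, nTr ξ (evalAt P b) - prodExp ρ fun w => nTr ξ (evalAt P (gen f w))|
      ≤ C₀ / 12 * ((9 * m) ^ d *
        ∑ j, (∑ i ∈ univ.filter (fun i => f i = j), varInf P i) ^ 2) := by
  have hm0 : 0 < m := by omega
  set Y : ℝ := (9 * m) ^ d * ∑ j, (∑ i ∈ univ.filter (fun i => f i = j), varInf P i) ^ 2 with hY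
  have hY0 : 0 ≤ Y := by positivity
  obtain ⟨R, hR0, hR⟩ := exists_spectrum_subset P hP
  have hspec : ∀ b, spectrum ℝ (evalAt P b) ⊆ Set.Icc (-R) R := by
    intro b
    have := hR ∅ b 1 (by simp)
    rw [Complex.ofReal_one, one_smul, evalAt_avoiding_add_touching] at this
    exact this.trans Set.Ioo_subset_Icc_self
  have hυ : ∀ _ : Fin p, FoolsDegree (4 * d) fun _ : Fin n → ℤˣ => (1 / 2 : ℝ) ^ n :=
    fun _ => foolsDegree_uniform _
  have key : ∀ ε > 0, |(1 / 2 : ℝ) ^ n * ∑ b, nTr ξ (evalAt P b)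
      - prodExp ρ fun w => nTr ξ (evalAt P (gen f w))| ≤ (C₀ + ε) / 12 * Y + 2 * ε := by
    intro ε hε
    obtain ⟨q, hq⟩ := exists_polynomial_near_iteratedDeriv 4 hξ hR0 hε
    have hq4 : ∀ t ∈ Set.Icc (-R) R, |(Polynomial.derivative^[4] q).eval t| ≤ C₀ + ε := by
      intro t ht
      have h1 := abs_le.1 (hq t ht).2
      have h2 := abs_le.1 (hC t)
      exact abs_le.2 ⟨by linarith, by linarith⟩
    have hc : 0 ≤ C₀ + ε := (abs_nonneg _).trans (hq4 0 ⟨by linarith, hR0⟩)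
    have hclose : ∀ w : Fin p → Fin n → ℤˣ, |nTr ξ (evalAt P (gen f w))
        - nTr (fun x => q.eval x) (evalAt P (gen f w))| ≤ ε := fun w =>
      abs_nTr_sub_nTr_le hm0 (isHermitian_evalAt hP _) fun x hx => (hq x (hspec _ hx)).1
    have h1 := abs_prodExp_sub_le hυ hclose
    have h2 := abs_prodExp_sub_le hρ hclose
    have h3 := abs_prodExp_polynomial_le hB hm hP hd q hR hc hq4 f hυ hρ
    rw [prodExp_const hυ] at h1
    rw [prodExp_const hρ] at h2
    rw [half_pow_mul_sum_eq_prodExp f]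
    rw [abs_le] at h1 h2 h3 ⊢
    constructor <;> linarith
  refine le_of_forall_pos_le_add fun δ hδ => ?_
  -- This ε solves ε(Y/12 + 2) = δ, the total cost of approximating by polynomials.
  refine (key (δ / (Y / 12 + 2)) (by positivity)).trans (le_of_eq ?_)
  field_simp
  ring

variable {τ : ℝ}

/-- The invariance principle for test functions with bounded fourth derivative. -/
theorem abs_expect_sub_expect_le (hB : IsStdBasis m B) (hm : 1 < m) (hd0 : 0 < d) (hτ : 0 < τ)
    {P : Finset (Fin n) → Op m h} (hP : ∀ S, (P S).IsHermitian)
    (hnorm : 𝔼 b : Fin n → ℤˣ, nnormSq (evalAt P b) ≤ 1)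
    (hdeg : ∀ S, (S.card : WithBot ℕ) + opDegree B (P S) ≤ (d : WithBot ℕ))
    (hinf : ∀ i, varInf P i ≤ τ) (hp : (d : ℝ) / τ ≤ p)
    {ι : Type*} [Fintype ι] {F : ι → Fin n → Fin p} (hF : HashUniform 2 F)
    {Ω : Type*} [MeasurableSpace Ω] {μ : Measure Ω} [IsProbabilityMeasure μ]
    {z : Fin p → Ω → Fin n → ℤˣ} (hz : ∀ i, Measurable (z i)) (hind : iIndepFun z μ)
    (hu : ∀ i, SignUniform μ (4 * d) (z i)) {ξ : ℝ → ℝ} {C₀ : ℝ}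
    (hξ : ContDiff ℝ 4 ξ) (hC : ∀ x, |iteratedDeriv 4 ξ x| ≤ C₀) :
    |(𝔼 b : Fin n → ℤˣ, nTr ξ (evalAt P b))
        - 𝔼 a : ι, ∫ ω, nTr ξ (evalAt P (gen (F a) (fun i => z i ω))) ∂μ|
      ≤ C₀ / 6 * ((9 * m) ^ d * d * τ) := by
  have hC0 : 0 ≤ C₀ := (abs_nonneg _).trans (hC 0)
  have hd : ∀ S σ, fourierCoeff B (P S) σ ≠ 0 → S.card + weight σ ≤ d :=
    fun S σ => card_add_weight_le_of_opDegree (hdeg S)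
  have hD : ∀ S, P S ≠ 0 → S.card ≤ d := by
    intro S hS
    obtain ⟨σ, hσ⟩ := hB.exists_fourierCoeff_ne_zero hS
    exact (Nat.le_add_right _ _).trans (hd S σ hσ)
  have hρ : ∀ i, FoolsDegree (4 * d) fun v => μ.real {ω | z i ω = v} :=
    fun i => (hu i).foolsDegree (hz i)
  have hι := hF.nonempty
  have hd0' : (0 : ℝ) < d := by exact_mod_cast hd0
  have hp0 : (0 : ℝ) < p := (div_pos hd0' hτ).trans_le hp
  have hsum : ∑ i, varInf P i ≤ d := by
    refine (sum_varInf_le hD).trans ?_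
    rw [← sum_nnormSq_evalAt, ← expect_units]
    exact mul_le_of_le_one_right hd0'.le hnorm
  have hsq : ∑ i, varInf P i ^ 2 ≤ d * τ := by
    calc ∑ i, varInf P i ^ 2 ≤ ∑ i, varInf P i * τ := by
          refine Finset.sum_le_sum fun i _ => ?_
          rw [sq]
          exact mul_le_mul_of_nonneg_left (hinf i) (varInf_nonneg P i)
      _ = (∑ i, varInf P i) * τ := by rw [Finset.sum_mul]
      _ ≤ d * τ := by gcongr
  have hsum0 : 0 ≤ ∑ i, varInf P i := Finset.sum_nonneg fun i _ => varInf_nonneg P i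
  -- The total influence is at most d and p ≥ d/τ, so d²/p ≤ dτ.
  have hcoll : (∑ i, varInf P i) ^ 2 / p ≤ d * τ := by
    rw [div_le_iff₀ hp0]
    rw [div_le_iff₀ hτ] at hp
    nlinarith
  have hhash := (hF.expect_sum_sq_le (varInf_nonneg P)).trans (add_le_add hsq hcoll)
  have hrw : ∀ a, ∫ ω, nTr ξ (evalAt P (gen (F a) (fun i => z i ω))) ∂μ
      = prodExp (fun i v => μ.real {ω | z i ω = v}) fun w => nTr ξ (evalAt P (gen (F a) w)) :=
    fun a => integral_eq_prodExp hz hind fun w => nTr ξ (evalAt P (gen (F a) w))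
  simp only [hrw, expect_units]
  rw [← Finset.expect_const (univ_nonempty (α := ι)) ((1 / 2 : ℝ) ^ n * ∑ b, nTr ξ (evalAt P b)),
    ← Finset.expect_sub_distrib]
  refine (Finset.abs_expect_le _ _).trans ?_
  refine (Finset.expect_le_expect fun a _ =>
    abs_sub_prodExp_le hB hm hP hd hξ hC (F a) hρ).trans ?_
  simp only [← Finset.mul_expect]
  -- Diagonal and collision terms contribute dτ each, which turns C₀/12 into C₀/6.
  calc _ ≤ C₀ / 12 * ((9 * m) ^ d * (d * τ + d * τ)) := by gcongr
    _ = _ := by ring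

lemma abs_expect_nTr_sub_le (hm : 0 < m) {P : Finset (Fin n) → Op m h}
    (hP : ∀ S, (P S).IsHermitian) {κ : Type*} [Fintype κ] [Nonempty κ] (b : κ → Fin n → ℤˣ)
    {f g : ℝ → ℝ} {ε : ℝ} (hfg : ∀ x, |f x - g x| ≤ ε) :
    |(𝔼 k, nTr f (evalAt P (b k))) - 𝔼 k, nTr g (evalAt P (b k))| ≤ ε := by
  rw [← Finset.expect_sub_distrib]
  refine (Finset.abs_expect_le _ _).trans (Finset.expect_le univ_nonempty fun k _ => ?_)
  exact abs_nTr_sub_nTr_le hm (isHermitian_evalAt hP _) fun x _ => hfg x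

lemma abs_expect_integral_nTr_sub_le (hm : 0 < m) {P : Finset (Fin n) → Op m h}
    (hP : ∀ S, (P S).IsHermitian) {ι : Type*} [Fintype ι] [Nonempty ι] (F : ι → Fin n → Fin p)
    {Ω : Type*} [MeasurableSpace Ω] {μ : Measure Ω} [IsProbabilityMeasure μ]
    {z : Fin p → Ω → Fin n → ℤˣ} (hz : ∀ i, Measurable (z i)) (hind : iIndepFun z μ)
    (hu : ∀ i, SignUniform μ (4 * d) (z i)) {f g : ℝ → ℝ} {ε : ℝ} (hfg : ∀ x, |f x - g x| ≤ ε) :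
    |(𝔼 a : ι, ∫ ω, nTr f (evalAt P (gen (F a) (fun i => z i ω))) ∂μ)
      - 𝔼 a : ι, ∫ ω, nTr g (evalAt P (gen (F a) (fun i => z i ω))) ∂μ| ≤ ε := by
  have hρ : ∀ i, FoolsDegree (4 * d) fun v => μ.real {ω | z i ω = v} :=
    fun i => (hu i).foolsDegree (hz i)
  have hrw : ∀ (ξ : ℝ → ℝ) a, ∫ ω, nTr ξ (evalAt P (gen (F a) (fun i => z i ω))) ∂μ
      = prodExp (fun i v => μ.real {ω | z i ω = v}) fun w => nTr ξ (evalAt P (gen (F a) w)) :=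
    fun ξ a => integral_eq_prodExp hz hind fun w => nTr ξ (evalAt P (gen (F a) w))
  simp only [hrw]
  rw [← Finset.expect_sub_distrib]
  refine (Finset.abs_expect_le _ _).trans (Finset.expect_le univ_nonempty fun a _ => ?_)
  refine (abs_prodExp_sub_le hρ fun w => abs_nTr_sub_nTr_le hm (isHermitian_evalAt hP _)
    fun x _ => hfg x).trans_eq (prodExp_const hρ ε)

/-- The invariance principle for `ζ`. -/
theorem abs_expect_zeta_sub_expect_le (hB : IsStdBasis m B) (hm : 1 < m) (hd0 : 0 < d)
    (hτ : 0 < τ) {P : Finset (Fin n) → Op m h} (hP : ∀ S, (P S).IsHermitian)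
    (hnorm : 𝔼 b : Fin n → ℤˣ, nnormSq (evalAt P b) ≤ 1)
    (hdeg : ∀ S, (S.card : WithBot ℕ) + opDegree B (P S) ≤ (d : WithBot ℕ))
    (hinf : ∀ i, varInf P i ≤ τ) (hp : (d : ℝ) / τ ≤ p)
    {ι : Type*} [Fintype ι] {F : ι → Fin n → Fin p} (hF : HashUniform 2 F)
    {Ω : Type*} [MeasurableSpace Ω] {μ : Measure Ω} [IsProbabilityMeasure μ]
    {z : Fin p → Ω → Fin n → ℤˣ} (hz : ∀ i, Measurable (z i)) (hind : iIndepFun z μ)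
    (hu : ∀ i, SignUniform μ (4 * d) (z i)) :
    |(𝔼 b : Fin n → ℤˣ, nTr zeta (evalAt P b))
        - 𝔼 a : ι, ∫ ω, nTr zeta (evalAt P (gen (F a) (fun i => z i ω))) ∂μ|
      ≤ 2 * √((9 * m) ^ d * d * τ) := by
  have hι := hF.nonempty
  set K : ℝ := (9 * m) ^ d * d * τ with hK
  have hK0 : 0 < K := by
    have : (0 : ℝ) < m := by exact_mod_cast (by omega : 0 < m)
    have : (0 : ℝ) < d := by exact_mod_cast hd0
    positivity
  have hs : 0 < √K := Real.sqrt_pos.2 hK0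
  -- The choice l² = √K balances the smoothing error l²/4, paid twice, against the invariance error
  -- (15/2)l⁻²K/6 = (5/4)√K. The total is (7/4)√K, within the bound 2√K.
  set l : ℝ := √(√K) with hl
  have hl0 : 0 < l := Real.sqrt_pos.2 hs
  have hl2 : l ^ 2 = √K := Real.sq_sqrt hs.le
  have hnear : ∀ x, |zeta x - smoothZeta l x| ≤ √K / 4 := fun x =>
    hl2 ▸ abs_zeta_sub_smoothZeta_le hl0 x
  have h1 := abs_expect_nTr_sub_le (by omega) hP (fun b : Fin n → ℤˣ => b) hnear
  have h2 := abs_expect_integral_nTr_sub_le (by omega) hP F hz hind hu hnear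
  have h3 := abs_expect_sub_expect_le hB hm hd0 hτ hP hnorm hdeg hinf hp hF hz hind hu
    (contDiff_smoothZeta hl0 4) (abs_iteratedDeriv_smoothZeta_le hl0)
  have h4 : 15 / 2 / l ^ 2 / 6 * K = 5 / 4 * √K := by
    rw [hl2]
    nth_rewrite 2 [← Real.mul_self_sqrt hK0.le]
    field_simp
    norm_num
  rw [← hK, h4] at h3
  rw [abs_le] at h1 h2 h3 ⊢
  constructor <;> linarith

end Main

end DerandInv

theorem mainTheorem6 :
    ∃ C C₁ : ℝ, 0 < C ∧ 0 < C₁ ∧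
      ∀ (d h m n p : ℕ), 0 < d → 0 < h → 1 < m → 0 < n →
      ∀ (B : Fin (m ^ 2) → Matrix (Fin m) (Fin m) ℂ), DerandInv.IsStdBasis m B →
      ∀ (τ : ℝ), 0 < τ →
      ∀ (P : Finset (Fin n) → DerandInv.Op m h),
        (∀ S, (P S).IsHermitian) →
        (𝔼 b : Fin n → ℤˣ, DerandInv.nnormSq (DerandInv.evalAt P b)) ≤ 1 →
        (∀ S, (S.card : WithBot ℕ) + DerandInv.opDegree B (P S) ≤ (d : WithBot ℕ)) →
        (∀ i, DerandInv.varInf P i ≤ τ) →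
        (d : ℝ) / τ ≤ (p : ℝ) →
      ∀ (ι : Type*) [Fintype ι] (F : ι → Fin n → Fin p), DerandInv.HashUniform 2 F →
      ∀ (Ω : Type*) [MeasurableSpace Ω] (μ : Measure Ω) [IsProbabilityMeasure μ]
        (z : Fin p → Ω → Fin n → ℤˣ),
        (∀ i, Measurable (z i)) → iIndepFun z μ →
        (∀ i, DerandInv.SignUniform μ (4 * d) (z i)) →
        |(𝔼 b : Fin n → ℤˣ, DerandInv.nTr DerandInv.zeta (DerandInv.evalAt P b))
            - 𝔼 a : ι, ∫ ω, DerandInv.nTr DerandInv.zeta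
                (DerandInv.evalAt P (DerandInv.gen (F a) (fun i => z i ω))) ∂μ|
          ≤ C * √((9 * (m : ℝ)) ^ d * d * τ) ∧
        ∀ (ξ : ℝ → ℝ) (C₀ : ℝ), ContDiff ℝ 4 ξ → (∀ x, |iteratedDeriv 4 ξ x| ≤ C₀) →
          |(𝔼 b : Fin n → ℤˣ, DerandInv.nTr ξ (DerandInv.evalAt P b))
              - 𝔼 a : ι, ∫ ω, DerandInv.nTr ξ
                  (DerandInv.evalAt P (DerandInv.gen (F a) (fun i => z i ω))) ∂μ|
            ≤ 4 * C₁ * C₀ * (9 * (m : ℝ)) ^ d * d * τ := by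
  -- The smooth case is proved with constant C₀/6, so C₁ = 1 leaves ample room in 4C₁C₀.
  refine ⟨2, 1, by norm_num, by norm_num, ?_⟩
  intro d h m n p hd _ hm _ B hB τ hτ P hP hnorm hdeg hinf hp ι _ F hF Ω _ μ _ z hz hind hu
  refine ⟨DerandInv.abs_expect_zeta_sub_expect_le hB hm hd hτ hP hnorm hdeg hinf hp hF hz hind hu,
    fun ξ C₀ hξ hC => ?_⟩
  refine (DerandInv.abs_expect_sub_expect_le hB hm hd hτ hP hnorm hdeg hinf hp hF hz hind hu
    hξ hC).trans ?_
  have hC0 : 0 ≤ C₀ := (abs_nonneg _).trans (hC 0)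
  have hK : 0 ≤ C₀ * ((9 * (m : ℝ)) ^ d * d * τ) := by positivity
  linarith
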